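/- A \emph{P-finite automaton} of dimension $n$ over a finite alphabet $\Sigma$ is a tuple $\mathcal A=(\alpha,\mu,\beta)$ with $\alpha\in\mathbb Q^{1\times n}$, $\mu:\Sigma\to\mathbb Q[x]^{n\times n}$ and $\beta\in\mathbb Q[x]^{n\times 1}$. For a word $u=\sigma_1\cdots\sigma_k$ put $$B_{\mathcal A}(u)(x)=\mu(\sigma_1)(x)\,\mu(\sigma_2)(x+1)\cdots\mu(\sigma_k)(x+k-1)\,\beta(x+k)\in\mathbb Q[x]^n .$$ The \emph{backward module} of $\mathcal A$ is the $\mathbb Q[x]$-submodule of $\mathbb Q[x]^n$ spanned by all $B_{\mathcal A}(u)$, $u\in\Sigma^*$. Let $d$ be the maximal degree of the entries of $\beta$ and of the matrices $\mu(\sigma)$. The procedure \emph{generators\_backward\_module} works as follows on input $\mathcal A$. Start with $W=\{\varepsilon\}$. First, while there is $(w,\sigma)\in W\times\Sigma$ with $B_{\mathcal A}(\sigma w)\notin\operatorname{span}_{\mathbb Q(x)}\{B_{\mathcal A}(u):u\in W\}$, add $\sigma w$ to $W$ for some such pair. Then, while there is $(w,\sigma)\in W\times\Sigma$ with $B_{\mathcal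 A}(\sigma w)\notin\operatorname{span}_{\mathbb Q[x]}\{B_{\mathcal A}(u):u\in W\}$, add $\sigma w$ to $W$ for some such pair. Finally return $\{B_{\mathcal A}(u):u\in W\}$. \textbf{Theorem.} On every P-finite automaton $\mathcal A$, and whatever pairs are chosen in the loops, the procedure terminates and returns a finite set that generates the backward module of $\mathcal A$. Throughout the execution $|W|\le \max(1,\,n\,d(n+1)+n)$, and $|W|\le n\,d(n+1)+n-1$ if $n\ge 1$ and $d\ge 1$. The procedure runs in time polynomial in the length of the encoding of $\mathcal A$: there are one program and one polynomial $p$ such that, for every $\mathcal A$ and every resolution of the choices of the program, the program halts on the encoding of $\mathcal A$ within time $p(\text{length of the encoding})$ and outputs the list of vectors $B_{\mathcal A}(u)$, $u\in W$, in order of insertion, of some complete execution of the procedure; and the output list of every complete execution arises in this way. Here polynomials are encoded by the list of all their coefficients up to the degree, and rational numbers by numerator and denominator in lowest terms, written in binary; programs are (nondeterministic) \texttt{while} programs on S-expressions with integer atoms, whose instructions (projections, pairing, tests, integer addition, subtraction, multiplication, division and comparison, binary choice) each cost one plus the length of the value they are applied to (plus the length of the constant, for a constant). -/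

import Mathlib

open Polynomial

namespace PFinite

noncomputable section

/-! ### P-finite automata and their backward modules -/

/-- The polynomial `p (x + k)`. -/
def shift (k : ℕ) (p : ℚ[X]) : ℚ[X] := p.comp (X + C (k : ℚ))

/-- A P-finite automaton of dimension `n` over the alphabet `Fin s`. -/
structure Automaton (n s : ℕ) where
  /-- the initial row vector -/
  init : Fin n → ℚ
  /-- the transition function -/
  trans : Fin s → Matrix (Fin n) (Fin n) ℚ[X]
  /-- the final column vector -/
  final : Fin n → ℚ[X]

variable {n s : ℕ}

/-- `A.transFrom k (σ₁ … σₘ) = μ(σ₁, x + k) μ(σ₂, x + k + 1) ⋯ μ(σₘ, x + k + m - 1)`. -/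
def Automaton.transFrom (A : Automaton n s) : ℕ → List (Fin s) → Matrix (Fin n) (Fin n) ℚ[X]
  | _, [] => 1
  | k, σ :: w => (A.trans σ).map (shift k) * A.transFrom (k + 1) w

/-- The extension `μ(w, x)` of the transition function to words. -/
def Automaton.transWord (A : Automaton n s) (w : List (Fin s)) : Matrix (Fin n) (Fin n) ℚ[X] :=
  A.transFrom 0 w

theorem Automaton.transWord_nil (A : Automaton n s) : A.transWord [] = 1 := rfl

theorem Automaton.transFrom_append_singleton (A : Automaton n s) (σ : Fin s) (w : List (Fin s)) :
    ∀ k : ℕ, A.transFrom k (w ++ [σ]) =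
      A.transFrom k w * (A.trans σ).map (shift (k + w.length)) := by
  induction w with
  | nil => intro k; simp [Automaton.transFrom]
  | cons a w ih =>
    intro k
    have h : k + 1 + w.length = k + (w.length + 1) := by omega
    simp [Automaton.transFrom, ih, Matrix.mul_assoc, h]

/-- The recursion `μ(wσ, x) = μ(w, x) μ(σ, x + |w|)`. -/
theorem Automaton.transWord_append_singleton (A : Automaton n s) (w : List (Fin s)) (σ : Fin s) :
    A.transWord (w ++ [σ]) = A.transWord w * (A.trans σ).map (shift w.length) := by
  simpa [Automaton.transWord] using A.transFrom_append_singleton σ w 0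

/-- The backward function `u ↦ μ(u, x) β(x + |u|)`. -/
def Automaton.backward (A : Automaton n s) (u : List (Fin s)) : Fin n → ℚ[X] :=
  (A.transWord u).mulVec fun i => shift u.length (A.final i)

/-- The backward module: the `ℚ[x]`-span of all values of the backward function. -/
def Automaton.backwardModule (A : Automaton n s) : Submodule ℚ[X] (Fin n → ℚ[X]) :=
  Submodule.span ℚ[X] (Set.range A.backward)

/-- The maximal degree of the entries of the transition matrices and of the final vector. -/
def Automaton.degree (A : Automaton n s) : ℕ :=
  max (Finset.univ.sup fun σ => Finset.univ.sup fun i => Finset.univ.sup fun j =>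
      (A.trans σ i j).natDegree)
    (Finset.univ.sup fun i => (A.final i).natDegree)

/-! ### The procedure

Its variable `W`, a finite set of words, is kept as the list of its elements in the order in which
they were added.  Which pair `(w, σ)` satisfying the loop guard is used is left open, so the
procedure is a nondeterministic transition system. -/

/-- A vector of polynomials viewed as a vector of rational functions. -/
def toRatFunc (v : Fin n → ℚ[X]) : Fin n → RatFunc ℚ :=
  fun i => algebraMap ℚ[X] (RatFunc ℚ) (v i)

/-- The guard of the first loop: the backward vector of `u` is not in the `ℚ(x)`-span of those
of the words in `W`. -/
def Automaton.RaisesRank (A : Automaton n s) (W : List (List (Fin s))) (u : List (Fin s)) : Prop :=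
  toRatFunc (A.backward u) ∉
    Submodule.span (RatFunc ℚ) {y | ∃ w ∈ W, y = toRatFunc (A.backward w)}

/-- The guard of the second loop: the backward vector of `u` is not in the `ℚ[x]`-span of those
of the words in `W`. -/
def Automaton.EnlargesModule (A : Automaton n s) (W : List (List (Fin s))) (u : List (Fin s)) :
    Prop :=
  A.backward u ∉ Submodule.span ℚ[X] {y | ∃ w ∈ W, y = A.backward w}

/-- The two `while` loops. -/
inductive Phase
  | first
  | second

/-- A state of the procedure: the loop it is in, and the value of `W`. -/
structure State (s : ℕ) where
  /-- the current loop -/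
  phase : Phase
  /-- the words collected so far -/
  words : List (List (Fin s))

/-- The initial state: `W = {ε}`, at the first loop. -/
def State.start (s : ℕ) : State s := ⟨Phase.first, [[]]⟩

/-- One step of the procedure: an iteration of one of the loops, or the exit from the first. -/
inductive Automaton.Step (A : Automaton n s) : State s → State s → Prop
  | rank (W : List (List (Fin s))) (w : List (Fin s)) (σ : Fin s) (hw : w ∈ W)
      (hg : A.RaisesRank W (σ :: w)) :
      A.Step ⟨Phase.first, W⟩ ⟨Phase.first, W ++ [σ :: w]⟩
  | exit (W : List (List (Fin s)))
      (hg : ∀ w ∈ W, ∀ σ : Fin s, ¬ A.RaisesRank W (σ :: w)) :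
      A.Step ⟨Phase.first, W⟩ ⟨Phase.second, W⟩
  | enlarge (W : List (List (Fin s))) (w : List (Fin s)) (σ : Fin s) (hw : w ∈ W)
      (hg : A.EnlargesModule W (σ :: w)) :
      A.Step ⟨Phase.second, W⟩ ⟨Phase.second, W ++ [σ :: w]⟩

/-- The states that occur in some execution of the procedure on `A`. -/
def Automaton.Reachable (A : Automaton n s) (q : State s) : Prop :=
  Relation.ReflTransGen A.Step (State.start s) q

/-- Some execution of the procedure on `A` exits its second loop, and hence returns, with the
words `W` (in this order of insertion). -/
def Automaton.Returns (A : Automaton n s) (W : List (List (Fin s))) : Prop :=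
  A.Reachable ⟨Phase.second, W⟩ ∧ ∀ w ∈ W, ∀ σ : Fin s, ¬ A.EnlargesModule W (σ :: w)

/-- The output of the procedure: the backward vectors of the collected words. -/
def Automaton.output (A : Automaton n s) (W : List (List (Fin s))) : List (Fin n → ℚ[X]) :=
  W.map A.backward

/-! ### Machine model: `while` programs on S-expressions with integer atoms, at logarithmic cost -/

/-- Values: S-expressions whose atoms are integers. -/
inductive Val
  | int (z : ℤ)
  | pair (a b : Val)

namespace Val

/-- The length of a value, its integers being written in binary. -/
def size : Val → ℕ
  | int z => 1 + Nat.size z.natAbs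
  | pair a b => 1 + a.size + b.size

/-- First component (`0` for an atom). -/
def fst : Val → Val
  | int _ => int 0
  | pair a _ => a

/-- Second component (`0` for an atom). -/
def snd : Val → Val
  | int _ => int 0
  | pair _ b => b

/-- The integer at an atom (`0` for a pair). -/
def toInt : Val → ℤ
  | int z => z
  | pair _ _ => 0

/-- `1` for a pair and `0` for an atom. -/
def isPair : Val → Val
  | int _ => int 0
  | pair _ _ => int 1

end Val

/-- Primitive operations. -/
inductive Op
  | id
  | fst
  | snd
  | isPair
  | add
  | sub
  | mul
  | div
  | le

/-- The effect of a primitive operation; the arithmetical ones act on a pair of integers, division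
is integer division, and a comparison returns `1` or `0`. -/
def Op.eval : Op → Val → Val
  | .id, v => v
  | .fst, v => v.fst
  | .snd, v => v.snd
  | .isPair, v => v.isPair
  | .add, v => .int (v.fst.toInt + v.snd.toInt)
  | .sub, v => .int (v.fst.toInt - v.snd.toInt)
  | .mul, v => .int (v.fst.toInt * v.snd.toInt)
  | .div, v => .int (v.fst.toInt / v.snd.toInt)
  | .le, v => .int (if v.fst.toInt ≤ v.snd.toInt then 1 else 0)

/-- Programs; each one transforms one value into another. -/
inductive Prog
  | op (o : Op)
  | const (z : ℤ)
  /-- run both programs on the input and pair the results -/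
  | pair (f g : Prog)
  /-- run `f`, then `g` on its result -/
  | seq (f g : Prog)
  /-- `if c then f else g`; a test holds when its result is not the atom `0` -/
  | ite (c f g : Prog)
  /-- `while c do f` -/
  | loop (c f : Prog)
  /-- nondeterministic choice of one component of a pair -/
  | choose

/-- `Runs pick P v r t`: on input `v`, the program `P` halts with result `r` after time `t`, when
its nondeterministic choices are resolved by `pick` (`true` selects the first component).  Every
instruction that is executed costs one plus the length of the value it is applied to, and the
length of a constant is charged too. -/
inductive Runs (pick : Val → Bool) : Prog → Val → Val → ℕ → Prop
  | op (o : Op) (v : Val) : Runs pick (.op o) v (o.eval v) (1 + v.size)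
  | const (z : ℤ) (v : Val) : Runs pick (.const z) v (.int z) (1 + v.size + (Val.int z).size)
  | pair {f g : Prog} {v a b : Val} {t₁ t₂ : ℕ} (hf : Runs pick f v a t₁)
      (hg : Runs pick g v b t₂) :
      Runs pick (.pair f g) v (.pair a b) (1 + v.size + t₁ + t₂)
  | seq {f g : Prog} {v a b : Val} {t₁ t₂ : ℕ} (hf : Runs pick f v a t₁)
      (hg : Runs pick g a b t₂) :
      Runs pick (.seq f g) v b (1 + v.size + t₁ + t₂)
  | iteTrue {c f g : Prog} {v b r : Val} {t₁ t₂ : ℕ} (hc : Runs pick c v b t₁)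
      (hb : b ≠ .int 0) (hf : Runs pick f v r t₂) :
      Runs pick (.ite c f g) v r (1 + v.size + t₁ + t₂)
  | iteFalse {c f g : Prog} {v r : Val} {t₁ t₂ : ℕ} (hc : Runs pick c v (.int 0) t₁)
      (hg : Runs pick g v r t₂) :
      Runs pick (.ite c f g) v r (1 + v.size + t₁ + t₂)
  | loopStep {c f : Prog} {v b v' r : Val} {t₁ t₂ t₃ : ℕ} (hc : Runs pick c v b t₁)
      (hb : b ≠ .int 0) (hf : Runs pick f v v' t₂) (hl : Runs pick (.loop c f) v' r t₃) :
      Runs pick (.loop c f) v r (1 + v.size + t₁ + t₂ + t₃)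
  | loopDone {c f : Prog} {v : Val} {t₁ : ℕ} (hc : Runs pick c v (.int 0) t₁) :
      Runs pick (.loop c f) v v (1 + v.size + t₁)
  | choose (v : Val) :
      Runs pick .choose v (if pick v then v.fst else v.snd) (1 + v.size)

/-! ### Encodings -/

/-- Lists are right-nested pairs that end in the atom `0`. -/
def encList : List Val → Val
  | [] => .int 0
  | v :: l => .pair v (encList l)

/-- A rational number as numerator and denominator in lowest terms. -/
def encRat (q : ℚ) : Val := .pair (.int q.num) (.int q.den)

/-- A polynomial as the list of its coefficients up to its degree, constant term first. -/
def encPoly (p : ℚ[X]) : Val :=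
  encList ((List.range (p.natDegree + 1)).map fun k => encRat (p.coeff k))

/-- A polynomial vector as the list of its entries. -/
def encVec (v : Fin n → ℚ[X]) : Val := encList (List.ofFn fun i => encPoly (v i))

/-- A polynomial matrix as the list of its rows. -/
def encMatrix (M : Matrix (Fin n) (Fin n) ℚ[X]) : Val := encList (List.ofFn fun i => encVec (M i))

/-- The encoding of an automaton: initial vector, transition matrices, final vector. -/
def Automaton.encode (A : Automaton n s) : Val :=
  .pair (encList (List.ofFn fun i => encRat (A.init i)))
    (.pair (encList (List.ofFn fun σ => encMatrix (A.trans σ))) (encVec A.final))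

/-- The encoding of a list of polynomial vectors. -/
def encVecs (L : List (Fin n → ℚ[X])) : Val := encList (L.map encVec)

end

end PFinite

open PFinite

namespace PFinite

noncomputable section

/-! ### Polynomial-time functions between encoded types -/

/-! Let `push σ` send `v(x)` to `μ(σ)(x) v(x+1)`. Then `B(σw) = push σ (B(w))`, and `push σ` is
semilinear: `push σ (p v) = p(x+1) push σ v`. A span over `ℚ[x]` or `ℚ(x)` is therefore stable under
all `push σ` once the images of its generators lie in it. When the second loop ends, the span over
`ℚ[x]` contains `β` and is stable, so it is the backward module (`Automaton.Returns.span_eq`).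

Number of words. Each word of the first loop raises the rank, so that loop collects at most
`max(1,n)` words. At its exit the rational span is stable, so the second loop never leaves it. A
maximal independent set of the vectors found so far, completed by unit vectors, forms a nonsingular
matrix (`exists_adapted`). A vector outside a module of full rank can be exchanged, after division
with remainder, for a row so that the degree of the determinant drops (`exists_smaller_det`). Hence
the second loop adds at most `deg det` words (`Adapted.chain_length_le`). The words of the first
loop are shorter than `max(1,n)`, their vectors have degree at most `d·max(1,n)`, and so `deg det ≤
n·d·max(1,n)`. This bounds every execution.

Running time. `PT` and `PD` form a calculus of polynomial-time functions on encoded data, closed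
under composition, case distinction, choice and folds whose intermediate results stay polynomially
small. Arithmetic of rationals and polynomials is built in it. The guards are decided by linear
algebra over `ℚ`: Cramer's rule bounds the degrees of the coefficients in a membership relation
(`mem_boundedSpan_of_mem_span`, `X_pow_smul_mem_of_mem_span`), and vectors of bounded degree are
packed into single polynomials. Membership in a span over `ℚ` is tested by Gram-Schmidt without
normalisation. Its numbers stay small because an orthogonal component depends only on the span and
the vector, hence is given by determinants of Gram matrices (`isRes_height`). The backward vectors
themselves have small numbers because a common denominator of the input is raised to a power linear
in the word length (`backward_height`).

The program runs each loop for a fixed number `fuel` of rounds, idle once the guard fails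
everywhere. Every resolution of its choices yields a complete execution (`procedure_spec`).
Conversely, for a prescribed output the choice function `follow` reads from each pair of
alternatives which one leads to that output (`procedure_follow`). -/

/-- A type whose elements are encoded as values. -/
class Enc (α : Type) where
  /-- the encoding -/
  enc : α → Val

/-- The length of the encoding. -/
def sz {α : Type} [Enc α] (a : α) : ℕ := (Enc.enc a).size

instance : Enc ℤ := ⟨Val.int⟩
instance : Enc Unit := ⟨fun _ => Val.int 0⟩
instance : Enc Bool := ⟨fun b => Val.int (if b then 1 else 0)⟩
instance {α β : Type} [Enc α] [Enc β] : Enc (α × β) :=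
  ⟨fun a => Val.pair (Enc.enc a.1) (Enc.enc a.2)⟩
instance {α : Type} [Enc α] : Enc (List α) := ⟨fun l => encList (l.map Enc.enc)⟩

theorem Val.size_pos (v : Val) : 1 ≤ v.size := by cases v <;> (simp [Val.size]; try omega)

theorem eval_mono (p : ℕ[X]) {a b : ℕ} (h : a ≤ b) : p.eval a ≤ p.eval b := by
  rw [eval_eq_sum_range, eval_eq_sum_range]
  gcongr

variable {α β γ δ : Type} [Enc α] [Enc β] [Enc γ] [Enc δ]

theorem sz_pos (a : α) : 1 ≤ sz a := Val.size_pos _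

theorem sz_pair (a : α) (b : β) : sz (a, b) = 1 + sz a + sz b := rfl

theorem sz_nil : sz ([] : List α) = 1 := by
  simp [sz, Enc.enc, encList, Val.size]

theorem sz_cons (a : α) (l : List α) : sz (a :: l) = 1 + sz a + sz l := rfl

theorem sz_append (l m : List α) : sz (l ++ m) + 1 = sz l + sz m := by
  induction l with
  | nil => simp [sz_nil]; omega
  | cons a l ih => simp only [List.cons_append, sz_cons]; omega

theorem sz_eq_sum (l : List α) : sz l = 1 + (l.map fun a => 1 + sz a).sum := by
  induction l with
  | nil => simp [sz_nil]
  | cons a l ih => simp only [sz_cons, List.map_cons, List.sum_cons, ih]; omega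

theorem sz_mem {a : α} {l : List α} (h : a ∈ l) : sz a + 1 ≤ sz l := by
  induction l with
  | nil => simp at h
  | cons b l ih =>
    rw [sz_cons]
    rcases List.mem_cons.1 h with rfl | h
    · have := sz_pos l; omega
    · have := ih h; omega

theorem length_le_sz (l : List α) : l.length ≤ sz l := by
  induction l with
  | nil => simp
  | cons b l ih => rw [sz_cons, List.length_cons]; omega

theorem sz_le_mul (l : List α) (B : ℕ) (h : ∀ a ∈ l, sz a ≤ B) :
    sz l ≤ 1 + l.length * (1 + B) := by
  induction l with
  | nil => simp [sz_nil]
  | cons b l ih =>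
    rw [sz_cons, List.length_cons]
    have h1 := h b (by simp)
    have h2 := ih fun a ha => h a (by simp [ha])
    nlinarith

theorem sz_sublist {l m : List α} (h : l.Sublist m) : sz l ≤ sz m := by
  induction h with
  | slnil => rfl
  | cons a _ ih => rw [sz_cons]; omega
  | cons_cons a _ ih => rw [sz_cons, sz_cons]; omega

/-! #### Polynomially bounded quantities -/

/-- `f` is bounded by a polynomial in the length of the encoding. -/
def PB (f : α → ℕ) : Prop := ∃ p : ℕ[X], ∀ a, f a ≤ p.eval (sz a)

theorem PB.mono {f g : α → ℕ} (hg : PB g) (h : ∀ a, f a ≤ g a) : PB f :=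
  let ⟨p, hp⟩ := hg; ⟨p, fun a => (h a).trans (hp a)⟩

theorem PB.const (c : ℕ) : PB fun _ : α => c := ⟨C c, fun a => by simp⟩

theorem PB.size : PB fun a : α => sz a := ⟨X, fun a => by simp⟩

theorem PB.add {f g : α → ℕ} (hf : PB f) (hg : PB g) : PB fun a => f a + g a :=
  let ⟨p, hp⟩ := hf; let ⟨q, hq⟩ := hg
  ⟨p + q, fun a => by rw [eval_add]; exact Nat.add_le_add (hp a) (hq a)⟩

theorem PB.mul {f g : α → ℕ} (hf : PB f) (hg : PB g) : PB fun a => f a * g a :=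
  let ⟨p, hp⟩ := hf; let ⟨q, hq⟩ := hg
  ⟨p * q, fun a => by rw [eval_mul]; exact Nat.mul_le_mul (hp a) (hq a)⟩

theorem PB.poly {f : α → ℕ} (hf : PB f) (q : ℕ[X]) : PB fun a => q.eval (f a) :=
  let ⟨p, hp⟩ := hf
  ⟨q.comp p, fun a => by rw [eval_comp]; exact eval_mono q (hp a)⟩

/-! #### Polynomial time -/

/-- `f pick` is computed in polynomial time by one program, for all `pick`. -/
def PT (f : (Val → Bool) → α → β) : Prop :=
  ∃ (P : Prog) (p : ℕ[X]), ∀ pick a, ∃ t,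
    Runs pick P (Enc.enc a) (Enc.enc (f pick a)) t ∧ t ≤ p.eval (sz a)

/-- Deterministic polynomial time. -/
@[fun_prop]
def PD (f : α → β) : Prop := PT fun _ => f

/-- Each instruction is charged for its input, and no primitive operation lengthens its input by
more than one. Time bounds thus bound outputs, which is what lets polynomial-time functions compose.
-/
theorem Runs.size_le {pick : Val → Bool} {P : Prog} {v r : Val} {t : ℕ} (h : Runs pick P v r t) :
    r.size ≤ t := by
  have hfst : ∀ v : Val, v.fst.size ≤ v.size := by
    rintro (z | ⟨a, b⟩) <;> simp [Val.fst, Val.size]; omega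
  have hsnd : ∀ v : Val, v.snd.size ≤ v.size := by
    rintro (z | ⟨a, b⟩) <;> simp [Val.snd, Val.size]
  have key : ∀ v : Val, 1 + Nat.size (v.fst.toInt.natAbs) + Nat.size (v.snd.toInt.natAbs)
      ≤ v.size := by
    rintro (z | ⟨a, b⟩)
    · simp [Val.fst, Val.snd, Val.toInt, Val.size]
    · rcases a with a | a <;> rcases b with b | b <;>
        simp [Val.fst, Val.snd, Val.toInt, Val.size] <;> omega
  induction h with
  | op o v =>
    have hk := key v
    set a := v.fst.toInt
    set b := v.snd.toInt
    have ha := Nat.lt_size_self a.natAbs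
    have hb := Nat.lt_size_self b.natAbs
    have h2 : ∀ m : ℕ, m ≤ max (Nat.size a.natAbs) (Nat.size b.natAbs) →
        2 ^ m ≤ 2 ^ (Nat.size a.natAbs + Nat.size b.natAbs) := fun m hm =>
      Nat.pow_le_pow_right (by norm_num) (by omega)
    have h3 := h2 (Nat.size a.natAbs) (by simp)
    have h4 := h2 (Nat.size b.natAbs) (by simp)
    -- A result of absolute value at most `|a| + |b|` needs at most one bit more than the two
    -- operands together. This covers sums, differences and quotients.
    have fin : ∀ z : ℤ, z.natAbs ≤ a.natAbs + b.natAbs → (Val.int z).size ≤ 1 + v.size := by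
      intro z hz
      have : Nat.size z.natAbs ≤ 1 + (Nat.size a.natAbs + Nat.size b.natAbs) := by
        rw [Nat.size_le, pow_add]
        omega
      simp only [Val.size]; omega
    cases o with
    | id => simp [Op.eval]
    | fst => have := hfst v; simp only [Op.eval]; omega
    | snd => have := hsnd v; simp only [Op.eval]; omega
    | isPair =>
      rcases v with z | ⟨x, y⟩
      · simp [Op.eval, Val.isPair, Val.size]
      · have := x.size_pos; have := y.size_pos
        simp [Op.eval, Val.isPair, Val.size]; omega
    | add => exact fin _ (Int.natAbs_add_le _ _)
    | sub => exact fin _ (Int.natAbs_sub_le _ _)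
    | mul =>
      simp only [Op.eval, Val.size]
      have : Nat.size (a * b).natAbs ≤ Nat.size a.natAbs + Nat.size b.natAbs := by
        rw [Nat.size_le, pow_add, Int.natAbs_mul]
        exact Nat.mul_lt_mul'' ha hb
      change 1 + Nat.size (a * b).natAbs ≤ _
      omega
    | div =>
      refine fin _ ?_
      have := Int.natAbs_ediv_le_natAbs a b
      change (a / b).natAbs ≤ _
      omega
    | le =>
      have := v.size_pos
      simp only [Op.eval]
      split_ifs <;> simp [Val.size] <;> omega
  | const z v => omega
  | pair _ _ h1 h2 => simp only [Val.size]; omega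
  | seq _ _ h1 h2 => omega
  | iteTrue _ _ _ h1 h2 => omega
  | iteFalse _ _ h1 h2 => omega
  | loopStep _ _ _ _ h1 h2 h3 => omega
  | loopDone _ h => omega
  | choose v =>
    have := hfst v; have := hsnd v
    split_ifs <;> omega

theorem PT.bound {f : (Val → Bool) → α → β} (hf : PT f) :
    ∃ g : α → ℕ, PB g ∧ ∀ pick a, sz (f pick a) ≤ g a :=
  let ⟨_, p, h⟩ := hf
  ⟨fun a => p.eval (sz a), ⟨p, fun _ => le_rfl⟩, fun pick a =>
    let ⟨_, h1, h2⟩ := h pick a; h1.size_le.trans h2⟩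

theorem PD.bound {f : α → β} (hf : PD f) : PB fun a => sz (f a) :=
  let ⟨_, hg, h⟩ := PT.bound hf
  hg.mono fun a => h (fun _ => true) a

/-- It suffices to bound the running time by a polynomially bounded quantity. -/
theorem PT.intro {f : (Val → Bool) → α → β} (P : Prog) {g : α → ℕ} (hg : PB g)
    (h : ∀ pick a, ∃ t, Runs pick P (Enc.enc a) (Enc.enc (f pick a)) t ∧ t ≤ g a) : PT f :=
  let ⟨p, hp⟩ := hg
  ⟨P, p, fun pick a => let ⟨t, h1, h2⟩ := h pick a; ⟨t, h1, h2.trans (hp a)⟩⟩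

theorem PT.elim {f : (Val → Bool) → α → β} (hf : PT f) : ∃ (P : Prog) (g : α → ℕ), PB g ∧
    ∀ pick a, ∃ t, Runs pick P (Enc.enc a) (Enc.enc (f pick a)) t ∧ t ≤ g a :=
  let ⟨P, p, h⟩ := hf
  ⟨P, fun a => p.eval (sz a), ⟨p, fun _ => le_rfl⟩, h⟩

/-- Functions that agree on encodings. -/
theorem PT.congr_enc {α' β' : Type} [Enc α'] [Enc β'] {f : (Val → Bool) → α → β} (hf : PT f)
    {f' : (Val → Bool) → α' → β'} (φ : α' → α) (hφ : ∀ a, Enc.enc a = Enc.enc (φ a))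
    (h : ∀ pick a, Enc.enc (f' pick a) = Enc.enc (f pick (φ a))) : PT f' := by
  obtain ⟨P, p, H⟩ := hf
  refine ⟨P, p, fun pick a => ?_⟩
  rw [h, hφ, sz, hφ]
  exact H pick (φ a)

/-- A function that does not change the encoding. -/
theorem PD.of_enc_eq {f : α → β} (h : ∀ a, Enc.enc (f a) = Enc.enc a) : PD f :=
  PT.intro (.op .id) ((PB.const 1).add PB.size) fun pick a => ⟨_, by
    rw [h]; exact Runs.op .id _, le_rfl⟩

@[fun_prop]
theorem PD.id : PD fun a : α => a := PD.of_enc_eq fun _ => rfl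

theorem PT.comp {g : (Val → Bool) → β → γ} {f : (Val → Bool) → α → β} (hg : PT g) (hf : PT f) :
    PT fun k a => g k (f k a) := by
  obtain ⟨u, hu, hu'⟩ := hf.bound
  obtain ⟨P, p, hP⟩ := hf
  obtain ⟨Q, q, hQ⟩ := hg
  refine PT.intro (.seq P Q) (g := fun a => 1 + sz a + p.eval (sz a) + q.eval (u a))
    (((PB.const 1).add PB.size |>.add (PB.size.poly p)).add (hu.poly q)) fun pick a => ?_
  obtain ⟨t1, h1, h1'⟩ := hP pick a
  obtain ⟨t2, h2, h2'⟩ := hQ pick (f pick a)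
  refine ⟨_, Runs.seq h1 h2, ?_⟩
  have := eval_mono q (hu' pick a)
  change 1 + sz a + t1 + t2 ≤ _
  omega

@[fun_prop]
theorem PD.comp {g : β → γ} {f : α → β} (hg : PD g) (hf : PD f) : PD fun a => g (f a) :=
  PT.comp hg hf

theorem PT.pair {f : (Val → Bool) → α → β} {g : (Val → Bool) → α → γ} (hf : PT f) (hg : PT g) :
    PT fun k a => (f k a, g k a) := by
  obtain ⟨P, p, hp, hP⟩ := hf.elim
  obtain ⟨Q, q, hq, hQ⟩ := hg.elim
  refine PT.intro (.pair P Q) (((PB.const 1).add PB.size).add hp |>.add hq) fun pick a => ?_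
  obtain ⟨t1, h1, h1'⟩ := hP pick a
  obtain ⟨t2, h2, h2'⟩ := hQ pick a
  refine ⟨_, Runs.pair h1 h2, ?_⟩
  change 1 + sz a + t1 + t2 ≤ _
  omega

@[fun_prop]
theorem PD.pair {f : α → β} {g : α → γ} (hf : PD f) (hg : PD g) : PD fun a => (f a, g a) :=
  PT.pair hf hg

theorem PD.op_eval (o : Op) {f : α → β} (h : ∀ a, Enc.enc (f a) = o.eval (Enc.enc a)) : PD f :=
  PT.intro (.op o) ((PB.const 1).add PB.size) fun pick a => ⟨_, by
    rw [h]; exact Runs.op o _, le_rfl⟩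

@[fun_prop]
theorem PD.fst {f : α → β × γ} (hf : PD f) : PD fun a => (f a).1 :=
  PD.comp (g := Prod.fst) (PD.op_eval .fst fun _ => rfl) hf

@[fun_prop]
theorem PD.snd {f : α → β × γ} (hf : PD f) : PD fun a => (f a).2 :=
  PD.comp (g := Prod.snd) (PD.op_eval .snd fun _ => rfl) hf

theorem exists_const_prog (r : Val) : ∃ (P : Prog) (c : ℕ), ∀ pick v, ∃ t,
    Runs pick P v r t ∧ t ≤ c * (1 + v.size) := by
  induction r with
  | int z =>
    refine ⟨.const z, 1 + (Val.int z).size, fun pick v => ⟨_, Runs.const z v, ?_⟩⟩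
    nlinarith [Nat.zero_le ((Val.int z).size * v.size)]
  | pair a b iha ihb =>
    obtain ⟨P, c, hP⟩ := iha
    obtain ⟨Q, d, hQ⟩ := ihb
    refine ⟨.pair P Q, 1 + c + d, fun pick v => ?_⟩
    obtain ⟨t1, h1, h1'⟩ := hP pick v
    obtain ⟨t2, h2, h2'⟩ := hQ pick v
    exact ⟨_, Runs.pair h1 h2, by nlinarith⟩

@[fun_prop]
theorem PD.const (b : β) : PD fun _ : α => b := by
  obtain ⟨P, c, h⟩ := exists_const_prog (Enc.enc b)
  exact PT.intro P ((PB.const c).mul ((PB.const 1).add PB.size)) fun pick a => h pick _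

theorem PT.ite {c : α → Bool} {f g : (Val → Bool) → α → β} (hc : PD c) (hf : PT f) (hg : PT g) :
    PT fun k a => if c a = true then f k a else g k a := by
  obtain ⟨R, r, hr, hR⟩ := PT.elim hc
  obtain ⟨P, p, hp, hP⟩ := hf.elim
  obtain ⟨Q, q, hq, hQ⟩ := hg.elim
  refine PT.intro (.ite R P Q) ((((PB.const 1).add PB.size).add hr |>.add hp).add hq)
    fun pick a => ?_
  obtain ⟨t0, h0, h0'⟩ := hR pick a
  obtain ⟨t1, h1, h1'⟩ := hP pick a
  obtain ⟨t2, h2, h2'⟩ := hQ pick a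
  cases hca : c a with
  | true =>
    refine ⟨_, Runs.iteTrue h0 ?_ (by simpa [hca] using h1), ?_⟩
    · simp [Enc.enc, hca]
    · change 1 + sz a + t0 + t1 ≤ _; omega
  | false =>
    refine ⟨_, Runs.iteFalse (t₁ := t0) ?_ (by simpa [hca] using h2), ?_⟩
    · simpa [Enc.enc, hca] using h0
    · change 1 + sz a + t0 + t2 ≤ _; omega

theorem PD.ite {c : α → Bool} {f g : α → β} (hc : PD c) (hf : PD f) (hg : PD g) :
    PD fun a => if c a = true then f a else g a := PT.ite hc hf hg

@[fun_prop]
theorem PD.not {c : α → Bool} (hc : PD c) : PD fun a => !(c a) := by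
  have : (fun a => !(c a)) = fun a => if c a = true then false else true := by
    funext a; cases c a <;> rfl
  rw [this]; exact hc.ite (PD.const _) (PD.const _)

@[fun_prop]
theorem PD.and {c d : α → Bool} (hc : PD c) (hd : PD d) : PD fun a => (c a && d a) := by
  have : (fun a => (c a && d a)) = fun a => if c a = true then d a else false := by
    funext a; cases c a <;> rfl
  rw [this]; exact hc.ite hd (PD.const _)

/-- The nondeterministic choice between `f` and `g`. -/
theorem PT.choose {f g : (Val → Bool) → α → β} (hf : PT f) (hg : PT g) :
    PT fun k a => if k (.pair (Enc.enc (f k a)) (Enc.enc (g k a))) = true then f k a else g k a := by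
  have : PT fun (k : Val → Bool) (p : β × β) => if k (Enc.enc p) = true then p.1 else p.2 :=
    PT.intro .choose ((PB.const 1).add PB.size) fun pick p => ⟨_, by
      have h := Runs.choose (pick := pick) (Enc.enc p)
      have h2 : (Enc.enc (if pick (Enc.enc p) = true then p.1 else p.2)) =
        if pick (Enc.enc p) = true then (Enc.enc p).fst else (Enc.enc p).snd := by
        split_ifs <;> rfl
      rw [h2]; exact h, le_rfl⟩
  exact this.comp (hf.pair hg)

/-! #### Lists -/

@[fun_prop]
theorem PD.cons {f : α → β} {g : α → List β} (hf : PD f) (hg : PD g) :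
    PD fun a => f a :: g a :=
  PD.comp (g := fun p : β × List β => p.1 :: p.2) (PD.of_enc_eq fun _ => rfl) (hf.pair hg)

/-- A nonempty list is encoded as the pair of its head and tail, so the value of `(a, l a)` is
already that of `(a, c, r)` and only the test for emptiness has to be executed. -/
theorem PT.listCases {l : α → List γ} {f : (Val → Bool) → α → β}
    {g : (Val → Bool) → α × γ × List γ → β} (hl : PD l) (hf : PT f) (hg : PT g) :
    PT fun k a => match l a with
      | [] => f k a
      | c :: r => g k (a, c, r) := by
  have hl' := hl.bound
  obtain ⟨R, r, hr, hR⟩ := PT.elim (PD.pair PD.id hl)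
  obtain ⟨P, p, hp, hP⟩ := hf.elim
  obtain ⟨Q, q, hQ⟩ := hg
  refine PT.intro (.seq R (.ite (.seq (.op .snd) (.op .isPair)) Q (.seq (.op .fst) P)))
    (g := fun a => 10 + sz a + r a + 10 * (1 + sz a + sz (l a)) + (q.eval (1 + sz a + sz (l a))
      + p a)) ?_ fun pick a => ?_
  · exact ((((PB.const _).add PB.size).add hr).add
      ((PB.const _).mul (((PB.const _).add PB.size).add hl'))).add
      (((((PB.const _).add PB.size).add hl').poly q).add hp)
  obtain ⟨t0, h0, h0'⟩ := hR pick a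
  obtain ⟨t1, h1, h1'⟩ := hP pick a
  have e : (Enc.enc (a, l a)).size = 1 + sz a + sz (l a) := rfl
  have hs := sz_pos (l a)
  cases hla : l a with
  | nil =>
    have ev : (Enc.enc (a, l a)).snd = .int 0 := by rw [hla]; rfl
    have c1 : Runs pick (.seq (.op .snd) (.op .isPair)) (Enc.enc (a, l a)) (.int 0)
        (1 + (1 + sz a + sz (l a)) + (1 + (1 + sz a + sz (l a))) + (1 + 1)) := by
      have := Runs.seq (Runs.op (pick := pick) .snd (Enc.enc (a, l a))) (Runs.op .isPair _)
      simp only [Op.eval, ev] at this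
      exact this
    refine ⟨_, Runs.seq h0 (Runs.iteFalse c1 (Runs.seq (Runs.op .fst _) h1)), ?_⟩
    simp only [e]
    have : (Op.eval .fst (Enc.enc (a, l a))).size = sz a := rfl
    change 1 + sz a + _ + _ ≤ _
    rw [← hla]
    omega
  | cons c r =>
    have ev : (Enc.enc (a, l a)).snd.isPair = .int 1 := by rw [hla]; rfl
    obtain ⟨t2, h2, h2'⟩ := hQ pick (a, c, r)
    have c1 : Runs pick (.seq (.op .snd) (.op .isPair)) (Enc.enc (a, l a)) (.int 1)
        (1 + (1 + sz a + sz (l a)) + (1 + (1 + sz a + sz (l a))) + (1 + sz (l a))) := by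
      have := Runs.seq (Runs.op (pick := pick) .snd (Enc.enc (a, l a))) (Runs.op .isPair _)
      simp only [Op.eval, ev] at this
      exact this
    have e2 : (Enc.enc (a, c, r)) = Enc.enc (a, l a) := by rw [hla]; rfl
    rw [e2] at h2
    refine ⟨_, Runs.seq h0 (Runs.iteTrue c1 (by simp) h2), ?_⟩
    have e3 : sz (a, c, r) = 1 + sz a + sz (l a) := by rw [← e, sz, e2]
    rw [e3] at h2'
    simp only [e]
    change 1 + sz a + _ + _ ≤ _
    rw [← hla]
    omega

theorem PD.listCases {l : α → List γ} {f : α → β} {g : α × γ × List γ → β} (hl : PD l)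
    (hf : PD f) (hg : PD g) :
    PD fun a => match l a with
      | [] => f a
      | c :: r => g (a, c, r) := PT.listCases hl hf hg

/-- The values `x i` form the trajectory of the loop. A pass costs at most `1 + 3 T` (input, test,
body), and the failing last test counts as one more pass. -/
theorem runs_loop {C F : Prog} {pick : Val → Bool} (x : ℕ → Val) (k T : ℕ)
    (hC : ∀ i < k, ∃ b t, Runs pick C (x i) b t ∧ b ≠ .int 0 ∧ t ≤ T)
    (hF : ∀ i < k, ∃ t, Runs pick F (x i) (x (i + 1)) t ∧ t ≤ T)
    (hE : ∃ t, Runs pick C (x k) (.int 0) t ∧ t ≤ T) (hS : ∀ i ≤ k, (x i).size ≤ T) :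
    ∃ t, Runs pick (.loop C F) (x 0) (x k) t ∧ t ≤ (k + 1) * (1 + 3 * T) := by
  induction k generalizing x with
  | zero =>
    obtain ⟨t, ht, ht'⟩ := hE
    have := hS 0 le_rfl
    exact ⟨_, Runs.loopDone ht, by omega⟩
  | succ k ih =>
    obtain ⟨t, ht, ht'⟩ := ih (fun i => x (i + 1)) (fun i hi => hC (i + 1) (by omega))
      (fun i hi => hF (i + 1) (by omega)) hE (fun i hi => hS (i + 1) (by omega))
    obtain ⟨b, t1, h1, hb, h1'⟩ := hC 0 (by omega)
    obtain ⟨t2, h2, h2'⟩ := hF 0 (by omega)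
    have := hS 0 (by omega)
    refine ⟨_, Runs.loopStep h1 hb h2 ht, ?_⟩
    have e : (k + 1 + 1) * (1 + 3 * T) = (k + 1) * (1 + 3 * T) + (1 + 3 * T) := by ring
    rw [e]
    omega

/-- Iteration of a polynomial-time function, when the number of iterations and the sizes of the
intermediate results are polynomially bounded. -/
theorem PT.while {c : β → Bool} {f : (Val → Bool) → β → β} {init : α → β} (hc : PD c) (hf : PT f)
    (hi : PD init) (k : (Val → Bool) → α → ℕ) {g : α → ℕ} (hg : PB g)
    (hk : ∀ pick a, k pick a ≤ g a)
    (h1 : ∀ pick a, ∀ i < k pick a, c ((f pick)^[i] (init a)) = true)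
    (h2 : ∀ pick a, c ((f pick)^[k pick a] (init a)) = false)
    (h3 : ∀ pick a, ∀ i ≤ k pick a, sz ((f pick)^[i] (init a)) ≤ g a) :
    PT fun pick a => (f pick)^[k pick a] (init a) := by
  obtain ⟨I, q, hq, hI⟩ := PT.elim hi
  obtain ⟨R, r, hR⟩ := hc
  obtain ⟨P, p, hP⟩ := hf
  refine PT.intro (.seq I (.loop R P)) (g := fun a => 1 + sz a + q a + (g a + 1) *
    (1 + 3 * (g a + r.eval (g a) + p.eval (g a)))) ?_ fun pick a => ?_
  · exact (((PB.const _).add PB.size).add hq).add ((hg.add (PB.const _)).mul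
      ((PB.const _).add ((PB.const _).mul ((hg.add (hg.poly r)).add (hg.poly p)))))
  obtain ⟨t0, h0, h0'⟩ := hI pick a
  obtain ⟨t, ht, ht'⟩ := runs_loop (C := R) (F := P) (pick := pick)
    (fun i => Enc.enc ((f pick)^[i] (init a))) (k pick a)
    (g a + r.eval (g a) + p.eval (g a))
    (fun i hi => by
      obtain ⟨t, ht, ht'⟩ := hR pick ((f pick)^[i] (init a))
      have := eval_mono r (h3 pick a i hi.le)
      exact ⟨_, t, ht, by simp [Enc.enc, h1 pick a i hi], by omega⟩)
    (fun i hi => by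
      obtain ⟨t, ht, ht'⟩ := hP pick ((f pick)^[i] (init a))
      have := eval_mono p (h3 pick a i hi.le)
      refine ⟨t, ?_, by omega⟩
      simpa only [Function.iterate_succ_apply'] using ht)
    (by
      obtain ⟨t, ht, ht'⟩ := hR pick ((f pick)^[k pick a] (init a))
      have := eval_mono r (h3 pick a _ le_rfl)
      change Runs pick R _ (Enc.enc (c _)) t at ht
      rw [h2] at ht
      exact ⟨t, ht, by omega⟩)
    (fun i hi => by have := h3 pick a i hi; change sz _ ≤ _; omega)
  refine ⟨_, Runs.seq h0 ht, ?_⟩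
  have := hk pick a
  have : (k pick a + 1) * (1 + 3 * (g a + r.eval (g a) + p.eval (g a))) ≤
    (g a + 1) * (1 + 3 * (g a + r.eval (g a) + p.eval (g a))) := by gcongr
  change 1 + sz a + t0 + t ≤ _
  omega

/-- A polynomial-time step may square the length of the accumulator, so iteration could blow up. The
hypothesis `h` excludes this by bounding the accumulator after every prefix of the list that is
actually traversed. -/
theorem PT.foldl {l : α → List γ} {b : (Val → Bool) → α → β}
    {f : (Val → Bool) → α × β × γ → β} {g : α → ℕ}
    (hl : PD l) (hb : PT b) (hf : PT f) (hg : PB g)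
    (h : ∀ pick a l₁ l₂, l a = l₁ ++ l₂ →
      sz (l₁.foldl (fun x c => f pick (a, x, c)) (b pick a)) ≤ g a) :
    PT fun pick a => (l a).foldl (fun x c => f pick (a, x, c)) (b pick a) := by
  have hl' := hl.bound
  obtain ⟨I, q, hq, hI⟩ := PT.elim (PT.pair (f := fun _ a => a) PD.id (PT.pair (g := fun _ => l) hb hl))
  have hG : PT fun (k : Val → Bool) (s : α × β × γ × List γ) =>
      ((s.1, f k (s.1, s.2.1, s.2.2.1), s.2.2.2) : α × β × List γ) := by
    have h1 : PD fun s : α × β × γ × List γ => s.1 := PD.id.fst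
    have h2 : PD fun s : α × β × γ × List γ => s.2.1 := PD.id.snd.fst
    have h3 : PD fun s : α × β × γ × List γ => s.2.2.1 := PD.id.snd.snd.fst
    have h4 : PD fun s : α × β × γ × List γ => s.2.2.2 := PD.id.snd.snd.snd
    exact PT.pair h1 (PT.pair (hf.comp (PT.pair h1 (PT.pair h2 h3))) h4)
  obtain ⟨P, p, hP⟩ := hG
  set M : α → ℕ := fun a => 2 + sz a + g a + sz (l a) with hM
  have hMB : PB M := (((PB.const _).add PB.size).add hg).add hl'
  refine PT.intro (.seq I (.seq (.loop (.seq (.op .snd) (.seq (.op .snd) (.op .isPair))) P)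
    (.seq (.op .snd) (.op .fst)))) (g := fun a => 1 + sz a + q a + (1 + M a + (sz (l a) + 1) *
      (1 + 3 * (5 + 5 * M a + p.eval (M a))) + (3 + 3 * M a))) ?_ fun pick a => ?_
  · exact (((PB.const _).add PB.size).add hq).add ((((PB.const _).add hMB).add ((hl'.add
      (PB.const _)).mul ((PB.const _).add ((PB.const _).mul (((PB.const _).add
      ((PB.const _).mul hMB)).add (hMB.poly p)))))).add ((PB.const _).add
      ((PB.const _).mul hMB)))
  obtain ⟨t0, h0, h0'⟩ := hI pick a
  set acc : ℕ → β := fun i => ((l a).take i).foldl (fun x c => f pick (a, x, c)) (b pick a) with hacc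
  have hsz : ∀ i, sz (acc i) ≤ g a := fun i => h pick a _ _ (List.take_append_drop i (l a)).symm
  have hdr : ∀ i, sz ((l a).drop i) ≤ sz (l a) := fun i => sz_sublist (List.drop_sublist _ _)
  have hx : ∀ i, sz (a, acc i, (l a).drop i) ≤ M a := by
    intro i
    have := hsz i; have := hdr i
    simp only [sz_pair, hM]; omega
  have cond : ∀ i, Runs pick (.seq (.op .snd) (.seq (.op .snd) (.op .isPair)))
      (Enc.enc (a, acc i, (l a).drop i)) (Enc.enc ((l a).drop i)).isPair
      (1 + sz (a, acc i, (l a).drop i) + (1 + sz (a, acc i, (l a).drop i)) +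
        (1 + sz (acc i, (l a).drop i) + (1 + sz (acc i, (l a).drop i)) +
        (1 + sz ((l a).drop i)))) := fun i =>
    Runs.seq (Runs.op .snd _) (Runs.seq (Runs.op .snd _) (Runs.op .isPair _))
  have condT : ∀ i, (1 + sz (a, acc i, (l a).drop i) + (1 + sz (a, acc i, (l a).drop i)) +
        (1 + sz (acc i, (l a).drop i) + (1 + sz (acc i, (l a).drop i)) +
        (1 + sz ((l a).drop i)))) ≤ 5 + 5 * M a + p.eval (M a) := by
    intro i
    have h1 := hx i
    have : sz (acc i, (l a).drop i) ≤ sz (a, acc i, (l a).drop i) := by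
      rw [sz_pair a]; omega
    have : sz ((l a).drop i) ≤ sz (a, acc i, (l a).drop i) := by
      rw [sz_pair a, sz_pair]; omega
    omega
  obtain ⟨t, ht, ht'⟩ := runs_loop (C := .seq (.op .snd) (.seq (.op .snd) (.op .isPair)))
    (F := P) (pick := pick) (fun i => Enc.enc (a, acc i, (l a).drop i)) (l a).length
    (5 + 5 * M a + p.eval (M a))
    (fun i hi => by
      refine ⟨_, _, cond i, ?_, condT i⟩
      rw [List.drop_eq_getElem_cons hi]
      change Val.int 1 ≠ .int 0
      simp)
    (fun i hi => by
      have e : (l a).drop i = (l a)[i] :: (l a).drop (i + 1) := List.drop_eq_getElem_cons hi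
      obtain ⟨t, ht, ht'⟩ := hP pick (a, acc i, (l a)[i], (l a).drop (i + 1))
      have e2 : Enc.enc (a, acc i, (l a)[i], (l a).drop (i + 1)) =
        Enc.enc (a, acc i, (l a).drop i) := by rw [e]; rfl
      have e3 : acc (i + 1) = f pick (a, acc i, (l a)[i]) := by
        simp only [hacc, List.take_succ_eq_append_getElem hi, List.foldl_append, List.foldl_cons,
          List.foldl_nil]
      rw [e2] at ht
      rw [sz, e2] at ht'
      refine ⟨t, ?_, ?_⟩
      · simpa only [e3] using ht
      · have := eval_mono p (hx i)
        change t ≤ p.eval (sz (a, acc i, (l a).drop i)) at ht'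
        omega)
    (by
      refine ⟨_, ?_, condT (l a).length⟩
      have := cond (l a).length
      have e : (Enc.enc ((l a).drop (l a).length)).isPair = .int 0 := by simp; rfl
      rwa [e] at this)
    (fun i hi => by have := hx i; change sz (a, acc i, (l a).drop i) ≤ _; omega)
  have eacc : acc (l a).length = (l a).foldl (fun x c => f pick (a, x, c)) (b pick a) := by
    simp [hacc]
  set last : α × β × List γ := (a, acc (l a).length, (l a).drop (l a).length) with hlast
  have hfin : Runs pick (.seq (.op .snd) (.op .fst)) (Enc.enc last) (Enc.enc last.2.1)
      (1 + sz last + (1 + sz last) + (1 + sz last.2)) := Runs.seq (Runs.op .snd _) (Runs.op .fst _)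
  have hinit : Enc.enc (a, b pick a, l a) = Enc.enc (a, acc 0, (l a).drop 0) := by simp [hacc]
  rw [hinit] at h0
  rw [← eacc]
  refine ⟨_, Runs.seq h0 (Runs.seq ht hfin), ?_⟩
  have l1 := length_le_sz (l a)
  have l2 : ((l a).length + 1) * (1 + 3 * (5 + 5 * M a + p.eval (M a))) ≤
    (sz (l a) + 1) * (1 + 3 * (5 + 5 * M a + p.eval (M a))) := by gcongr
  have l3 := hx 0
  have l4 : sz last ≤ M a := hx _
  have l5 : sz last = 1 + sz last.1 + sz last.2 := rfl
  change 1 + sz a + t0 + (1 + sz (a, acc 0, (l a).drop 0) + t + _) ≤ _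
  omega

theorem PD.foldl {l : α → List γ} {b : α → β} {f : α × β × γ → β} {g : α → ℕ}
    (hl : PD l) (hb : PD b) (hf : PD f) (hg : PB g)
    (h : ∀ a l₁ l₂, l a = l₁ ++ l₂ → sz (l₁.foldl (fun x c => f (a, x, c)) (b a)) ≤ g a) :
    PD fun a => (l a).foldl (fun x c => f (a, x, c)) (b a) :=
  PT.foldl (b := fun _ => b) (f := fun _ => f) hl hb hf hg fun _ => h

end

end PFinite

namespace PFinite

noncomputable section

variable {α β γ δ : Type} [Enc α] [Enc β] [Enc γ] [Enc δ]

/-! #### List operations -/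

theorem sz_perm {l m : List α} (h : l.Perm m) : sz l = sz m := by
  rw [sz_eq_sum, sz_eq_sum, (h.map _).sum_eq]

theorem sz_reverse (l : List α) : sz l.reverse = sz l := sz_perm (List.reverse_perm l)

theorem foldl_cons_map {β γ : Type} (f : β → γ) (l : List β) (m : List γ) :
    l.foldl (fun x c => f c :: x) m = (l.map f).reverse ++ m := by
  induction l generalizing m with
  | nil => simp
  | cons a l ih => simp [ih]

@[fun_prop]
theorem PD.reverse {l : α → List β} (hl : PD l) : PD fun a => (l a).reverse := by
  have := PD.foldl (l := l) (b := fun _ => ([] : List β)) (f := fun s => s.2.2 :: s.2.1)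
    (g := fun a => sz (l a)) hl (by fun_prop) (by fun_prop) hl.bound (by
      intro a l₁ l₂ h
      have := foldl_cons_map (fun c : β => c) l₁ []
      simp only [this, List.map_id', List.append_nil, sz_reverse]
      exact sz_sublist (by rw [h]; simp))
  simpa [foldl_cons_map (fun c : β => c)] using this

theorem PT.map {l : α → List β} {f : (Val → Bool) → α × β → γ} (hl : PD l) (hf : PT f) :
    PT fun k a => (l a).map fun c => f k (a, c) := by
  obtain ⟨u, hu, hu'⟩ := hf.bound
  obtain ⟨p, hp⟩ := hu
  have hb := hl.bound
  have h2 : PT fun k a => (l a).foldl (fun x c => f k (a, c) :: x) [] := by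
    refine PT.foldl (l := l) (b := fun _ _ => ([] : List γ))
      (f := fun k s => f k (s.1, s.2.2) :: s.2.1)
      (g := fun a => 1 + sz (l a) * (1 + p.eval (1 + sz a + sz (l a)))) hl (PD.const _) ?_ ?_ ?_
    · exact PT.comp (g := fun _ (s : γ × List γ) => s.1 :: s.2)
        (show PD fun s : γ × List γ => s.1 :: s.2 by fun_prop)
        (PT.pair (hf.comp (show PD fun s : α × List γ × β => (s.1, s.2.2) by fun_prop))
          (show PD fun s : α × List γ × β => s.2.1 by fun_prop))
    · exact (PB.const _).add (hb.mul ((PB.const _).add (PB.poly (((PB.const _).add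
        PB.size).add hb) p)))
    · intro k a l₁ l₂ h
      change sz (l₁.foldl (fun x c => f k (a, c) :: x) []) ≤ _
      rw [foldl_cons_map (fun c => f k (a, c)), List.append_nil, sz_reverse]
      refine (sz_le_mul _ (p.eval (1 + sz a + sz (l a))) ?_).trans ?_
      · intro c hc
        obtain ⟨b, hb, rfl⟩ := List.mem_map.1 hc
        have hb2 : b ∈ l a := by rw [h]; simp [hb]
        refine (hu' k (a, b)).trans ((hp _).trans (eval_mono p ?_))
        have := sz_mem hb2
        rw [sz_pair]; omega
      · have : (l₁.map fun c => f k (a, c)).length ≤ sz (l a) := by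
          have := length_le_sz (l a)
          rw [h] at this ⊢
          simp only [List.length_map, List.length_append] at this ⊢
          omega
        gcongr
  have h3 : PD fun m : List γ => m.reverse := by fun_prop
  have := PT.comp h3 h2
  simpa [foldl_cons_map (fun c => f _ (_, c))] using this

theorem PD.map {l : α → List β} {f : α × β → γ} (hl : PD l) (hf : PD f) :
    PD fun a => (l a).map fun c => f (a, c) := PT.map hl hf

@[fun_prop]
theorem PD.append {l m : α → List β} (hl : PD l) (hm : PD m) : PD fun a => l a ++ m a := by
  have := PD.foldl (l := fun a => (l a).reverse) (b := m) (f := fun s => s.2.2 :: s.2.1)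
    (g := fun a => sz (l a) + sz (m a)) (by fun_prop) hm (by fun_prop) (hl.bound.add hm.bound) (by
      intro a l₁ l₂ h
      have e := foldl_cons_map (fun c : β => c) l₁ (m a)
      simp only [e, List.map_id']
      have h1 := sz_append l₁.reverse (m a)
      have h2 : sz l₁ ≤ sz (l a) := by
        rw [← sz_reverse (l a), h]
        exact sz_sublist (by simp)
      rw [sz_reverse] at h1
      omega)
  simpa [foldl_cons_map (fun c : β => c)] using this

@[fun_prop]
theorem PD.flatten {l : α → List (List β)} (hl : PD l) : PD fun a => (l a).flatten := by
  have key : ∀ (l : List (List β)) (m : List β), l.foldl (fun x c => x ++ c) m = m ++ l.flatten := by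
    intro l
    induction l with
    | nil => simp
    | cons a l ih => intro m; simp [ih]
  have hs : ∀ l : List (List β), sz l.flatten ≤ sz l := by
    intro l
    induction l with
    | nil => simp [sz_nil]
    | cons a l ih =>
      have := sz_append a l.flatten
      rw [List.flatten_cons, sz_cons]; omega
  have := PD.foldl (l := l) (b := fun _ => ([] : List β)) (f := fun s => s.2.1 ++ s.2.2)
    (g := fun a => sz (l a)) hl (by fun_prop) (by fun_prop) hl.bound (by
      intro a l₁ l₂ h
      simp only [key, List.nil_append]
      exact (hs l₁).trans (sz_sublist (by rw [h]; simp)))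
  simpa [key] using this

theorem PD.flatMap {l : α → List β} {f : α × β → List γ} (hl : PD l) (hf : PD f) :
    PD fun a => (l a).flatMap fun c => f (a, c) := by
  have := (PD.map hl hf).flatten
  simpa [List.flatMap_def] using this

theorem PD.filter {l : α → List β} {c : α × β → Bool} (hl : PD l) (hc : PD c) :
    PD fun a => (l a).filter fun b => c (a, b) := by
  have h : PD fun a => (l a).flatMap fun b => if c (a, b) = true then [b] else [] :=
    PD.flatMap (f := fun s : α × β => if c s = true then [s.2] else []) hl
      (hc.ite (by fun_prop) (by fun_prop))
  have e : ∀ (c : β → Bool) (l : List β), (l.flatMap fun b => if c b = true then [b] else []) =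
      l.filter c := by
    intro c l
    induction l with
    | nil => rfl
    | cons a l ih => rw [List.flatMap_cons, ih, List.filter_cons]; split_ifs <;> rfl
  simpa [e] using h

@[fun_prop]
theorem PD.tail {l : α → List β} (hl : PD l) : PD fun a => (l a).tail := by
  have := PD.listCases (f := fun _ => ([] : List β)) (g := fun s : α × β × List β => s.2.2) hl
    (by fun_prop) (by fun_prop)
  refine cast (congrArg PD (funext fun a => ?_)) this
  cases l a <;> rfl

@[fun_prop]
theorem PD.headD {l : α → List β} {d : α → β} (hl : PD l) (hd : PD d) :
    PD fun a => (l a).headD (d a) := by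
  have := PD.listCases (f := d) (g := fun s : α × β × List β => s.2.1) hl hd (by fun_prop)
  refine cast (congrArg PD (funext fun a => ?_)) this
  cases l a <;> rfl

/-! #### Natural numbers in unary -/

/-- Natural numbers serve as lengths, degrees and round counts. In unary, every number computed in
polynomial time is itself polynomially bounded (`PB.nat`) and may control a fold. -/
instance : Enc ℕ := ⟨fun n => Enc.enc (List.replicate n ())⟩

theorem sz_nat (n : ℕ) : sz n = 2 * n + 1 := by
  change sz (List.replicate n ()) = _
  induction n with
  | zero => simp [sz_nil]
  | succ n ih =>
    rw [List.replicate_succ, sz_cons, ih]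
    have : sz () = 1 := by simp [sz, Enc.enc, Val.size]
    omega

theorem PB.nat {f : α → ℕ} (hf : PD f) : PB f :=
  hf.bound.mono fun a => by rw [sz_nat]; omega

@[fun_prop]
theorem PD.units {n : α → ℕ} (hn : PD n) : PD fun a => List.replicate (n a) () :=
  PD.comp (g := fun n : ℕ => List.replicate n ()) (PD.of_enc_eq fun _ => rfl) hn

@[fun_prop]
theorem PD.length {l : α → List β} (hl : PD l) : PD fun a => (l a).length := by
  have h1 : PD fun l : List Unit => l.length := PD.of_enc_eq fun l => by
    change Enc.enc (List.replicate _ ()) = _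
    rw [← List.eq_replicate_length.2 fun b _ => rfl]
  have h2 : PD fun a => (l a).map fun _ => () := PD.map (f := fun _ => ()) hl (by fun_prop)
  simpa using PD.comp h1 h2

@[fun_prop]
theorem PD.nat_add {m n : α → ℕ} (hm : PD m) (hn : PD n) : PD fun a => m a + n a := by
  have : PD fun a => (List.replicate (m a) () ++ List.replicate (n a) ()).length := by fun_prop
  simpa using this

@[fun_prop]
theorem PD.nat_mul {m n : α → ℕ} (hm : PD m) (hn : PD n) : PD fun a => m a * n a := by
  have h : PD fun a => (List.replicate (m a) ()).flatMap fun _ => List.replicate (n a) () :=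
    PD.flatMap (f := fun s : α × Unit => List.replicate (n s.1) ()) (by fun_prop)
      (PD.units (PD.comp hn (by fun_prop)))
  simpa using h.length

@[fun_prop]
theorem PD.drop {n : α → ℕ} {l : α → List β} (hn : PD n) (hl : PD l) :
    PD fun a => (l a).drop (n a) := by
  have e : ∀ (u : List Unit) (l : List β), u.foldl (fun x _ => x.tail) l = l.drop u.length := by
    intro u
    induction u with
    | nil => simp
    | cons a u ih =>
      intro l
      rw [List.foldl_cons, ih, ← List.drop_one, List.drop_drop, List.length_cons, Nat.add_comm]
  have := PD.foldl (l := fun a => List.replicate (n a) ()) (b := l) (f := fun s => s.2.1.tail)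
    (g := fun a => sz (l a)) (by fun_prop) hl (by fun_prop) hl.bound (by
      intro a l₁ l₂ _
      simp only [e]
      exact sz_sublist (List.drop_sublist _ _))
  simpa [e] using this

@[fun_prop]
theorem PD.nat_sub {m n : α → ℕ} (hm : PD m) (hn : PD n) : PD fun a => m a - n a := by
  have : PD fun a => ((List.replicate (m a) ()).drop (n a)).length := by fun_prop
  simpa using this

@[fun_prop]
theorem PD.getD {n : α → ℕ} {l : α → List β} {d : α → β} (hl : PD l) (hn : PD n) (hd : PD d) :
    PD fun a => (l a).getD (n a) (d a) := by
  have : PD fun a => ((l a).drop (n a)).headD (d a) := by fun_prop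
  refine cast (congrArg PD (funext fun a => ?_)) this
  rw [List.headD_eq_head?_getD, List.head?_drop, List.getD_eq_getElem?_getD]

@[fun_prop]
theorem PD.range {n : α → ℕ} (hn : PD n) : PD fun a => List.range (n a) := by
  have e : ∀ u : List Unit, u.foldl (fun (x : List ℕ) _ => x.length :: x) [] =
      (List.range u.length).reverse := by
    intro u
    induction u using List.reverseRecOn with
    | nil => simp
    | append_singleton u a ih => simp [ih, List.range_succ]
  have := PD.foldl (l := fun a => List.replicate (n a) ()) (b := fun _ => ([] : List ℕ))
    (f := fun s => s.2.1.length :: s.2.1)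
    (g := fun a => 1 + n a * (1 + (2 * n a + 1))) (by fun_prop) (by fun_prop) (by fun_prop)
    ((PB.const _).add ((PB.nat hn).mul ((PB.const _).add (((PB.const _).mul (PB.nat hn)).add
      (PB.const _))))) (by
      intro a l₁ l₂ h
      simp only [e]
      have h' : l₁.length ≤ n a := by
        have := congrArg List.length h
        simp at this; omega
      rw [sz_reverse]
      refine (sz_le_mul _ (2 * n a + 1) fun k hk => ?_).trans ?_
      · rw [sz_nat]; rw [List.mem_range] at hk; omega
      · rw [List.length_range]; gcongr)
  simpa [e] using this.reverse

/-! #### Integers -/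

@[fun_prop]
theorem PD.int_add {f g : α → ℤ} (hf : PD f) (hg : PD g) : PD fun a => f a + g a :=
  PD.comp (g := fun p : ℤ × ℤ => p.1 + p.2) (PD.op_eval .add fun _ => rfl) (hf.pair hg)

@[fun_prop]
theorem PD.int_sub {f g : α → ℤ} (hf : PD f) (hg : PD g) : PD fun a => f a - g a :=
  PD.comp (g := fun p : ℤ × ℤ => p.1 - p.2) (PD.op_eval .sub fun _ => rfl) (hf.pair hg)

@[fun_prop]
theorem PD.int_mul {f g : α → ℤ} (hf : PD f) (hg : PD g) : PD fun a => f a * g a :=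
  PD.comp (g := fun p : ℤ × ℤ => p.1 * p.2) (PD.op_eval .mul fun _ => rfl) (hf.pair hg)

@[fun_prop]
theorem PD.int_div {f g : α → ℤ} (hf : PD f) (hg : PD g) : PD fun a => f a / g a :=
  PD.comp (g := fun p : ℤ × ℤ => p.1 / p.2) (PD.op_eval .div fun _ => rfl) (hf.pair hg)

@[fun_prop]
theorem PD.int_neg {f : α → ℤ} (hf : PD f) : PD fun a => -f a := by
  have : PD fun a => 0 - f a := by fun_prop
  simpa using this

@[fun_prop]
theorem PD.int_mod {f g : α → ℤ} (hf : PD f) (hg : PD g) : PD fun a => f a % g a := by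
  have : PD fun a => f a - g a * (f a / g a) := by fun_prop
  simpa [Int.emod_def] using this

@[fun_prop]
theorem PD.int_le {f g : α → ℤ} (hf : PD f) (hg : PD g) : PD fun a => decide (f a ≤ g a) :=
  PD.comp (g := fun p : ℤ × ℤ => decide (p.1 ≤ p.2)) (PD.op_eval .le fun p => by
    by_cases h : p.1 ≤ p.2 <;> simp [Enc.enc, Op.eval, Val.fst, Val.snd, Val.toInt, h])
    (hf.pair hg)

@[fun_prop]
theorem PD.int_eq {f g : α → ℤ} (hf : PD f) (hg : PD g) : PD fun a => decide (f a = g a) := by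
  have : PD fun a => decide (f a ≤ g a) && decide (g a ≤ f a) := by fun_prop
  refine cast (congrArg PD (funext fun a => ?_)) this
  rw [← Bool.decide_and, decide_eq_decide, ← le_antisymm_iff]

theorem sz_int (z : ℤ) : sz z = 1 + Nat.size z.natAbs := rfl

/-- One step of the Euclidean algorithm. -/
def euclid (s : ℤ × ℤ) : ℤ × ℤ := (s.2 % s.1, s.1)

/-- The product of the two numbers at least halves in each step: `m < n` gives `n ≥ m + n % m`, so
`2 (n % m) ≤ n`. Hence the bit length of `m * n` bounds the number of steps. -/
theorem exists_euclid_iterate (m n : ℕ) (h : m < n) : ∃ k ≤ Nat.size (m * n),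
    (∀ i < k, (euclid^[i] ((m : ℤ), (n : ℤ))).1 ≠ 0) ∧
    euclid^[k] ((m : ℤ), (n : ℤ)) = (0, (Nat.gcd m n : ℤ)) ∧
    ∀ i ≤ k, sz (euclid^[i] ((m : ℤ), (n : ℤ))) ≤ 3 + 2 * Nat.size n := by
  induction m using Nat.strong_induction_on generalizing n with
  | _ m ih =>
    have hmn : Nat.size m ≤ Nat.size n := Nat.size_le_size h.le
    have h0 : sz ((m : ℤ), (n : ℤ)) ≤ 3 + 2 * Nat.size n := by
      rw [sz_pair, sz_int, sz_int, Int.natAbs_natCast, Int.natAbs_natCast]; omega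
    rcases Nat.eq_zero_or_pos m with rfl | hm
    · refine ⟨0, Nat.zero_le _, by simp, by simp, fun i hi => ?_⟩
      obtain rfl : i = 0 := by omega
      exact h0
    · obtain ⟨k, hk, h1, h2, h3⟩ := ih (n % m) (Nat.mod_lt _ hm) m (Nat.mod_lt _ hm)
      have e : euclid ((m : ℤ), (n : ℤ)) = (((n % m : ℕ) : ℤ), (m : ℤ)) := by
        simp [euclid]
      refine ⟨k + 1, ?_, ?_, ?_, ?_⟩
      · have h4 : 2 * (n % m * m) ≤ m * n := by
          have := Nat.mod_add_div n m
          have h5 : 1 ≤ n / m := Nat.div_pos h.le hm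
          have h6 := Nat.mod_lt n hm
          have h7 : m ≤ m * (n / m) := Nat.le_mul_of_pos_right m h5
          have h8 : 2 * (n % m) ≤ n := by omega
          calc 2 * (n % m * m) = m * (2 * (n % m)) := by ring
            _ ≤ m * n := by gcongr
        have h5 : n % m * m < 2 ^ (Nat.size (m * n) - 1) := by
          have h7 : 0 < Nat.size (m * n) := Nat.size_pos.2 (Nat.mul_pos hm (by omega))
          have h6 := Nat.lt_size_self (m * n)
          obtain ⟨j, hj⟩ : ∃ j, Nat.size (m * n) = j + 1 := ⟨_, (Nat.succ_pred_eq_of_pos h7).symm⟩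
          rw [hj, pow_succ] at h6
          rw [hj, Nat.add_sub_cancel]
          omega
        have h6 := Nat.size_le.2 h5
        have h7 : 0 < Nat.size (m * n) := Nat.size_pos.2 (Nat.mul_pos hm (by omega))
        omega
      · intro i hi
        rcases i with _ | i
        · simpa using hm.ne'
        · rw [Function.iterate_succ_apply, e]
          exact h1 i (by omega)
      · rw [Function.iterate_succ_apply, e, h2, Nat.gcd_rec m n]
      · intro i hi
        rcases i with _ | i
        · exact h0
        · rw [Function.iterate_succ_apply, e]
          exact (h3 i (by omega)).trans (by omega)

/-- The greatest common divisor of `a` and `b > 0`. -/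
theorem PD.gcd : PD fun p : ℤ × ℤ => if 0 < p.2 then (Int.gcd p.1 p.2 : ℤ) else 1 := by
  -- Reducing `a` modulo `b` first ensures that the smaller number comes first. For `b ≤ 0` the
  -- start `(0, 1)` is already final and gives the default value `1`.
  set init : ℤ × ℤ → ℤ × ℤ := fun p =>
    if decide (0 < p.2) = true then (p.1 % p.2, p.2) else (0, 1) with hinit
  have hi : PD init := PD.ite (by fun_prop) (by fun_prop) (by fun_prop)
  have hn : ∀ p, ∃ m n : ℕ, m < n ∧ init p = ((m : ℤ), (n : ℤ)) ∧
      Nat.size n ≤ 1 + sz p ∧ Nat.size (m * n) ≤ 2 * (1 + sz p) ∧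
      (Nat.gcd m n : ℤ) = if 0 < p.2 then (Int.gcd p.1 p.2 : ℤ) else 1 := by
    rintro ⟨a, b⟩
    simp only [hinit]
    by_cases hb : 0 < b
    · obtain ⟨n, rfl⟩ := Int.eq_ofNat_of_zero_le hb.le
      obtain ⟨m, hm⟩ := Int.eq_ofNat_of_zero_le (Int.emod_nonneg a hb.ne')
      have hlt : (m : ℤ) < n := by rw [← hm]; exact Int.emod_lt_of_pos a hb
      have hlt' : m < n := by exact_mod_cast hlt
      have hs : Nat.size n ≤ 1 + sz (a, (n : ℤ)) := by
        rw [sz_pair, sz_int (n : ℤ), Int.natAbs_natCast]; omega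
      refine ⟨m, n, hlt', ?_, hs, ?_, ?_⟩
      · simp only [hb, decide_true, if_true, hm]
      · have h1 := Nat.lt_size_self n
        have : Nat.size (m * n) ≤ 2 * Nat.size n := by
          rw [Nat.size_le, two_mul, pow_add]
          exact Nat.mul_lt_mul'' (hlt'.trans h1) h1
        omega
      · rw [if_pos hb, ← Int.emod_add_mul_ediv a n, hm]; simp
    · refine ⟨0, 1, one_pos, ?_, ?_, ?_, ?_⟩
      · simp [hb]
      · simp
      · simp
      · simp [hb]
  choose m n hmn hmi hns hms hg using hn
  choose k hk h1 h2 h3 using fun p => exists_euclid_iterate (m p) (n p) (hmn p)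
  have := PT.while (c := fun s : ℤ × ℤ => !decide (s.1 = 0)) (f := fun _ => euclid) (init := init)
    (by fun_prop) (show PD euclid by unfold euclid; fun_prop) hi (fun _ => k)
    (g := fun p => 5 + 2 * sz p) ((PB.const _).add ((PB.const _).mul PB.size))
    (fun _ p => by have := hk p; have := hms p; omega)
    (fun _ p i hi => by simpa [hmi] using h1 p i hi)
    (fun _ p => by simp [hmi, h2])
    (fun _ p i hi => by rw [hmi]; have := h3 p i hi; have := hns p; omega)
  have h4 : PD fun p => (euclid^[k p] (init p)).2 := PD.snd this
  refine cast (congrArg PD (funext fun p => ?_)) h4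
  rw [hmi, h2, ← hg]

end

end PFinite

namespace PFinite

noncomputable section

variable {α β γ δ : Type} [Enc α] [Enc β] [Enc γ] [Enc δ]

/-! #### Rational numbers -/

instance : Enc ℚ := ⟨encRat⟩

theorem sz_rat (q : ℚ) : sz q = 3 + Nat.size q.num.natAbs + Nat.size q.den := by
  change (encRat q).size = _
  simp only [encRat, Val.size, Int.natAbs_natCast]
  omega

@[fun_prop]
theorem PD.rat_num {f : α → ℚ} (hf : PD f) : PD fun a => (f a).num :=
  PD.comp (g := fun q : ℚ => q.num) (PD.op_eval .fst fun _ => rfl) hf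

@[fun_prop]
theorem PD.rat_den {f : α → ℚ} (hf : PD f) : PD fun a => ((f a).den : ℤ) :=
  PD.comp (g := fun q : ℚ => (q.den : ℤ)) (PD.op_eval .snd fun _ => rfl) hf

theorem rat_num_den_div (a : ℤ) {b : ℤ} (hb : 0 < b) :
    ((a : ℚ) / b).num = a / (Int.gcd a b : ℤ) ∧ (((a : ℚ) / b).den : ℤ) = b / (Int.gcd a b : ℤ) := by
  have hg : 0 < Int.gcd a b := Int.gcd_pos_of_ne_zero_right _ hb.ne'
  obtain ⟨x, hx⟩ := Int.gcd_dvd_left (a := a) (b := b)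
  obtain ⟨y, hy⟩ := Int.gcd_dvd_right (a := a) (b := b)
  set g := Int.gcd a b with hgdef
  have hg' : (0 : ℤ) < g := by exact_mod_cast hg
  have hy0 : 0 < y := by
    rw [hy] at hb
    exact pos_of_mul_pos_right hb hg'.le
  have hcop : Nat.Coprime x.natAbs y.natAbs := by
    have h1 : Int.gcd (g * x) (g * y) = g * Int.gcd x y := by
      rw [Int.gcd_mul_left, Int.natAbs_natCast]
    rw [← hx, ← hy, ← hgdef] at h1
    have : Int.gcd x y = 1 := by
      have := Nat.eq_of_mul_eq_mul_left hg (h1.symm.trans (mul_one g).symm)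
      exact this
    exact this
  have e : (a : ℚ) / b = x / y := by
    rw [hx, hy]
    push_cast
    rw [mul_div_mul_left]
    exact_mod_cast hg.ne'
  have hxd : a / (g : ℤ) = x := by
    rw [hx]; exact Int.mul_ediv_cancel_left _ hg'.ne'
  have hyd : b / (g : ℤ) = y := by
    rw [hy]; exact Int.mul_ediv_cancel_left _ hg'.ne'
  rw [e, hxd, hyd]
  exact ⟨Rat.num_div_eq_of_coprime hy0 hcop, Rat.den_div_eq_of_coprime hy0 hcop⟩

/-- The quotient of integers, where it is `0` when the denominator is not positive. -/
def divPos (a b : ℤ) : ℚ := if 0 < b then (a : ℚ) / b else 0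

@[fun_prop]
theorem PD.divPos {f g : α → ℤ} (hf : PD f) (hg : PD g) : PD fun a => divPos (f a) (g a) := by
  suffices h : PD fun p : ℤ × ℤ => PFinite.divPos p.1 p.2 from h.comp (hf.pair hg)
  have h1 : PD fun p : ℤ × ℤ => if decide (0 < p.2) = true then
      (p.1 / (if 0 < p.2 then (Int.gcd p.1 p.2 : ℤ) else 1),
        p.2 / (if 0 < p.2 then (Int.gcd p.1 p.2 : ℤ) else 1)) else ((0 : ℤ), (1 : ℤ)) :=
    PD.ite (by fun_prop) (PD.pair (PD.int_div (by fun_prop) PD.gcd)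
      (PD.int_div (by fun_prop) PD.gcd)) (by fun_prop)
  refine PT.congr_enc h1 (fun a => a) (fun _ => rfl) fun _ p => ?_
  simp only [PFinite.divPos]
  by_cases h : 0 < p.2
  · simp only [h, decide_true, if_true]
    obtain ⟨h2, h3⟩ := rat_num_den_div p.1 h
    change Val.pair (.int _) (.int _) = Val.pair (.int _) (.int _)
    rw [h2, h3]
  · simp only [h, decide_false, if_false]
    rfl

@[fun_prop]
theorem PD.rat_add {f g : α → ℚ} (hf : PD f) (hg : PD g) : PD fun a => f a + g a := by
  have : PD fun a => PFinite.divPos ((f a).num * (g a).den + (g a).num * (f a).den)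
    ((f a).den * (g a).den) := by fun_prop
  refine cast (congrArg PD (funext fun a => ?_)) this
  have h1 := (f a).den_pos
  have h2 := (g a).den_pos
  rw [PFinite.divPos, if_pos (by positivity)]
  conv_rhs => rw [← Rat.num_div_den (f a), ← Rat.num_div_den (g a)]
  push_cast
  field_simp

@[fun_prop]
theorem PD.rat_mul {f g : α → ℚ} (hf : PD f) (hg : PD g) : PD fun a => f a * g a := by
  have : PD fun a => PFinite.divPos ((f a).num * (g a).num) ((f a).den * (g a).den) := by fun_prop
  refine cast (congrArg PD (funext fun a => ?_)) this
  have h1 := (f a).den_pos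
  have h2 := (g a).den_pos
  rw [PFinite.divPos, if_pos (by positivity)]
  conv_rhs => rw [← Rat.num_div_den (f a), ← Rat.num_div_den (g a)]
  push_cast
  field_simp

@[fun_prop]
theorem PD.rat_inv {f : α → ℚ} (hf : PD f) : PD fun a => (f a)⁻¹ := by
  -- `divPos` vanishes unless its denominator is positive, so the first summand handles positive
  -- numbers, the second negative ones, and both vanish at `0`.
  have : PD fun a => PFinite.divPos (f a).den (f a).num +
    PFinite.divPos (-(f a).den) (-(f a).num) := by fun_prop
  refine cast (congrArg PD (funext fun a => ?_)) this
  conv_rhs => rw [← Rat.num_div_den (f a), inv_div]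
  simp only [PFinite.divPos]
  rcases lt_trichotomy (f a).num 0 with h | h | h
  · rw [if_neg (by omega), if_pos (by omega)]
    push_cast
    rw [zero_add, neg_div_neg_eq]
  · rw [if_neg (by omega), if_neg (by omega), h]; simp
  · rw [if_pos h, if_neg (by omega)]
    push_cast
    rw [add_zero]

@[fun_prop]
theorem PD.rat_div {f g : α → ℚ} (hf : PD f) (hg : PD g) : PD fun a => f a / g a := by
  have : PD fun a => f a * (g a)⁻¹ := by fun_prop
  simpa [div_eq_mul_inv] using this

@[fun_prop]
theorem PD.rat_eq_zero {f : α → ℚ} (hf : PD f) : PD fun a => decide (f a = 0) := by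
  have : PD fun a => decide ((f a).num = 0) := by fun_prop
  refine cast (congrArg PD (funext fun a => ?_)) this
  rw [decide_eq_decide, Rat.num_eq_zero]

/-- `c` is a denominator of `q`, with a numerator of absolute value at most `2 ^ h`. -/
def Ht (c h : ℕ) (q : ℚ) : Prop := 0 < c ∧ ∃ z : ℤ, (c : ℚ) * q = z ∧ z.natAbs ≤ 2 ^ h

/-- In lowest terms the denominator divides `c` and the numerator divides `z`. -/
theorem Ht.sz_le {c h : ℕ} {q : ℚ} (H : Ht c h q) : sz q ≤ 4 + h + Nat.size c := by
  obtain ⟨hc, z, hz, hzh⟩ := H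
  have hc' : (c : ℚ) ≠ 0 := by exact_mod_cast hc.ne'
  have e : q = Rat.divInt z c := by
    rw [Rat.divInt_eq_div, ← hz]; push_cast; field_simp
  have h1 : q.num ∣ z := by rw [e]; exact Rat.num_dvd z (by exact_mod_cast hc.ne')
  have h2 : (q.den : ℤ) ∣ c := by rw [e]; exact Rat.den_dvd z c
  have h3 : q.num.natAbs ≤ 2 ^ h := by
    by_cases hz0 : z = 0
    · have : q = 0 := by
        rw [hz0] at hz; simpa [hc'] using hz
      simp [this]
    · exact (Nat.le_of_dvd (Int.natAbs_pos.2 hz0) (Int.natAbs_dvd_natAbs.2 h1)).trans hzh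
  have h4 : q.den ≤ c := Nat.le_of_dvd hc (by exact_mod_cast h2)
  have h5 : Nat.size q.num.natAbs ≤ h + 1 := by
    rw [Nat.size_le, pow_succ]
    have : 0 < 2 ^ h := by positivity
    omega
  have h6 := Nat.size_le_size h4
  rw [sz_rat]; omega

theorem Ht.zero {c h : ℕ} (hc : 0 < c) : Ht c h 0 := ⟨hc, 0, by simp, by simp⟩

theorem Ht.mono {c h h' : ℕ} {q : ℚ} (H : Ht c h q) (hh : h ≤ h') : Ht c h' q :=
  let ⟨hc, z, hz, hb⟩ := H
  ⟨hc, z, hz, hb.trans (Nat.pow_le_pow_right (by norm_num) hh)⟩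

theorem Ht.neg {c h : ℕ} {q : ℚ} (H : Ht c h q) : Ht c h (-q) :=
  let ⟨hc, z, hz, hb⟩ := H
  ⟨hc, -z, by push_cast; rw [← hz]; ring, by simpa using hb⟩

/-- This is the purpose of a denominator fixed in advance: an addition costs one bit of height and
leaves `c` alone, whereas denominators of unrelated fractions would multiply. -/
theorem Ht.add {c h : ℕ} {p q : ℚ} (hp : Ht c h p) (hq : Ht c h q) : Ht c (h + 1) (p + q) :=
  let ⟨hc, z, hz, hb⟩ := hp; let ⟨_, w, hw, hb'⟩ := hq
  ⟨hc, z + w, by push_cast; rw [← hz, ← hw]; ring, by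
    have := Int.natAbs_add_le z w; rw [pow_succ]; omega⟩

theorem Ht.mul {c h c' h' : ℕ} {p q : ℚ} (hp : Ht c h p) (hq : Ht c' h' q) :
    Ht (c * c') (h + h') (p * q) :=
  let ⟨hc, z, hz, hb⟩ := hp; let ⟨hc', w, hw, hb'⟩ := hq
  ⟨Nat.mul_pos hc hc', z * w, by push_cast; rw [← hz, ← hw]; ring, by
    rw [Int.natAbs_mul, pow_add]; exact Nat.mul_le_mul hb hb'⟩

theorem Ht.sum {ι : Type*} {c h : ℕ} (hc : 0 < c) (s : Finset ι) (f : ι → ℚ)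
    (hf : ∀ i ∈ s, Ht c h (f i)) : Ht c (h + s.card) (∑ i ∈ s, f i) := by
  classical
  induction s using Finset.induction_on with
  | empty => simpa using Ht.zero hc
  | insert a s ha ih =>
    rw [Finset.sum_insert ha, Finset.card_insert_of_notMem ha, ← add_assoc]
    refine Ht.add ((hf a (by simp)).mono (by omega)) (ih fun i hi => hf i (by simp [hi]))

theorem Ht.list_sum {c h : ℕ} (hc : 0 < c) (l : List ℚ) (hf : ∀ q ∈ l, Ht c h q) :
    Ht c (h + l.length) l.sum := by
  induction l with
  | nil => simpa using Ht.zero hc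
  | cons a l ih =>
    rw [List.sum_cons, List.length_cons, ← add_assoc]
    exact Ht.add ((hf a (by simp)).mono (by omega)) (ih fun i hi => hf i (by simp [hi]))

/-- Finitely many rational numbers have a common denominator of about the size of their
encoding. -/
theorem exists_common_den (l : List ℚ) : ∃ c : ℕ, 0 < c ∧ c ≤ 2 ^ sz l ∧
    ∀ q ∈ l, Ht c (2 * sz l) q := by
  induction l with
  | nil => exact ⟨1, one_pos, Nat.one_le_two_pow, by simp⟩
  | cons a l ih =>
    obtain ⟨c, hc, hcl, hq⟩ := ih
    have h1 : sz (a :: l) = 1 + sz a + sz l := rfl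
    have hd : a.den ≤ 2 ^ sz a := by
      refine (Nat.lt_size_self _).le.trans (Nat.pow_le_pow_right (by norm_num) ?_)
      rw [sz_rat]; omega
    have hn : a.num.natAbs ≤ 2 ^ sz a := by
      refine (Nat.lt_size_self _).le.trans (Nat.pow_le_pow_right (by norm_num) ?_)
      rw [sz_rat]; omega
    refine ⟨a.den * c, Nat.mul_pos a.den_pos hc, ?_, ?_⟩
    · rw [h1, add_assoc, pow_add, pow_add]
      calc a.den * c ≤ 2 ^ sz a * 2 ^ sz l := Nat.mul_le_mul hd hcl
        _ ≤ _ := Nat.le_mul_of_pos_left _ (by norm_num)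
    · intro q hq'
      rcases List.mem_cons.1 hq' with rfl | hq'
      · refine ⟨Nat.mul_pos q.den_pos hc, q.num * c, ?_, ?_⟩
        · push_cast
          have := Rat.den_mul_eq_num q
          rw [mul_right_comm, this]
        · rw [Int.natAbs_mul, Int.natAbs_natCast]
          calc q.num.natAbs * c ≤ 2 ^ sz q * 2 ^ sz l := Nat.mul_le_mul hn hcl
            _ = 2 ^ (sz q + sz l) := (pow_add _ _ _).symm
            _ ≤ _ := Nat.pow_le_pow_right (by norm_num) (by omega)
      · obtain ⟨_, z, hz, hb⟩ := hq q hq'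
        refine ⟨Nat.mul_pos a.den_pos hc, a.den * z, ?_, ?_⟩
        · push_cast; rw [mul_assoc, hz]
        · rw [Int.natAbs_mul, Int.natAbs_natCast]
          calc a.den * z.natAbs ≤ 2 ^ sz a * 2 ^ (2 * sz l) := Nat.mul_le_mul hd hb
            _ = 2 ^ (sz a + 2 * sz l) := (pow_add _ _ _).symm
            _ ≤ _ := Nat.pow_le_pow_right (by norm_num) (by omega)

theorem size_le_of_le_two_pow {c k : ℕ} (h : c ≤ 2 ^ k) : Nat.size c ≤ k + 1 := by
  rw [Nat.size_le, pow_succ]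
  have : 0 < 2 ^ k := by positivity
  omega

theorem sz_sum_le (l : List ℚ) : sz l.sum ≤ 5 + 4 * sz l := by
  obtain ⟨c, hc, hcl, hq⟩ := exists_common_den l
  have h1 := (Ht.list_sum hc l hq).sz_le
  have h2 := size_le_of_le_two_pow hcl
  have h3 := length_le_sz l
  omega

@[fun_prop]
theorem PD.rat_sum {l : α → List ℚ} (hl : PD l) : PD fun a => (l a).sum := by
  have e : ∀ (l : List ℚ) (q : ℚ), l.foldl (fun x c => x + c) q = q + l.sum := by
    intro l
    induction l with
    | nil => simp
    | cons a l ih => intro q; rw [List.foldl_cons, ih, List.sum_cons, add_assoc]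
  have := PD.foldl (l := l) (b := fun _ => (0 : ℚ)) (f := fun s => s.2.1 + s.2.2)
    (g := fun a => 5 + 4 * sz (l a)) hl (by fun_prop) (by fun_prop)
    ((PB.const _).add ((PB.const _).mul hl.bound)) (by
      intro a l₁ l₂ h
      simp only [e, zero_add]
      refine (sz_sum_le _).trans ?_
      have : sz l₁ ≤ sz (l a) := sz_sublist (by rw [h]; simp)
      omega)
  simpa [e] using this

theorem PD.rat_sum_range {f : α × ℕ → ℚ} {n : α → ℕ} (hf : PD f) (hn : PD n) :
    PD fun a => ∑ i ∈ Finset.range (n a), f (a, i) :=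
  PD.rat_sum (PD.map hn.range hf)

/-! #### Polynomials -/

instance : Enc ℚ[X] := ⟨encPoly⟩

/-- The coefficients up to the degree. -/
def coefs (p : ℚ[X]) : List ℚ := (List.range (p.natDegree + 1)).map p.coeff

theorem enc_coefs (p : ℚ[X]) : Enc.enc (coefs p) = Enc.enc p := by
  change encList (((List.range _).map _).map _) = encList _
  rw [List.map_map]; rfl

theorem sz_coefs (p : ℚ[X]) : sz (coefs p) = sz p := by rw [sz, enc_coefs]; rfl

@[fun_prop]
theorem PD.coefs {f : α → ℚ[X]} (hf : PD f) : PD fun a => coefs (f a) :=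
  PD.comp (PD.of_enc_eq enc_coefs) hf

theorem length_coefs (p : ℚ[X]) : (coefs p).length = p.natDegree + 1 := by simp [coefs]

theorem getD_map_range (f : ℕ → ℚ) (n k : ℕ) :
    ((List.range n).map f).getD k 0 = if k < n then f k else 0 := by
  rw [List.getD_eq_getElem?_getD, List.getElem?_map]
  by_cases h : k < n
  · simp [h]
  · rw [if_neg h, List.getElem?_eq_none (by simpa using h)]; rfl

theorem coeff_eq_getD (p : ℚ[X]) (k : ℕ) : p.coeff k = (PFinite.coefs p).getD k 0 := by
  rw [PFinite.coefs, getD_map_range]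
  split_ifs with h
  · rfl
  · exact coeff_eq_zero_of_natDegree_lt (by omega)

@[fun_prop]
theorem PD.natDegree {f : α → ℚ[X]} (hf : PD f) : PD fun a => (f a).natDegree := by
  have : PD fun a => (PFinite.coefs (f a)).length - 1 := by fun_prop
  simpa [length_coefs] using this

@[fun_prop]
theorem PD.coeff {f : α → ℚ[X]} {k : α → ℕ} (hf : PD f) (hk : PD k) :
    PD fun a => (f a).coeff (k a) := by
  have : PD fun a => (PFinite.coefs (f a)).getD (k a) 0 := by fun_prop
  simpa only [← coeff_eq_getD] using this

/-- The polynomial with the given coefficients. -/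
def ofCoefs : List ℚ → ℚ[X]
  | [] => 0
  | c :: l => ofCoefs l * X + C c

theorem coeff_ofCoefs (l : List ℚ) (k : ℕ) : (ofCoefs l).coeff k = l.getD k 0 := by
  induction l generalizing k with
  | nil => simp [ofCoefs]
  | cons c l ih =>
    cases k with
    | zero => simp [ofCoefs]
    | succ k => simp [ofCoefs, coeff_C_succ, ih]

theorem ofCoefs_coefs (p : ℚ[X]) : ofCoefs (coefs p) = p := by
  ext k; rw [coeff_ofCoefs, coeff_eq_getD]

theorem ofCoefs_map_range {p : ℚ[X]} {n : ℕ} (h : p.natDegree < n) (f : ℕ → ℚ)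
    (hf : ∀ k < n, f k = p.coeff k) : ofCoefs ((List.range n).map f) = p := by
  ext k
  rw [coeff_ofCoefs, getD_map_range]
  split_ifs with hk
  · exact hf k hk
  · rw [coeff_eq_zero_of_natDegree_lt (by omega)]

/-- Removal of the zeros at the end of a list. -/
def trim (l : List ℚ) : List ℚ :=
  l.reverse.foldl (fun x c => if (decide (x.length = 0) && decide (c = 0)) = true then [] else c :: x) []

theorem trim_cons (c : ℚ) (l : List ℚ) : trim (c :: l) =
    if (decide ((trim l).length = 0) && decide (c = 0)) = true then [] else c :: trim l := by
  simp [trim]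

theorem trim_spec (l : List ℚ) : (∀ k, (trim l).getD k 0 = l.getD k 0) ∧
    (∀ h : trim l ≠ [], (trim l).getLast h ≠ 0) ∧ (trim l).Sublist l := by
  induction l with
  | nil => simp [trim]
  | cons c l ih =>
    obtain ⟨h1, h2, h3⟩ := ih
    rw [trim_cons]
    split_ifs with h
    · simp only [Bool.and_eq_true, decide_eq_true_eq, List.length_eq_zero_iff] at h
      refine ⟨fun k => ?_, by simp, by simp⟩
      cases k with
      | zero => simp [h.2]
      | succ k => rw [List.getD_cons_succ, ← h1 k, h.1]; simp
    · simp only [Bool.and_eq_true, decide_eq_true_eq, List.length_eq_zero_iff, not_and] at h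
      refine ⟨fun k => ?_, fun _ => ?_, List.Sublist.cons_cons c h3⟩
      · cases k with
        | zero => simp
        | succ k => rw [List.getD_cons_succ, List.getD_cons_succ, h1 k]
      · by_cases ht : trim l = []
        · simp only [ht, List.getLast_singleton]; exact h ht
        · rw [List.getLast_cons ht]; exact h2 ht

/-- Encodings stop at the degree, so trailing zeros must be removed. The zero polynomial has
`natDegree` equal to `0` and is encoded by the list `[0]`, hence the exceptional case. -/
theorem coefs_ofCoefs (l : List ℚ) :
    coefs (ofCoefs l) = if decide ((trim l).length = 0) = true then [0] else trim l := by
  obtain ⟨h1, h2, -⟩ := trim_spec l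
  have hc : ∀ k, (ofCoefs l).coeff k = (trim l).getD k 0 := fun k => by rw [coeff_ofCoefs, h1]
  split_ifs with h
  · have h0 : ofCoefs l = 0 := by
      ext k
      rw [hc, List.length_eq_zero_iff.1 (of_decide_eq_true h)]; simp
    rw [h0]; simp [coefs]
  · have ht : trim l ≠ [] := fun h' => h (by simp [h'])
    have hlen : 0 < (trim l).length := List.length_pos_iff.2 ht
    have hd : (ofCoefs l).natDegree = (trim l).length - 1 := by
      refine natDegree_eq_of_le_of_coeff_ne_zero ?_ ?_
      · rw [natDegree_le_iff_coeff_eq_zero]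
        intro k hk
        rw [hc, List.getD_eq_default _ _ (by omega)]
      · rw [hc, List.getD_eq_getElem _ _ (by omega), ← List.getLast_eq_getElem ht]
        exact h2 ht
    refine List.ext_getElem (by rw [length_coefs, hd]; omega) fun k hk hk' => ?_
    simp only [coefs, List.getElem_map, List.getElem_range]
    rw [hc, List.getD_eq_getElem _ _ hk']

@[fun_prop]
theorem PD.ofCoefs {l : α → List ℚ} (hl : PD l) : PD fun a => ofCoefs (l a) := by
  have ht : PD fun l : List ℚ => trim l := by
    refine PD.foldl (l := fun l : List ℚ => l.reverse) (b := fun _ => ([] : List ℚ))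
      (f := fun s => if (decide (((s.2.1.length : ℕ) : ℕ) = 0) && decide (s.2.2 = 0)) = true then []
        else s.2.2 :: s.2.1) (g := fun l => sz l) (by fun_prop) (by fun_prop) ?_ PB.size ?_
    · refine PD.ite (PD.and ?_ (by fun_prop)) (by fun_prop) (by fun_prop)
      have h : PD fun l : List ℚ => decide (l.length = 0) := by
        have := PD.listCases (f := fun _ => true)
          (g := fun _ : List ℚ × ℚ × List ℚ => false) (PD.id (α := List ℚ)) (by fun_prop)
          (by fun_prop)
        refine cast (congrArg PD (funext fun a => ?_)) this
        cases a <;> simp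
      exact h.comp (by fun_prop)
    · intro l l₁ l₂ h
      have h2 : trim l₁.reverse = l₁.foldl (fun x c => if (decide (x.length = 0) && decide (c = 0))
        = true then [] else c :: x) [] := by simp [trim]
      change sz (l₁.foldl (fun x c => if (decide (x.length = 0) && decide (c = 0))
        = true then [] else c :: x) []) ≤ sz l
      rw [← h2]
      refine (sz_sublist (trim_spec _).2.2).trans ?_
      rw [sz_reverse, ← sz_reverse l, h]
      exact sz_sublist (by simp)
  have h : PD fun l : List ℚ => if decide ((trim l).length = 0) = true then [0] else trim l := by
    refine PD.ite ?_ (by fun_prop) ht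
    have h : PD fun l : List ℚ => decide (l.length = 0) := by
      have := PD.listCases (f := fun _ => true)
        (g := fun _ : List ℚ × ℚ × List ℚ => false) (PD.id (α := List ℚ)) (by fun_prop)
        (by fun_prop)
      refine cast (congrArg PD (funext fun a => ?_)) this
      cases a <;> simp
    exact h.comp ht
  refine PT.congr_enc (h.comp hl) (fun a => a) (fun _ => rfl) fun _ a => ?_
  rw [← coefs_ofCoefs, enc_coefs]

/-- A polynomial is computed in polynomial time if its coefficients are. -/
theorem PD.poly {f : α → ℚ[X]} {n : α → ℕ} {c : α × ℕ → ℚ} (hn : PD n) (hc : PD c)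
    (h : ∀ a, (f a).natDegree < n a) (h' : ∀ a k, c (a, k) = (f a).coeff k) : PD f := by
  have := PD.ofCoefs (PD.map hn.range hc)
  refine cast (congrArg PD (funext fun a => ?_)) this
  exact ofCoefs_map_range (h a) _ fun k _ => h' a k

@[fun_prop]
theorem PD.poly_add {f g : α → ℚ[X]} (hf : PD f) (hg : PD g) : PD fun a => f a + g a :=
  PD.poly (n := fun a => (f a).natDegree + (g a).natDegree + 1)
    (c := fun s => (f s.1).coeff s.2 + (g s.1).coeff s.2) (by fun_prop) (by fun_prop)
    (fun a => by have := natDegree_add_le (f a) (g a); omega) fun a k => (coeff_add _ _ _).symm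

@[fun_prop]
theorem PD.poly_C {f : α → ℚ} (hf : PD f) : PD fun a => C (f a) := by
  have : PD fun a => PFinite.ofCoefs [f a] := by fun_prop
  simpa [PFinite.ofCoefs] using this

@[fun_prop]
theorem PD.poly_mul {f g : α → ℚ[X]} (hf : PD f) (hg : PD g) : PD fun a => f a * g a :=
  PD.poly (n := fun a => (f a).natDegree + (g a).natDegree + 1)
    (c := fun s => ∑ i ∈ Finset.range (s.2 + 1), (f s.1).coeff i * (g s.1).coeff (s.2 - i))
    (by fun_prop)
    (PD.rat_sum_range (f := fun s : (α × ℕ) × ℕ =>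
      (f s.1.1).coeff s.2 * (g s.1.1).coeff (s.1.2 - s.2)) (n := fun s : α × ℕ => s.2 + 1)
      (by fun_prop) (by fun_prop))
    (fun a => by have := natDegree_mul_le (p := f a) (q := g a); omega) fun a k => by
      rw [coeff_mul, Finset.Nat.sum_antidiagonal_eq_sum_range_succ_mk]

@[fun_prop]
theorem PD.poly_sub {f g : α → ℚ[X]} (hf : PD f) (hg : PD g) : PD fun a => f a - g a := by
  have : PD fun a => f a + C (-1) * g a := by fun_prop
  refine cast (congrArg PD (funext fun a => ?_)) this
  simp [sub_eq_add_neg]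

@[fun_prop]
theorem PD.poly_smul {c : α → ℚ} {f : α → ℚ[X]} (hc : PD c) (hf : PD f) :
    PD fun a => c a • f a := by
  have : PD fun a => C (c a) * f a := by fun_prop
  simpa [smul_eq_C_mul] using this

@[fun_prop]
theorem PD.poly_X_pow {n : α → ℕ} (hn : PD n) : PD fun a => (X ^ n a : ℚ[X]) := by
  have h1 : PD fun a => PFinite.ofCoefs ((List.range (n a)).map (fun _ => (0 : ℚ)) ++ [1]) :=
    PD.ofCoefs (PD.append (PD.map (f := fun _ : α × ℕ => (0 : ℚ)) hn.range (by fun_prop))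
      (by fun_prop))
  refine cast (congrArg PD (funext fun a => ?_)) h1
  ext k
  rw [coeff_ofCoefs, coeff_X_pow, List.getD_eq_getElem?_getD]
  rcases lt_trichotomy k (n a) with h | h | h
  · rw [List.getElem?_append_left (by simpa using h)]; simp [h, h.ne]
  · rw [List.getElem?_append_right (by simp [h])]; simp [h]
  · rw [List.getElem?_eq_none (by simp; omega)]; simp [h.ne']

theorem poly_eq_zero_iff_coefs (p : ℚ[X]) :
    p = 0 ↔ (decide (p.coeff 0 = 0) && decide ((p.natDegree : ℕ) = 0)) = true := by
  constructor
  · rintro rfl; simp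
  · intro h
    simp only [Bool.and_eq_true, decide_eq_true_eq] at h
    rw [eq_C_of_natDegree_eq_zero h.2, h.1, C_0]

@[fun_prop]
theorem PD.nat_eq_zero {f : α → ℕ} (hf : PD f) : PD fun a => decide (f a = 0) := by
  have := PD.listCases (l := fun a => List.replicate (f a) ()) (f := fun _ => true)
    (g := fun _ : α × Unit × List Unit => false) (by fun_prop) (by fun_prop) (by fun_prop)
  refine cast (congrArg PD (funext fun a => ?_)) this
  cases f a <;> rfl

@[fun_prop]
theorem PD.poly_eq_zero {f : α → ℚ[X]} (hf : PD f) : PD fun a => decide (f a = 0) := by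
  have : PD fun a => (decide ((f a).coeff 0 = 0) && decide ((f a).natDegree = 0)) := by fun_prop
  refine cast (congrArg PD (funext fun a => ?_)) this
  rw [Bool.eq_iff_iff, ← poly_eq_zero_iff_coefs, decide_eq_true_eq]

theorem list_sum_coeff (l : List ℚ[X]) (k : ℕ) : l.sum.coeff k = (l.map fun p => p.coeff k).sum := by
  induction l with
  | nil => simp
  | cons a l ih => simp [ih]

@[fun_prop]
theorem PD.poly_sum {l : α → List ℚ[X]} (hl : PD l) : PD fun a => (l a).sum := by
  -- The total number of listed coefficients is a computable bound for the degree of every summand.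
  refine PD.poly (n := fun a => ((l a).flatMap fun p => PFinite.coefs p).length + 1)
    (c := fun s => ((l s.1).map fun p => p.coeff s.2).sum) ?_ ?_ ?_ ?_
  · exact PD.nat_add (PD.length (PD.flatMap (f := fun s : α × ℚ[X] => PFinite.coefs s.2) hl
      (by fun_prop))) (by fun_prop)
  · exact PD.rat_sum (PD.map (f := fun s : (α × ℕ) × ℚ[X] => s.2.coeff s.1.2)
      (l := fun s : α × ℕ => l s.1) (by fun_prop) (by fun_prop))
  · intro a
    rw [Nat.lt_succ_iff]
    induction l a with
    | nil => simp
    | cons p l ih =>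
      rw [List.sum_cons, List.flatMap_cons, List.length_append, length_coefs]
      refine (natDegree_add_le _ _).trans (max_le ?_ ?_) <;> omega
  · exact fun a k => (list_sum_coeff _ _).symm

/-! #### Heights of polynomials -/

/-- All coefficients have the given height. -/
def PHt (c h : ℕ) (p : ℚ[X]) : Prop := ∀ k, Ht c h (p.coeff k)

theorem sz_poly_le {p : ℚ[X]} {d B : ℕ} (hd : p.natDegree ≤ d) (h : ∀ k, sz (p.coeff k) ≤ B) :
    sz p ≤ 1 + (d + 1) * (1 + B) := by
  rw [← sz_coefs]
  refine (sz_le_mul _ B fun q hq => ?_).trans ?_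
  · obtain ⟨k, -, rfl⟩ := List.mem_map.1 hq
    exact h k
  · rw [length_coefs]; gcongr

theorem natDegree_lt_sz (p : ℚ[X]) : p.natDegree < sz p := by
  have := length_le_sz (coefs p)
  rw [length_coefs, sz_coefs] at this
  omega

theorem PHt.sz_le {c h d : ℕ} {p : ℚ[X]} (H : PHt c h p) (hd : p.natDegree ≤ d) :
    sz p ≤ 1 + (d + 1) * (5 + h + Nat.size c) :=
  (sz_poly_le hd fun k => (H k).sz_le).trans (by gcongr 1 + (d + 1) * ?_; omega)

theorem PHt.pos {c h : ℕ} {p : ℚ[X]} (H : PHt c h p) : 0 < c := (H 0).1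

theorem PHt.mono {c h h' : ℕ} {p : ℚ[X]} (H : PHt c h p) (hh : h ≤ h') : PHt c h' p :=
  fun k => (H k).mono hh

theorem PHt.zero {c h : ℕ} (hc : 0 < c) : PHt c h 0 := fun k => by
  rw [coeff_zero]; exact Ht.zero hc

theorem PHt.neg {c h : ℕ} {p : ℚ[X]} (H : PHt c h p) : PHt c h (-p) := fun k => by
  rw [coeff_neg]; exact (H k).neg

theorem PHt.add {c h : ℕ} {p q : ℚ[X]} (hp : PHt c h p) (hq : PHt c h q) :
    PHt c (h + 1) (p + q) := fun k => by
  rw [coeff_add]; exact (hp k).add (hq k)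

theorem PHt.C_mul {c h c' h' : ℕ} {a : ℚ} {p : ℚ[X]} (ha : Ht c h a) (hp : PHt c' h' p) :
    PHt (c * c') (h + h') (C a * p) := fun k => by
  rw [coeff_C_mul]; exact ha.mul (hp k)

theorem PHt.sum {ι : Type*} {c h : ℕ} (hc : 0 < c) (s : Finset ι) (f : ι → ℚ[X])
    (hf : ∀ i ∈ s, PHt c h (f i)) : PHt c (h + s.card) (∑ i ∈ s, f i) := fun k => by
  rw [finsetSum_coeff]; exact Ht.sum hc s _ fun i hi => hf i hi k

theorem PHt.X_mul {c h : ℕ} {p : ℚ[X]} (hp : PHt c h p) : PHt c h (p * X) := fun k => by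
  cases k with
  | zero => rw [mul_coeff_zero, coeff_X_zero, mul_zero]; exact Ht.zero hp.pos
  | succ k => rw [coeff_mul_X]; exact hp k

theorem PHt.mul {c h c' h' d : ℕ} {p q : ℚ[X]} (hp : PHt c h p) (hq : PHt c' h' q)
    (hd : p.natDegree ≤ d) : PHt (c * c') (h + h' + (d + 1)) (p * q) := fun k => by
  have e : (p * q).coeff k = ∑ i ∈ Finset.range (d + 1), p.coeff i *
      (if i ≤ k then q.coeff (k - i) else 0) := by
    conv_lhs => rw [as_sum_range' p (d + 1) (by omega), Finset.sum_mul, finsetSum_coeff]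
    refine Finset.sum_congr rfl fun i _ => ?_
    rw [← C_mul_X_pow_eq_monomial, mul_assoc, coeff_C_mul, coeff_X_pow_mul']
  rw [e]
  have := Ht.sum (h := h + h') (Nat.mul_pos hp.pos hq.pos) (Finset.range (d + 1))
    (fun i => p.coeff i * (if i ≤ k then q.coeff (k - i) else 0)) fun i _ => (hp i).mul (by
      split_ifs
      · exact hq _
      · exact Ht.zero hq.pos)
  simpa using this

/-- Horner's scheme: replacing `q` by `q (X + 1) + a` uses two additions, hence two bits of height
per coefficient, and no new denominator. -/
theorem ofCoefs_comp_succ_bound {c h : ℕ} (hc : 0 < c) (l : List ℚ) (hl : ∀ q ∈ l, Ht c h q) :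
    PHt c (h + 2 * l.length) ((ofCoefs l).comp (X + C 1)) ∧
      ((ofCoefs l).comp (X + C 1)).natDegree ≤ l.length := by
  induction l with
  | nil => exact ⟨by simpa [ofCoefs] using PHt.zero hc, by simp [ofCoefs]⟩
  | cons a l ih =>
    obtain ⟨h1, h2⟩ := ih fun q hq => hl q (by simp [hq])
    have ha : PHt c h (C a) := fun k => by
      rw [coeff_C]
      split_ifs
      · exact hl a (by simp)
      · exact Ht.zero hc
    simp only [ofCoefs, add_comp, mul_comp, X_comp, C_comp, List.length_cons]
    constructor
    · have := ((h1.X_mul.add (h1.mono (Nat.le_refl _))).add (ha.mono (show h ≤ h + 2 * l.length + 1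
        by omega))).mono (show _ ≤ h + 2 * (l.length + 1) by omega)
      convert this using 1
      rw [C_1, mul_add, mul_one]
    · refine (natDegree_add_le _ _).trans (max_le ?_ (by simp))
      refine natDegree_mul_le.trans ?_
      have : (X + C 1 : ℚ[X]).natDegree ≤ 1 := (natDegree_X_add_C 1).le
      omega

theorem PHt.shift {c h d : ℕ} {p : ℚ[X]} (hp : PHt c h p) (hd : p.natDegree ≤ d) :
    PHt c (h + 2 * (d + 1)) (PFinite.shift 1 p) := by
  have := (ofCoefs_comp_succ_bound hp.pos (PFinite.coefs p) fun q hq => by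
    obtain ⟨k, -, rfl⟩ := List.mem_map.1 hq
    exact hp k).1
  rw [ofCoefs_coefs, length_coefs] at this
  rw [PFinite.shift, Nat.cast_one]
  exact this.mono (by omega)

@[fun_prop]
theorem PD.shift {f : α → ℚ[X]} (hf : PD f) : PD fun a => shift 1 (f a) := by
  -- The accumulators of Horner's scheme are shifts of polynomials whose coefficients form an upper
  -- segment of those of `f a`, so the height bound applies to all of them.
  have key : ∀ l : List ℚ, l.foldl (fun x c => x * (X + C 1) + C c) 0 =
      (PFinite.ofCoefs l.reverse).comp (X + C 1) := by
    intro l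
    induction l using List.reverseRecOn with
    | nil => simp [PFinite.ofCoefs]
    | append_singleton l a ih =>
      rw [List.foldl_append, List.foldl_cons, List.foldl_nil, ih, List.reverse_append,
        List.reverse_singleton, List.singleton_append]
      simp only [PFinite.ofCoefs, add_comp, mul_comp, X_comp, C_comp]
  have := PD.foldl (l := fun a => (PFinite.coefs (f a)).reverse) (b := fun _ => (0 : ℚ[X]))
    (f := fun s => s.2.1 * (X + C 1) + C s.2.2)
    (g := fun a => 1 + (sz (f a) + 1) * (5 + (2 * sz (f a) + 2 * sz (f a)) + (sz (f a) + 1)))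
    (by fun_prop) (by fun_prop) (by fun_prop) (by
      have := hf.bound
      exact (PB.const _).add ((this.add (PB.const _)).mul (((PB.const _).add
        (((PB.const _).mul this).add ((PB.const _).mul this))).add (this.add (PB.const _))))) (by
      intro a l₁ l₂ h
      change sz (l₁.foldl (fun x c => x * (X + C 1) + C c) 0) ≤ _
      rw [key]
      obtain ⟨c, hc, hcl, hq⟩ := exists_common_den (PFinite.coefs (f a))
      rw [sz_coefs] at hcl hq
      obtain ⟨h1, h2⟩ := ofCoefs_comp_succ_bound hc l₁.reverse (fun q hq' => hq q (by
        rw [← List.mem_reverse, h]; simp at hq'; simp [hq']))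
      have h3 : l₁.reverse.length ≤ sz (f a) := by
        have := congrArg List.length h
        rw [List.length_reverse, List.length_append] at this
        have h4 := length_le_sz (PFinite.coefs (f a))
        rw [sz_coefs] at h4
        rw [List.length_reverse]; omega
      refine (h1.sz_le h2).trans ?_
      have := size_le_of_le_two_pow hcl
      gcongr)
  refine cast (congrArg PD (funext fun a => ?_)) this
  change ((PFinite.coefs (f a)).reverse).foldl (fun x c => x * (X + C 1) + C c) 0 = _
  rw [key, List.reverse_reverse, ofCoefs_coefs, PFinite.shift, Nat.cast_one]

end

end PFinite

namespace PFinite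

noncomputable section

variable {α β γ δ : Type} [Enc α] [Enc β] [Enc γ] [Enc δ]

/-! ### Gram-Schmidt orthogonalisation of rational polynomials -/

/-- The scalar product of the coefficient vectors. -/
def pdot (p q : ℚ[X]) : ℚ := ∑ i ∈ Finset.range (p.natDegree + 1), p.coeff i * q.coeff i

theorem pdot_eq {p : ℚ[X]} {n : ℕ} (h : p.natDegree < n) (q : ℚ[X]) :
    pdot p q = ∑ i ∈ Finset.range n, p.coeff i * q.coeff i := by
  refine Finset.sum_subset (Finset.range_subset_range.2 h) fun i _ hi => ?_
  rw [Finset.mem_range, not_lt] at hi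
  rw [coeff_eq_zero_of_natDegree_lt (by omega), zero_mul]

theorem pdot_comm (p q : ℚ[X]) : pdot p q = pdot q p := by
  rw [pdot_eq (n := p.natDegree + q.natDegree + 1) (by omega),
    pdot_eq (n := p.natDegree + q.natDegree + 1) (by omega)]
  exact Finset.sum_congr rfl fun i _ => mul_comm _ _

theorem pdot_self_eq_zero {p : ℚ[X]} (h : pdot p p = 0) : p = 0 := by
  rw [pdot, Finset.sum_eq_zero_iff_of_nonneg fun i _ => mul_self_nonneg _] at h
  ext i
  by_cases hi : i < p.natDegree + 1
  · simpa using h i (Finset.mem_range.2 hi)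
  · exact coeff_eq_zero_of_natDegree_lt (by omega)

/-- The scalar product with a fixed polynomial, as a linear form. -/
def dotForm (q : ℚ[X]) : ℚ[X] →ₗ[ℚ] ℚ where
  toFun p := pdot p q
  map_add' p p' := by
    have := natDegree_add_le p p'
    rw [pdot_eq (n := p.natDegree + p'.natDegree + 1) (by omega),
      pdot_eq (n := p.natDegree + p'.natDegree + 1) (by omega),
      pdot_eq (n := p.natDegree + p'.natDegree + 1) (by omega), ← Finset.sum_add_distrib]
    exact Finset.sum_congr rfl fun i _ => by rw [coeff_add, add_mul]
  map_smul' c p := by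
    rw [pdot_eq (n := p.natDegree + 1) (Nat.lt_succ_of_le (natDegree_smul_le c p)), pdot,
      RingHom.id_apply, smul_eq_mul, Finset.mul_sum]
    exact Finset.sum_congr rfl fun i _ => by rw [coeff_smul, smul_eq_mul, mul_assoc]

theorem dotForm_apply (p q : ℚ[X]) : dotForm q p = pdot p q := rfl

/-- `r` is the component of `v` orthogonal to the span of `L`. -/
def IsRes (L : List ℚ[X]) (v r : ℚ[X]) : Prop :=
  v - r ∈ Submodule.span ℚ {u | u ∈ L} ∧ ∀ u ∈ L, pdot r u = 0

theorem pdot_eq_zero_of_mem_span {L : List ℚ[X]} {r w : ℚ[X]} (h : ∀ u ∈ L, pdot r u = 0)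
    (hw : w ∈ Submodule.span ℚ {u | u ∈ L}) : pdot r w = 0 := by
  have : Submodule.span ℚ {u | u ∈ L} ≤ LinearMap.ker (dotForm r) := Submodule.span_le.2
    fun u hu => by
      change pdot u r = 0
      rw [pdot_comm]; exact h u hu
  rw [pdot_comm]
  exact this hw

/-- If `v` lies in the span, then so does `r`, which is therefore orthogonal to itself; the form is
positive definite over `ℚ`. -/
theorem IsRes.eq_zero_iff {L : List ℚ[X]} {v r : ℚ[X]} (h : IsRes L v r) :
    r = 0 ↔ v ∈ Submodule.span ℚ {u | u ∈ L} := by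
  constructor
  · rintro rfl; simpa using h.1
  · intro hv
    refine pdot_self_eq_zero (pdot_eq_zero_of_mem_span h.2 ?_)
    have := Submodule.sub_mem _ hv h.1
    rwa [sub_sub_cancel] at this

/-- The component of `v` orthogonal to all elements of the orthogonal family `O`. -/
def res (O : List ℚ[X]) (v : ℚ[X]) : ℚ[X] := v - (O.map fun b => (pdot v b / pdot b b) • b).sum

/-- An orthogonal family with the same span. -/
def gs (L : List ℚ[X]) : List ℚ[X] := L.foldl (fun O v => res O v :: O) []

/-- The test for membership in the linear span. -/
def inSpan (L : List ℚ[X]) (v : ℚ[X]) : Bool := decide (res (gs L) v = 0)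

theorem isRes_res {O : List ℚ[X]} (hO : O.Pairwise fun p q => pdot p q = 0) (v : ℚ[X]) :
    IsRes O v (res O v) := by
  constructor
  · rw [res, sub_sub_cancel]
    refine list_sum_mem fun x hx => ?_
    obtain ⟨b, hb, rfl⟩ := List.mem_map.1 hx
    exact Submodule.smul_mem _ _ (Submodule.subset_span hb)
  · have key : ∀ u ∈ O, pdot (O.map fun b => (pdot v b / pdot b b) • b).sum u = pdot v u := by
      induction O with
      | nil => simp
      | cons o O ih =>
        rw [List.pairwise_cons] at hO
        intro u hu
        rw [List.map_cons, List.sum_cons, ← dotForm_apply, map_add, map_smul, dotForm_apply,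
          dotForm_apply, smul_eq_mul]
        rcases List.mem_cons.1 hu with rfl | hu
        · have h0 : pdot (O.map fun b => (pdot v b / pdot b b) • b).sum u = 0 := by
            rw [pdot_comm]
            refine pdot_eq_zero_of_mem_span hO.1 (list_sum_mem fun x hx => ?_)
            obtain ⟨b, hb, rfl⟩ := List.mem_map.1 hx
            exact Submodule.smul_mem _ _ (Submodule.subset_span hb)
          rw [h0, add_zero]
          -- Dependent vectors leave zeros in the orthogonal family. For such a `u` the coefficient
          -- is a division by zero, with value `0`, and both sides vanish.
          by_cases hz : pdot u u = 0
          · have := pdot_self_eq_zero hz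
            rw [hz, this, ← pdot_comm 0]; simp [pdot]
          · exact div_mul_cancel₀ _ hz
        · rw [hO.1 u hu, mul_zero, zero_add, ih hO.2 u hu]
    intro u hu
    rw [res, ← dotForm_apply, map_sub, dotForm_apply, dotForm_apply, key u hu, sub_self]

theorem gs_append_singleton (L : List ℚ[X]) (v : ℚ[X]) :
    gs (L ++ [v]) = res (gs L) v :: gs L := by
  simp [gs]

theorem gs_spec (L : List ℚ[X]) : (gs L).Pairwise (fun p q => pdot p q = 0) ∧
    Submodule.span ℚ {u | u ∈ gs L} = Submodule.span ℚ {u | u ∈ L} := by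
  induction L using List.reverseRecOn with
  | nil => exact ⟨by simp [gs], rfl⟩
  | append_singleton L v ih =>
    obtain ⟨h1, h2⟩ := ih
    have h3 := isRes_res h1 v
    rw [gs_append_singleton]
    refine ⟨List.pairwise_cons.2 ⟨h3.2, h1⟩, ?_⟩
    have e1 : {u | u ∈ res (gs L) v :: gs L} = insert (res (gs L) v) {u | u ∈ gs L} := by
      ext; simp
    have e2 : {u | u ∈ L ++ [v]} = insert v {u | u ∈ L} := by
      ext; simp [or_comm]
    rw [e1, e2, Submodule.span_insert, Submodule.span_insert, h2]
    have h4 := h3.1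
    rw [h2] at h4
    apply le_antisymm
    · refine sup_le ?_ le_sup_right
      rw [Submodule.span_singleton_le_iff_mem]
      have : res (gs L) v = v - (v - res (gs L) v) := by ring
      rw [this]
      exact Submodule.sub_mem _ (Submodule.mem_sup_left (Submodule.mem_span_singleton_self v))
        (Submodule.mem_sup_right h4)
    · refine sup_le ?_ le_sup_right
      rw [Submodule.span_singleton_le_iff_mem]
      have := Submodule.add_mem _ (Submodule.mem_sup_left (Submodule.mem_span_singleton_self
        (R := ℚ) (res (gs L) v))) (Submodule.mem_sup_right h4)
      rwa [add_sub_cancel] at this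

theorem isRes_gs (L : List ℚ[X]) (v : ℚ[X]) : IsRes L v (res (gs L) v) := by
  obtain ⟨h1, h2⟩ := gs_spec L
  have h3 := isRes_res h1 v
  refine ⟨h2 ▸ h3.1, fun u hu => pdot_eq_zero_of_mem_span h3.2 ?_⟩
  rw [h2]
  exact Submodule.subset_span hu

theorem inSpan_iff (L : List ℚ[X]) (v : ℚ[X]) :
    inSpan L v = true ↔ v ∈ Submodule.span ℚ {u | u ∈ L} := by
  rw [inSpan, decide_eq_true_eq, (isRes_gs L v).eq_zero_iff]

/-! #### The size of orthogonal components -/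

/-- The Leibniz expansion is enough here: the factorial is absorbed by `2 ^ (k * k)`, and the
products of entries by `2 ^ (m * k)`. -/
theorem det_natAbs_le {ι : Type*} [Fintype ι] [DecidableEq ι] (M : Matrix ι ι ℤ) {k m : ℕ}
    (hk : Fintype.card ι ≤ k) (h : ∀ i j, (M i j).natAbs ≤ 2 ^ m) :
    M.det.natAbs ≤ 2 ^ (k * k + m * k) := by
  have h1 := Matrix.det_le (A := M) (abv := AbsoluteValue.abs) (x := (2 : ℤ) ^ m) fun i j => by
    rw [AbsoluteValue.abs_apply, Int.abs_eq_natAbs]; exact_mod_cast h i j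
  rw [AbsoluteValue.abs_apply, Int.abs_eq_natAbs, nsmul_eq_mul] at h1
  have h2 : M.det.natAbs ≤ (Fintype.card ι).factorial * (2 ^ m) ^ Fintype.card ι := by
    exact_mod_cast h1
  refine h2.trans ?_
  set c := Fintype.card ι
  rw [pow_add]
  refine Nat.mul_le_mul ?_ ?_
  · calc c.factorial ≤ c ^ c := Nat.factorial_le_pow c
      _ ≤ (2 ^ k) ^ c := Nat.pow_le_pow_left (hk.trans (Nat.lt_two_pow_self).le) c
      _ = 2 ^ (k * c) := (pow_mul _ _ _).symm
      _ ≤ _ := Nat.pow_le_pow_right (by norm_num) (Nat.mul_le_mul_left _ hk)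
  · rw [← pow_mul]
    exact Nat.pow_le_pow_right (by norm_num) (Nat.mul_le_mul_left _ hk)

theorem Ht.pdot {h h' N : ℕ} {p q : ℚ[X]} (hp : PHt 1 h p) (hq : PHt 1 h' q)
    (hN : p.natDegree ≤ N) : Ht 1 (h + h' + (N + 1)) (pdot p q) := by
  have := Ht.sum (c := 1) (h := h + h') one_pos (Finset.range (p.natDegree + 1))
    (fun i => p.coeff i * q.coeff i) fun i _ => by simpa using (hp i).mul (hq i)
  rw [Finset.card_range] at this
  exact this.mono (by omega)

theorem Ht.exists_int {h : ℕ} {q : ℚ} (H : Ht 1 h q) : ∃ z : ℤ, (z : ℚ) = q ∧ z.natAbs ≤ 2 ^ h := by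
  obtain ⟨_, z, hz, hb⟩ := H
  exact ⟨z, by simpa using hz.symm, hb⟩

/-- The component `r` is determined by `L` and `v`, whatever was computed before, so heights do not
accumulate along Gram-Schmidt. For a basis `b` of the span chosen in `L`, the coefficients of `v -
r` solve a linear system with the Gram matrix of `b` and right-hand side the products of `v` with
`b`. With integral data, Cramer's rule gives them as quotients of bounded integers by the Gram
determinant, whose absolute value serves as `D`. -/
theorem isRes_height {L : List ℚ[X]} {v r : ℚ[X]} {h N k m : ℕ} (hr : IsRes L v r)
    (hL : ∀ u ∈ L, PHt 1 h u) (hv : PHt 1 h v) (hLN : ∀ u ∈ L, u.natDegree ≤ N)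
    (hvN : v.natDegree ≤ N) (hk : L.length = k) (hm : m = k * k + (h + h + (N + 1)) * k) :
    ∃ D : ℕ, D ≤ 2 ^ m ∧ PHt D (m + h + k + 1) r := by
  obtain ⟨b, hbL, hspan, hli⟩ := exists_linearIndependent ℚ {u | u ∈ L}
  have hfin : b.Finite := (List.finite_toSet L).subset hbL
  have : Fintype b := hfin.fintype
  classical
  have hcard : Fintype.card b ≤ k := by
    rw [← Set.toFinset_card, ← hk]
    refine (Finset.card_le_card (t := L.toFinset) fun u hu => ?_).trans (List.toFinset_card_le L)
    rw [List.mem_toFinset]; exact hbL (Set.mem_toFinset.1 hu)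
  choose Z hZ hZb using fun (i j : b) =>
    (Ht.pdot (hL j (hbL j.2)) (hL i (hbL i.2)) (hLN j (hbL j.2))).exists_int
  choose y hy hyb using fun (j : b) => (Ht.pdot hv (hL j (hbL j.2)) hvN).exists_int
  have hmem := hr.1
  rw [← hspan] at hmem
  obtain ⟨c, hc⟩ : ∃ c : b → ℚ, ∑ i, c i • (i : ℚ[X]) = v - r := by
    have : b = Set.range (fun i : b => (i : ℚ[X])) := Subtype.range_coe.symm
    rw [this] at hmem
    exact (Submodule.mem_span_range_iff_exists_fun ℚ).1 hmem
  set M : Matrix b b ℤ := Matrix.of Z with hM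
  set G : Matrix b b ℚ := M.map (Int.castRingHom ℚ) with hG
  have hGe : ∀ i j, G i j = PFinite.pdot (j : ℚ[X]) (i : ℚ[X]) := fun i j => by
    simp only [hG, hM, Matrix.map_apply, Matrix.of_apply]; exact hZ i j
  have hGc : G.mulVec c = fun j => (y j : ℚ) := by
    funext j
    have h1 : PFinite.pdot (v - r) j = y j := by
      rw [hy, ← dotForm_apply, map_sub, dotForm_apply, dotForm_apply, hr.2 j (hbL j.2), sub_zero]
    rw [← h1, ← hc, ← dotForm_apply, map_sum]
    refine Finset.sum_congr rfl fun i _ => ?_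
    simp only [map_smul, dotForm_apply, smul_eq_mul, hGe]; ring
  have hdet : (M.det : ℚ) = G.det := by
    rw [hG, ← RingHom.mapMatrix_apply, ← RingHom.map_det]; rfl
  -- A kernel vector of the Gram matrix gives a combination orthogonal to the whole basis, hence to
  -- itself. It is then zero, against independence.
  have hne : G.det ≠ 0 := by
    intro h0
    obtain ⟨x, hx0, hx⟩ := Matrix.exists_mulVec_eq_zero_iff.2 h0
    set w : ℚ[X] := ∑ i, x i • (i : ℚ[X]) with hw
    have h1 : ∀ j : b, PFinite.pdot w j = 0 := fun j => by
      have := congrFun hx j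
      rw [hw, ← dotForm_apply, map_sum]
      rw [Pi.zero_apply] at this
      rw [← this]
      refine Finset.sum_congr rfl fun i _ => ?_
      simp only [map_smul, dotForm_apply, smul_eq_mul, hGe]; ring
    have h2 : PFinite.pdot w w = 0 := by
      conv_lhs => rw [pdot_comm, hw, ← dotForm_apply, map_sum]
      refine Finset.sum_eq_zero fun i _ => ?_
      rw [map_smul, dotForm_apply, ← hw, pdot_comm, h1, smul_zero]
    have h3 := Fintype.linearIndependent_iff.1 hli x (pdot_self_eq_zero h2)
    exact hx0 (funext h3)
  have hcr : ∀ i, G.det * c i = (M.cramer y i : ℤ) := fun i => by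
    have h1 : G.cramer (G.mulVec c) = G.det • c := by
      rw [Matrix.cramer_eq_adjugate_mulVec, Matrix.mulVec_mulVec, Matrix.adjugate_mul,
        Matrix.smul_mulVec, Matrix.one_mulVec]
    have h2 := congrFun h1 i
    rw [Pi.smul_apply, smul_eq_mul] at h2
    rw [← h2, hGc, Matrix.cramer_apply, Matrix.cramer_apply]
    have : (G.updateCol i fun j => (y j : ℚ)) = (M.updateCol i y).map (Int.castRingHom ℚ) := by
      ext a b'
      simp only [Matrix.updateCol_apply, Matrix.map_apply, hG]
      split_ifs <;> rfl
    rw [this, ← RingHom.mapMatrix_apply, ← RingHom.map_det]; rfl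
  have hDb : M.det.natAbs ≤ 2 ^ m := by
    rw [hm]; exact det_natAbs_le M hcard fun i j => hZb i j
  have hEb : ∀ i, (M.cramer y i).natAbs ≤ 2 ^ m := fun i => by
    rw [hm, Matrix.cramer_apply]
    refine det_natAbs_le _ hcard fun a b' => ?_
    rw [Matrix.updateCol_apply]
    split_ifs
    · exact hyb a
    · exact hZb a b'
  have hr' : C G.det * r = C G.det * v - ∑ i : b, C ((M.cramer y i : ℤ) : ℚ) * (i : ℚ[X]) := by
    have : r = v - ∑ i, c i • (i : ℚ[X]) := by rw [hc]; ring
    conv_lhs => rw [this]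
    rw [mul_sub, Finset.mul_sum]
    congr 1
    refine Finset.sum_congr rfl fun i _ => ?_
    rw [smul_eq_C_mul, ← mul_assoc, ← C_mul, hcr]
  have hHt : ∀ z : ℤ, z.natAbs ≤ 2 ^ m → Ht 1 m (z : ℚ) := fun z hz => ⟨one_pos, z, by simp, hz⟩
  have hP : PHt 1 (m + h + k + 1) (C G.det * r) := by
    rw [hr', sub_eq_add_neg]
    have h1 : PHt 1 (m + h) (C G.det * v) := by
      rw [← hdet]
      simpa using PHt.C_mul (hHt _ hDb) hv
    have h2 : PHt 1 (m + h + k) (∑ i : b, C ((M.cramer y i : ℤ) : ℚ) * (i : ℚ[X])) := by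
      refine (PHt.sum (h := m + h) one_pos Finset.univ _ fun i _ => ?_).mono
        (by rw [Finset.card_univ]; omega)
      simpa using PHt.C_mul (hHt _ (hEb i)) (hL i (hbL i.2))
    exact (h1.mono (by omega)).add h2.neg
  refine ⟨M.det.natAbs, hDb, fun j => ?_⟩
  have hMne : M.det ≠ 0 := by
    intro h0; rw [h0] at hdet; exact hne (by rw [← hdet]; simp)
  obtain ⟨_, z, hz, hzb⟩ := hP j
  -- The denominator has to be positive, so the sign of the determinant moves to the numerator.
  refine ⟨Int.natAbs_pos.2 hMne, M.det.sign * z, ?_, ?_⟩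
  · rw [coeff_C_mul, ← hdet, Nat.cast_one, one_mul] at hz
    push_cast
    rw [← hz, ← mul_assoc, Nat.cast_natAbs, ← Int.sign_mul_self_eq_abs]
    push_cast
    ring
  · rw [Int.natAbs_mul, Int.natAbs_sign_of_ne_zero hMne, one_mul]; exact hzb

/-- A bound for the size of orthogonal components, in terms of a bound `s` for the size of the
data. -/
def resBound (s : ℕ) : ℕ :=
  1 + (s + 1) * (5 + ((s * s + (2 * s + 2 * s + (s + 1)) * s) + 2 * s + s + 1) +
    ((s * s + (2 * s + 2 * s + (s + 1)) * s) + s + 1))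

/-- Orthogonal components scale with the data: multiplication of `L`, `v` and `r` by a common
denominator `c` reduces to the integral case, and `D * c` is then a denominator for `r`. The degree
of `r` is controlled because `v - r` is a combination of `L`. -/
theorem isRes_sz_le {L : List ℚ[X]} {v r : ℚ[X]} (hr : IsRes L v r) {s : ℕ}
    (hs : sz L + sz v ≤ s) : sz r ≤ resBound s := by
  set l : List ℚ := coefs v ++ L.flatMap coefs with hl
  have hls : sz l ≤ s := by
    have h1 := sz_append (coefs v) (L.flatMap coefs)
    have h2 : ∀ L : List ℚ[X], sz (L.flatMap coefs) ≤ sz L := by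
      intro L
      induction L with
      | nil => simp [sz_nil]
      | cons p L ih =>
        have h3 := sz_append (coefs p) (L.flatMap coefs)
        rw [sz_coefs] at h3
        rw [List.flatMap_cons, sz_cons]; omega
    have h3 := h2 L
    rw [sz_coefs] at h1
    rw [hl]; omega
  obtain ⟨c, hc, hcl, hq⟩ := exists_common_den l
  have hc' : (c : ℚ) ≠ 0 := by exact_mod_cast hc.ne'
  have hcs : c ≤ 2 ^ s := hcl.trans (Nat.pow_le_pow_right (by norm_num) hls)
  have key : ∀ p : ℚ[X], (∀ q ∈ coefs p, q ∈ l) → PHt 1 (2 * s) (C (c : ℚ) * p) := fun p hp k => by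
    have h0 : Ht c (2 * s) (p.coeff k) := by
      rw [coeff_eq_getD]
      by_cases hk : k < (coefs p).length
      · rw [List.getD_eq_getElem _ _ hk]
        exact (hq _ (hp _ (List.getElem_mem hk))).mono (by omega)
      · rw [List.getD_eq_default _ _ (by omega)]; exact Ht.zero hc
    obtain ⟨_, z, hz, hb⟩ := h0
    exact ⟨one_pos, z, by rw [coeff_C_mul, hz]; simp, hb⟩
  have hr' : IsRes (L.map fun u => C (c : ℚ) * u) (C (c : ℚ) * v) (C (c : ℚ) * r) := by
    constructor
    · rw [← mul_sub]
      have : Submodule.map (LinearMap.mulLeft ℚ (C (c : ℚ))) (Submodule.span ℚ {u | u ∈ L}) ≤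
          Submodule.span ℚ {u | u ∈ L.map fun u => C (c : ℚ) * u} := by
        rw [Submodule.map_span_le]
        intro u hu
        exact Submodule.subset_span (List.mem_map.2 ⟨u, hu, rfl⟩)
      exact this ⟨_, hr.1, rfl⟩
    · intro u hu
      obtain ⟨w, hw, rfl⟩ := List.mem_map.1 hu
      rw [← smul_eq_C_mul, ← dotForm_apply, map_smul, dotForm_apply, pdot_comm, ← smul_eq_C_mul,
        ← dotForm_apply, map_smul, dotForm_apply, pdot_comm, hr.2 w hw, smul_zero, smul_zero]
  have hdL : ∀ u ∈ L, u.natDegree ≤ s := fun u hu => by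
    have h1 := natDegree_lt_sz u
    have h2 := sz_mem hu
    omega
  have hdv : v.natDegree ≤ s := by
    have h1 := natDegree_lt_sz v
    omega
  have hdeg : ∀ p : ℚ[X], (C (c : ℚ) * p).natDegree = p.natDegree := fun p => by
    rw [natDegree_C_mul hc']
  obtain ⟨D, hD, hP⟩ := isRes_height (h := 2 * s) (N := s) (k := L.length)
    (m := L.length * L.length + (2 * s + 2 * s + (s + 1)) * L.length) hr' (by
      intro u hu
      obtain ⟨w, hw, rfl⟩ := List.mem_map.1 hu
      refine key w fun q hq => List.mem_append_right _ (List.mem_flatMap.2 ⟨w, hw, hq⟩))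
    (key v fun q hq => List.mem_append_left _ hq) (by
      intro u hu
      obtain ⟨w, hw, rfl⟩ := List.mem_map.1 hu
      rw [hdeg]; exact hdL w hw) (by rw [hdeg]; exact hdv) (by simp) rfl
  have hk : L.length ≤ s := by have := length_le_sz L; omega
  set m := L.length * L.length + (2 * s + 2 * s + (s + 1)) * L.length with hmdef
  have hm : m ≤ s * s + (2 * s + 2 * s + (s + 1)) * s := by rw [hmdef]; gcongr
  have hP2 : PHt (D * c) (m + 2 * s + L.length + 1) r := fun j => by
    obtain ⟨h0, z, hz, hb⟩ := hP j
    refine ⟨Nat.mul_pos h0 hc, z, ?_, hb⟩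
    rw [← hz, coeff_C_mul]; push_cast; ring
  have hrd : r.natDegree ≤ s := by
    have h1 : ∀ w ∈ Submodule.span ℚ {u | u ∈ L}, w.natDegree ≤ s := fun w hw => by
      have : Submodule.span ℚ {u | u ∈ L} ≤ degreeLT ℚ (s + 1) := Submodule.span_le.2
        fun u hu => mem_degreeLT.2 ((degree_le_natDegree).trans_lt (by
          exact_mod_cast Nat.lt_succ_of_le (hdL u hu)))
      have h2 := mem_degreeLT.1 (this hw)
      by_cases hw0 : w = 0
      · simp [hw0]
      · rw [degree_eq_natDegree hw0] at h2
        exact Nat.lt_succ_iff.1 (by exact_mod_cast h2)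
    have h2 : r = v - (v - r) := by ring
    rw [h2]
    exact (natDegree_sub_le _ _).trans (max_le hdv (h1 _ hr.1))
  refine (hP2.sz_le hrd).trans ?_
  have hDc : Nat.size (D * c) ≤ m + s + 1 := by
    refine size_le_of_le_two_pow ?_
    rw [pow_add]; exact Nat.mul_le_mul hD hcs
  rw [resBound]
  gcongr
  omega

theorem PB.resBound {f : α → ℕ} (hf : PB f) : PB fun a => resBound (f a) := by
  have hm : PB fun a => f a * f a + (2 * f a + 2 * f a + (f a + 1)) * f a :=
    (hf.mul hf).add (((((PB.const _).mul hf).add ((PB.const _).mul hf)).add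
      (hf.add (PB.const _))).mul hf)
  exact (PB.const _).add ((hf.add (PB.const _)).mul (((PB.const _).add
    (((hm.add ((PB.const _).mul hf)).add hf).add (PB.const _))).add ((hm.add hf).add (PB.const _))))

theorem resBound_mono {s t : ℕ} (h : s ≤ t) : resBound s ≤ resBound t := by
  unfold resBound; gcongr

/-! #### Computation of linear spans -/

@[fun_prop]
theorem PD.pdot {f g : α → ℚ[X]} (hf : PD f) (hg : PD g) : PD fun a => pdot (f a) (g a) :=
  PD.rat_sum_range (f := fun s : α × ℕ => (f s.1).coeff s.2 * (g s.1).coeff s.2)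
    (n := fun a => (f a).natDegree + 1) (by fun_prop) (by fun_prop)

@[fun_prop]
theorem PD.res {O : α → List ℚ[X]} {v : α → ℚ[X]} (hO : PD O) (hv : PD v) :
    PD fun a => res (O a) (v a) :=
  PD.poly_sub hv (PD.poly_sum (PD.map (f := fun s : α × ℚ[X] =>
    (PFinite.pdot (v s.1) s.2 / PFinite.pdot s.2 s.2) • s.2) hO (by fun_prop)))

@[fun_prop]
theorem PD.gs {L : α → List ℚ[X]} (hL : PD L) : PD fun a => gs (L a) := by
  refine PD.foldl (l := L) (b := fun _ => ([] : List ℚ[X])) (f := fun s =>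
    PFinite.res s.2.1 s.2.2 :: s.2.1) (g := fun a => 1 + sz (L a) * (1 + PFinite.resBound (sz (L a))))
    hL (by fun_prop) (by fun_prop) ((PB.const _).add (hL.bound.mul ((PB.const _).add
      (PB.resBound hL.bound)))) ?_
  intro a l₁ l₂ h
  change sz (PFinite.gs l₁) ≤ _
  have h1 : sz l₁ ≤ sz (L a) := sz_sublist (by rw [h]; simp)
  -- Each member of the orthogonal family is the component of one vector of the list relative to the
  -- vectors before it, so `isRes_sz_le` applies to it directly.
  have key : ∀ l : List ℚ[X], (PFinite.gs l).length = l.length ∧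
      ∀ u ∈ PFinite.gs l, sz u ≤ PFinite.resBound (sz l) := by
    intro l
    induction l using List.reverseRecOn with
    | nil => simp [PFinite.gs]
    | append_singleton l v ih =>
      have h2 := sz_append l [v]
      have h3 : sz [v] = 1 + sz v + 1 := by rw [sz_cons, sz_nil]
      rw [gs_append_singleton]
      refine ⟨by simp [ih.1], fun u hu => ?_⟩
      rcases List.mem_cons.1 hu with rfl | hu
      · exact isRes_sz_le (isRes_gs l v) (by omega)
      · exact (ih.2 u hu).trans (resBound_mono (by omega))
  refine (sz_le_mul _ _ (key l₁).2).trans ?_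
  rw [(key l₁).1]
  have h2 := length_le_sz l₁
  have h3 := resBound_mono h1
  gcongr
  omega

@[fun_prop]
theorem PD.inSpan {L : α → List ℚ[X]} {v : α → ℚ[X]} (hL : PD L) (hv : PD v) :
    PD fun a => inSpan (L a) (v a) := by
  unfold PFinite.inSpan; fun_prop

end

end PFinite

namespace PFinite

noncomputable section

/-! ### Matrices adapted to a set of polynomial vectors -/

section Adapted

variable {n : ℕ}

theorem toRatFunc_add (v w : Fin n → ℚ[X]) : toRatFunc (v + w) = toRatFunc v + toRatFunc w := by
  funext i; simp [toRatFunc]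

theorem toRatFunc_smul (p : ℚ[X]) (v : Fin n → ℚ[X]) :
    toRatFunc (p • v) = algebraMap ℚ[X] (RatFunc ℚ) p • toRatFunc v := by
  funext i; simp [toRatFunc]

theorem toRatFunc_zero : toRatFunc (0 : Fin n → ℚ[X]) = 0 := by
  funext i; simp [toRatFunc]

theorem toRatFunc_injective : Function.Injective (toRatFunc : (Fin n → ℚ[X]) → _) :=
  fun _ _ h => funext fun i => RatFunc.algebraMap_injective ℚ (congrFun h i)

/-- Passage to rational functions, as a linear map. -/
def ratFuncMap : (Fin n → ℚ[X]) →ₗ[ℚ[X]] (Fin n → RatFunc ℚ) where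
  toFun := toRatFunc
  map_add' := toRatFunc_add
  map_smul' p v := by
    rw [toRatFunc_smul, RingHom.id_apply, algebraMap_smul]

/-- An invertible matrix whose rows are elements of `S` (those in `I`) that span `S` over the
rational functions, completed by other elements of `S` or unit vectors. -/
structure Adapted (S : Set (Fin n → ℚ[X])) (B : Matrix (Fin n) (Fin n) ℚ[X]) (I : Set (Fin n)) :
    Prop where
  det_ne : B.det ≠ 0
  mem : ∀ i ∈ I, B i ∈ S
  mem_or : ∀ i, B i ∈ S ∨ ∃ j, B i = Pi.single j 1
  cramer_eq_zero : ∀ v, toRatFunc v ∈ Submodule.span (RatFunc ℚ) (toRatFunc '' S) →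
    ∀ i ∉ I, B.transpose.cramer v i = 0

/-- A maximal independent subfamily of `S` is extended by unit vectors to a basis of `ℚ(x)^n`. If
`v` is a combination of the rows in `I`, then putting it in place of another row makes the
determinant vanish, and these determinants are the Cramer coordinates outside `I`. -/
theorem exists_adapted (S : Set (Fin n → ℚ[X])) : ∃ B I, Adapted S B I := by
  classical
  set P : S ⊕ Fin n → (Fin n → ℚ[X]) := Sum.elim Subtype.val fun j => Pi.single j 1 with hP
  set f : S ⊕ Fin n → (Fin n → RatFunc ℚ) := fun i => toRatFunc (P i) with hf
  obtain ⟨b₁, hb₁, -, hsp₁, hli₁⟩ := exists_linearIndepOn_extension (v := f)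
    (linearIndepOn_empty (RatFunc ℚ) f) (Set.empty_subset (Set.range Sum.inl))
  obtain ⟨b₂, -, hb₂, hsp₂, hli₂⟩ := exists_linearIndepOn_extension hli₁ (Set.subset_univ b₁)
  have htop : ⊤ ≤ Submodule.span (RatFunc ℚ) (Set.range fun i : b₂ => f i) := by
    have h1 : Set.range (fun i : b₂ => f i) = f '' b₂ := by
      ext; simp
    rw [h1, ← (Pi.basisFun (RatFunc ℚ) (Fin n)).span_eq, Submodule.span_le]
    rintro _ ⟨j, rfl⟩
    refine hsp₂ ⟨Sum.inr j, trivial, ?_⟩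
    funext k
    rw [Pi.basisFun_apply]
    simp only [hf, hP, Sum.elim_inr, toRatFunc, Pi.single_apply]
    split_ifs <;> simp
  set bas := Module.Basis.mk (v := fun i : b₂ => f i) hli₂ htop with hbas
  have : Fintype b₂ := FiniteDimensional.fintypeBasisIndex bas
  have hcard : Fintype.card (Fin n) = Fintype.card b₂ := by
    rw [← Module.finrank_eq_card_basis bas, Module.finrank_pi]
  obtain ⟨e⟩ := Fintype.card_eq.1 hcard
  set B : Matrix (Fin n) (Fin n) ℚ[X] := Matrix.of fun i => P (e i) with hB
  have hBe : ∀ i, B i = P (e i) := fun i => rfl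
  set φ := algebraMap ℚ[X] (RatFunc ℚ)
  have hrow : LinearIndependent (RatFunc ℚ) (B.map φ).row := hli₂.comp e e.injective
  have hdet : φ B.det ≠ 0 := by
    rw [RingHom.map_det, RingHom.mapMatrix_apply]
    exact ((Matrix.isUnit_iff_isUnit_det _).1
      (Matrix.linearIndependent_rows_iff_isUnit.1 hrow)).ne_zero
  refine ⟨B, {i | (e i : S ⊕ Fin n) ∈ b₁}, ⟨fun h => hdet (by rw [h, map_zero]), ?_, ?_, ?_⟩⟩
  · intro i hi
    obtain ⟨s, hs⟩ := hb₁ hi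
    rw [hBe, ← hs]; exact s.2
  · intro i
    rw [hBe]
    rcases (e i : S ⊕ Fin n) with s | j
    · exact Or.inl s.2
    · exact Or.inr ⟨j, rfl⟩
  · intro v hv i hi
    have h1 : Submodule.span (RatFunc ℚ) (toRatFunc '' S) ≤
        LinearMap.ker ((LinearMap.proj i).comp (B.map φ).transpose.cramer) := by
      have h2 : toRatFunc '' S ⊆ Submodule.span (RatFunc ℚ) (f '' b₁) := by
        rintro _ ⟨s, hs, rfl⟩
        exact hsp₁ ⟨Sum.inl ⟨s, hs⟩, ⟨_, rfl⟩, rfl⟩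
      refine (Submodule.span_le.2 h2).trans (Submodule.span_le.2 ?_)
      rintro _ ⟨k, hk, rfl⟩
      obtain ⟨j, hj⟩ := e.surjective ⟨k, hb₂ hk⟩
      have h3 : f k = (B.map φ) j := by
        have : B.map φ j = f (e j) := rfl
        rw [this, hj]
      have hij : i ≠ j := by
        rintro rfl
        exact hi (by rw [Set.mem_ofPred_eq, hj]; exact hk)
      rw [h3]
      change (B.map φ).transpose.cramer ((B.map φ) j) i = 0
      rw [Matrix.cramer_transpose_row_self, Pi.single_apply, if_neg hij]
    have h2 : (B.map φ).transpose.cramer (toRatFunc v) i = 0 := h1 hv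
    refine RatFunc.algebraMap_injective ℚ ?_
    rw [map_zero, ← h2, Matrix.cramer_transpose_apply, Matrix.cramer_transpose_apply,
      RingHom.map_det]
    congr 1
    ext a b
    simp only [RingHom.mapMatrix_apply, Matrix.map_apply, Matrix.updateRow_apply]
    split_ifs <;> rfl

/-- Cramer's rule for the rows, free of division: the entries of `B.transpose.cramer v` are the
coordinates of `v` multiplied by the determinant. -/
theorem det_smul_eq_sum {R : Type*} [CommRing R] (B : Matrix (Fin n) (Fin n) R) (v : Fin n → R) :
    B.det • v = ∑ i, B.transpose.cramer v i • B i := by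
  have h := Matrix.mulVec_cramer B.transpose v
  rw [Matrix.det_transpose] at h
  rw [← h]
  funext k
  rw [Finset.sum_apply]
  simp only [Matrix.mulVec, dotProduct, Matrix.transpose_apply, Pi.smul_apply, smul_eq_mul]
  exact Finset.sum_congr rfl fun i _ => mul_comm (B i k) (B.transpose.cramer v i)

theorem natDegree_det_le (B : Matrix (Fin n) (Fin n) ℚ[X]) {D : ℕ}
    (h : ∀ i j, (B i j).natDegree ≤ D) : B.det.natDegree ≤ n * D := by
  rw [Matrix.det_apply]
  refine natDegree_sum_le_of_forall_le _ _ fun σ _ => ?_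
  refine (natDegree_smul_le _ _).trans ((natDegree_prod_le _ _).trans ?_)
  refine (Finset.sum_le_sum fun i _ => h _ _).trans ?_
  simp

theorem natDegree_cramer_le (B : Matrix (Fin n) (Fin n) ℚ[X]) {v : Fin n → ℚ[X]} {D : ℕ}
    (h : ∀ i j, (B i j).natDegree ≤ D) (hv : ∀ j, (v j).natDegree ≤ D) (i : Fin n) :
    (B.transpose.cramer v i).natDegree ≤ n * D := by
  rw [Matrix.cramer_transpose_apply]
  refine natDegree_det_le _ fun a b => ?_
  rw [Matrix.updateRow_apply]
  split_ifs
  · exact hv b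
  · exact h a b

theorem Adapted.natDegree_le {S : Set (Fin n → ℚ[X])} {B : Matrix (Fin n) (Fin n) ℚ[X]}
    {I : Set (Fin n)} (hB : Adapted S B I) {D : ℕ} (hS : ∀ v ∈ S, ∀ j, (v j).natDegree ≤ D)
    (i j : Fin n) : (B i j).natDegree ≤ D := by
  rcases hB.mem_or i with h | ⟨k, h⟩
  · exact hS _ h j
  · rw [h, Pi.single_apply]; split_ifs <;> simp

theorem cramer_sum_smul (B : Matrix (Fin n) (Fin n) ℚ[X]) (t : Fin n → ℚ[X]) (j : Fin n) :
    B.transpose.cramer (∑ i, t i • B i) j = t j * B.det := by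
  rw [map_sum, Finset.sum_apply, Finset.sum_eq_single j]
  · rw [map_smul, Matrix.cramer_transpose_row_self, Pi.smul_apply, Pi.single_eq_same, smul_eq_mul]
  · intro i _ hij
    rw [map_smul, Matrix.cramer_transpose_row_self, Pi.smul_apply, Pi.single_eq_of_ne hij.symm,
      smul_zero]
  · simp

/-! ### Chains of modules of full rank -/

/-- A vector outside a module of full rank yields a larger module of smaller determinant. -/
theorem exists_smaller_det {L : Submodule ℚ[X] (Fin n → ℚ[X])} {B : Matrix (Fin n) (Fin n) ℚ[X]}
    (hdet : B.det ≠ 0) (hB : ∀ i, B i ∈ L) {v : Fin n → ℚ[X]} (hv : v ∉ L) :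
    ∃ B' : Matrix (Fin n) (Fin n) ℚ[X], B'.det ≠ 0 ∧ B'.det.natDegree < B.det.natDegree ∧
      ∀ i, B' i ∈ L ⊔ Submodule.span ℚ[X] {v} := by
  set c := B.transpose.cramer v with hc
  -- If the determinant divided all Cramer numerators, `v` would be a polynomial combination of the
  -- rows and hence lie in `L`.
  have h1 : ∃ i, c i % B.det ≠ 0 := by
    by_contra! h
    refine hv ?_
    have h2 : v = ∑ i, (c i / B.det) • B i := by
      refine smul_right_injective _ hdet ?_
      change B.det • v = B.det • _
      rw [det_smul_eq_sum, Finset.smul_sum]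
      refine Finset.sum_congr rfl fun i _ => ?_
      rw [← mul_smul, ← hc]
      congr 1
      have := EuclideanDomain.div_add_mod (c i) B.det
      rw [h i, add_zero] at this
      exact this.symm
    rw [h2]
    exact Submodule.sum_mem _ fun i _ => Submodule.smul_mem _ _ (hB i)
  obtain ⟨i, hi⟩ := h1
  -- With `v` in place of row `i` the determinant is `c i`. Subtracting the quotient times the old
  -- row turns it into the remainder, which is nonzero and of smaller degree.
  have hd : (B.updateRow i (v + (-(c i / B.det)) • B i)).det = c i % B.det := by
    rw [Matrix.det_updateRow_add, Matrix.det_updateRow_smul, Matrix.updateRow_eq_self,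
      ← Matrix.cramer_transpose_apply, ← hc]
    have := EuclideanDomain.div_add_mod (c i) B.det
    linear_combination -this
  refine ⟨B.updateRow i (v + (-(c i / B.det)) • B i), by rwa [hd], ?_, fun j => ?_⟩
  · rw [hd]
    exact natDegree_lt_natDegree hi (degree_mod_lt _ hdet)
  · by_cases hj : j = i
    · subst hj
      have : (B.updateRow j (v + (-(c j / B.det)) • B j)) j = v + (-(c j / B.det)) • B j :=
        Matrix.updateRow_self
      rw [this]
      exact Submodule.add_mem _ (Submodule.mem_sup_right (Submodule.mem_span_singleton_self v))
        (Submodule.mem_sup_left (Submodule.smul_mem _ _ (hB j)))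
    · have : (B.updateRow i (v + (-(c i / B.det)) • B i)) j = B j :=
        Matrix.updateRow_ne hj
      rw [this]
      exact Submodule.mem_sup_left (hB j)

/-- The degree of the determinant of a nonsingular matrix with rows in the current module is a
potential that drops with each new vector. -/
theorem chain_length_le (vs : List (Fin n → ℚ[X])) :
    ∀ (L : Submodule ℚ[X] (Fin n → ℚ[X])) (B : Matrix (Fin n) (Fin n) ℚ[X]), B.det ≠ 0 →
      (∀ i, B i ∈ L) → (∀ vs₁ v vs₂, vs = vs₁ ++ v :: vs₂ →
        v ∉ L ⊔ Submodule.span ℚ[X] {w | w ∈ vs₁}) → vs.length ≤ B.det.natDegree := by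
  induction vs with
  | nil => intros; simp
  | cons v vs ih =>
    intro L B hdet hB h
    have hv : v ∉ L := by
      have := h [] v vs rfl
      simpa using this
    obtain ⟨B', h1, h2, h3⟩ := exists_smaller_det hdet hB hv
    have := ih _ B' h1 h3 fun vs₁ w vs₂ e => by
      have := h (v :: vs₁) w vs₂ (by rw [e]; rfl)
      rwa [sup_assoc, ← Submodule.span_union, Set.singleton_union,
        show insert v {w | w ∈ vs₁} = {w | w ∈ v :: vs₁} by ext; simp]
    rw [List.length_cons]; omega

/-- A strictly increasing chain of modules inside the rational span of a set of vectors. -/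
theorem Adapted.chain_length_le {S : Set (Fin n → ℚ[X])} {B : Matrix (Fin n) (Fin n) ℚ[X]}
    {I : Set (Fin n)} (hB : Adapted S B I) (vs : List (Fin n → ℚ[X]))
    (hvs : ∀ v ∈ vs, toRatFunc v ∈ Submodule.span (RatFunc ℚ) (toRatFunc '' S))
    (h : ∀ vs₁ v vs₂, vs = vs₁ ++ v :: vs₂ → v ∉ Submodule.span ℚ[X] (S ∪ {w | w ∈ vs₁})) :
    vs.length ≤ B.det.natDegree := by
  -- The auxiliary rows outside `I` raise the module to full rank. They must not absorb any of the
  -- vectors `vs`, which is the point of the rest of the proof.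
  set T : Submodule ℚ[X] (Fin n → ℚ[X]) := Submodule.span ℚ[X] (B '' Iᶜ) with hT
  refine PFinite.chain_length_le vs (Submodule.span ℚ[X] S ⊔ T) B hB.det_ne (fun i => ?_) ?_
  · by_cases hi : i ∈ I
    · exact Submodule.mem_sup_left (Submodule.subset_span (hB.mem i hi))
    · exact Submodule.mem_sup_right (Submodule.subset_span ⟨i, hi, rfl⟩)
  · intro vs₁ v vs₂ e hv
    refine h vs₁ v vs₂ e ?_
    rw [sup_assoc, sup_comm T, ← sup_assoc, ← Submodule.span_union] at hv
    obtain ⟨m, hm, t, ht, rfl⟩ := Submodule.mem_sup.1 hv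
    have hz : ∀ w : Fin n → ℚ[X], toRatFunc w ∈ Submodule.span (RatFunc ℚ) (toRatFunc '' S) →
        ∀ i ∉ I, B.transpose.cramer w i = 0 := hB.cramer_eq_zero
    have hm' : toRatFunc m ∈ Submodule.span (RatFunc ℚ) (toRatFunc '' S) := by
      have : Submodule.span ℚ[X] (S ∪ {w | w ∈ vs₁}) ≤ Submodule.comap ratFuncMap
          ((Submodule.span (RatFunc ℚ) (toRatFunc '' S)).restrictScalars ℚ[X]) := by
        refine Submodule.span_le.2 ?_
        rintro w (hw | hw)
        · exact Submodule.subset_span ⟨w, hw, rfl⟩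
        · exact hvs w (by rw [e]; simp only [Set.mem_ofPred_eq] at hw; simp [hw])
      exact this hm
    -- The coordinates of `t` in `I` vanish because `t` is a combination of the other rows. Those
    -- outside `I` vanish because `m + t` and `m` both lie in the rational span of `S`.
    have ht0 : t = 0 := by
      have h1 : ∀ i ∈ I, B.transpose.cramer t i = 0 := by
        intro i hi
        have : T ≤ LinearMap.ker ((LinearMap.proj i).comp B.transpose.cramer) := by
          refine Submodule.span_le.2 ?_
          rintro _ ⟨j, hj, rfl⟩
          change B.transpose.cramer (B j) i = 0
          rw [Matrix.cramer_transpose_row_self, Pi.single_apply, if_neg]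
          rintro rfl; exact hj hi
        exact this ht
      have h2 : ∀ i ∉ I, B.transpose.cramer t i = 0 := by
        intro i hi
        have h3 := hz _ (hvs (m + t) (by rw [e]; simp)) i hi
        rwa [map_add, Pi.add_apply, hz m hm' i hi, zero_add] at h3
      have h3 : B.det • t = 0 := by
        rw [det_smul_eq_sum]
        refine Finset.sum_eq_zero fun i _ => ?_
        by_cases hi : i ∈ I
        · rw [h1 i hi, zero_smul]
        · rw [h2 i hi, zero_smul]
      exact (smul_eq_zero.1 h3).resolve_left hB.det_ne
    rwa [ht0, add_zero]

/-! ### Degree bounds for membership -/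

/-- The rational linear combinations of the products `x ^ j v`, `j < k`, `v ∈ S`. -/
def boundedSpan (S : Set (Fin n → ℚ[X])) (k : ℕ) : Submodule ℚ (Fin n → ℚ[X]) :=
  Submodule.span ℚ {w | ∃ v ∈ S, ∃ j < k, w = (X ^ j : ℚ[X]) • v}

theorem smul_mem_boundedSpan {S : Set (Fin n → ℚ[X])} {k : ℕ} {p : ℚ[X]} {v : Fin n → ℚ[X]}
    (hv : v ∈ S) (hp : p.degree < (k : WithBot ℕ)) : p • v ∈ boundedSpan S k := by
  have h : p = ∑ i ∈ Finset.range k, C (p.coeff i) * X ^ i := by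
    ext m
    rw [finsetSum_coeff]
    simp only [coeff_C_mul, coeff_X_pow, mul_ite, mul_one, mul_zero, Finset.sum_ite_eq,
      Finset.mem_range]
    split_ifs with hm
    · rfl
    · exact coeff_eq_zero_of_degree_lt (hp.trans_le (by exact_mod_cast not_lt.1 hm))
  rw [h, Finset.sum_smul]
  refine Submodule.sum_mem _ fun i hi => ?_
  rw [mul_smul, ← algebraMap_eq, algebraMap_smul]
  exact Submodule.smul_mem _ _ (Submodule.subset_span ⟨v, hv, i, Finset.mem_range.1 hi, rfl⟩)

theorem boundedSpan_mono {S : Set (Fin n → ℚ[X])} {k l : ℕ} (h : k ≤ l) :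
    boundedSpan S k ≤ boundedSpan S l := by
  refine Submodule.span_mono ?_
  rintro w ⟨v, hv, j, hj, rfl⟩
  exact ⟨v, hv, j, by omega, rfl⟩

theorem boundedSpan_le (S : Set (Fin n → ℚ[X])) (k : ℕ) :
    boundedSpan S k ≤ (Submodule.span ℚ[X] S).restrictScalars ℚ := by
  refine Submodule.span_le.2 ?_
  rintro w ⟨v, hv, j, -, rfl⟩
  exact Submodule.smul_mem _ _ (Submodule.subset_span hv)

/-- The vectors with entries of degree less than `k`. -/
def degVec (n k : ℕ) : Submodule ℚ (Fin n → ℚ[X]) :=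
  Submodule.pi Set.univ fun _ => degreeLT ℚ k

theorem mem_degVec {k : ℕ} {v : Fin n → ℚ[X]} :
    v ∈ degVec n k ↔ ∀ i, (v i).degree < (k : WithBot ℕ) := by
  simp [degVec, Submodule.mem_pi, mem_degreeLT]

theorem boundedSpan_le_degVec {S : Set (Fin n → ℚ[X])} {k D : ℕ}
    (hS : ∀ v ∈ S, ∀ j, (v j).natDegree ≤ D) : boundedSpan S k ≤ degVec n (D + k) := by
  refine Submodule.span_le.2 ?_
  rintro w ⟨v, hv, j, hj, rfl⟩
  refine mem_degVec.2 fun i => ?_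
  rw [Pi.smul_apply, smul_eq_mul]
  refine degree_le_natDegree.trans_lt ?_
  have h1 := natDegree_mul_le (p := (X ^ j : ℚ[X])) (q := v i)
  rw [natDegree_X_pow] at h1
  have := hS v hv i
  exact_mod_cast (show (X ^ j * v i : ℚ[X]).natDegree < D + k by omega)

theorem natDegree_le_of_degree_lt {p : ℚ[X]} {k : ℕ} (h : p.degree < (k : WithBot ℕ)) :
    p.natDegree ≤ k := by
  by_cases hp : p = 0
  · simp [hp]
  · rw [degree_eq_natDegree hp] at h
    exact (by exact_mod_cast h : p.natDegree < k).le

/-- Membership in a polynomial module with coefficients of bounded degree. -/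
theorem mem_boundedSpan_of_mem_span {S : Set (Fin n → ℚ[X])} {v : Fin n → ℚ[X]} {D U : ℕ}
    (hS : ∀ v ∈ S, ∀ j, (v j).natDegree ≤ D) (hvD : ∀ j, (v j).natDegree ≤ D)
    (hU : n * D + 1 ≤ U) (hU' : n * (D + (n * D + 1)) + 1 ≤ U)
    (hv : v ∈ Submodule.span ℚ[X] S) : v ∈ boundedSpan S U := by
  obtain ⟨B, I, hB⟩ := exists_adapted S
  have hBD := hB.natDegree_le hS
  have hdet := natDegree_det_le B hBD
  have hspan : ∀ w ∈ S, toRatFunc w ∈ Submodule.span (RatFunc ℚ) (toRatFunc '' S) := fun w hw =>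
    Submodule.subset_span ⟨w, hw, rfl⟩
  -- Each coefficient is reduced modulo the determinant. The multiple of the determinant that splits
  -- off acts, by Cramer's rule, as a combination of rows in `I`, so unbounded degrees survive only
  -- in the coefficients `e` of at most `n` independent rows.
  have key : ∃ y ∈ boundedSpan S (n * D + 1), ∃ e : Fin n → ℚ[X], (∀ i ∉ I, e i = 0) ∧
      v = y + ∑ i, e i • B i := by
    clear hvD
    induction hv using Submodule.closure_induction with
    | zero => exact ⟨0, Submodule.zero_mem _, 0, by simp, by simp⟩
    | add x y _ _ hx hy =>
      obtain ⟨y₁, h1, e₁, h1', rfl⟩ := hx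
      obtain ⟨y₂, h2, e₂, h2', rfl⟩ := hy
      refine ⟨y₁ + y₂, Submodule.add_mem _ h1 h2, e₁ + e₂, fun i hi => ?_, ?_⟩
      · rw [Pi.add_apply, h1' i hi, h2' i hi, add_zero]
      · simp only [Pi.add_apply, add_smul, Finset.sum_add_distrib]
        abel
    | smul_mem p b hb =>
      refine ⟨(p % B.det) • b, smul_mem_boundedSpan hb ?_,
        fun i => (p / B.det) * B.transpose.cramer b i, fun i hi => ?_, ?_⟩
      · refine (degree_mod_lt p hB.det_ne).trans_le (degree_le_natDegree.trans ?_)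
        exact_mod_cast hdet.trans (Nat.le_succ _)
      · simp only [hB.cramer_eq_zero b (hspan b hb) i hi, mul_zero]
      · simp only [mul_smul]
        rw [← Finset.smul_sum, ← det_smul_eq_sum, ← mul_smul, ← add_smul]
        congr 1
        have := EuclideanDomain.div_add_mod p B.det
        linear_combination -this
  obtain ⟨y, hy, e, he, hve⟩ := key
  rw [hve]
  refine Submodule.add_mem _ (boundedSpan_mono hU hy) (Submodule.sum_mem _ fun i _ => ?_)
  by_cases hi : i ∈ I
  · refine smul_mem_boundedSpan (hB.mem i hi) ?_
    have h1 : ∑ i, e i • B i = v - y := by rw [hve]; abel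
    have hyD := mem_degVec.1 (boundedSpan_le_degVec hS hy)
    have h2 : ∀ j, ((v - y) j).natDegree ≤ D + (n * D + 1) := fun j => by
      rw [Pi.sub_apply]
      refine (natDegree_sub_le _ _).trans (max_le ((hvD j).trans (by omega)) ?_)
      exact natDegree_le_of_degree_lt (by exact_mod_cast hyD j)
    -- Independence makes `e i` computable: times the determinant, it is a Cramer coordinate of `v -
    -- y`, whose entries have bounded degree.
    have h3 := cramer_sum_smul B e i
    rw [h1] at h3
    have h4 := natDegree_cramer_le B (fun i j => (hBD i j).trans (by omega)) h2 i
    by_cases h0 : e i = 0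
    · rw [h0, degree_zero]; exact WithBot.bot_lt_coe _
    · rw [h3, natDegree_mul h0 hB.det_ne] at h4
      rw [degree_eq_natDegree h0]
      exact_mod_cast (show (e i).natDegree < U by omega)
  · rw [he i hi, zero_smul]; exact Submodule.zero_mem _

/-- Membership in a rational span, as a linear condition. -/
theorem X_pow_smul_mem_of_mem_span {S : Set (Fin n → ℚ[X])} {v : Fin n → ℚ[X]} {D U : ℕ}
    (hS : ∀ v ∈ S, ∀ j, (v j).natDegree ≤ D) (hvD : ∀ j, (v j).natDegree ≤ D)
    (hU : n * D + 1 ≤ U)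
    (hv : toRatFunc v ∈ Submodule.span (RatFunc ℚ) (toRatFunc '' S)) :
    (X ^ U : ℚ[X]) • v ∈ boundedSpan {v} U ⊔ boundedSpan S (2 * U) := by
  obtain ⟨B, I, hB⟩ := exists_adapted S
  have hBD := hB.natDegree_le hS
  have hdet := natDegree_det_le B hBD
  set a := B.det.leadingCoeff with ha
  have ha0 : a ≠ 0 := leadingCoeff_ne_zero.2 hB.det_ne
  set δ := B.det.natDegree with hδ
  -- A monic multiple of the determinant of degree exactly `U`. It multiplies `v` into the module by
  -- Cramer's rule, and `X ^ U - Q` has degree below `U`.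
  set Q : ℚ[X] := C a⁻¹ * (X ^ (U - δ) * B.det) with hQ
  have h1 : Q • v ∈ boundedSpan S (2 * U) := by
    have : Q • v = ∑ i, (C a⁻¹ * X ^ (U - δ) * B.transpose.cramer v i) • B i := by
      simp only [mul_smul, hQ]
      rw [← Finset.smul_sum, ← Finset.smul_sum, ← det_smul_eq_sum]
    rw [this]
    refine Submodule.sum_mem _ fun i _ => ?_
    by_cases hi : i ∈ I
    · refine smul_mem_boundedSpan (hB.mem i hi) (degree_le_natDegree.trans_lt ?_)
      have h2 := natDegree_cramer_le B hBD hvD i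
      have h3 : (C a⁻¹ * X ^ (U - δ) * B.transpose.cramer v i).natDegree ≤ (U - δ) + n * D := by
        refine natDegree_mul_le.trans (Nat.add_le_add ?_ h2)
        exact natDegree_C_mul_X_pow_le _ _
      exact_mod_cast (show _ < 2 * U by omega)
    · rw [hB.cramer_eq_zero v hv i hi, mul_zero, zero_smul]; exact Submodule.zero_mem _
  have h2 : (X ^ U - Q).degree < (U : WithBot ℕ) := by
    have hQd : Q.degree = ((X ^ U : ℚ[X])).degree := by
      rw [hQ, degree_mul, degree_mul, degree_C (inv_ne_zero ha0), degree_X_pow, degree_X_pow,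
        degree_eq_natDegree hB.det_ne, zero_add]
      exact_mod_cast (show U - δ + δ = U by omega)
    have := degree_sub_lt_left hQd.symm (pow_ne_zero _ X_ne_zero) (by
      rw [hQ, leadingCoeff_mul, leadingCoeff_mul, leadingCoeff_C, leadingCoeff_X_pow,
        leadingCoeff_X_pow, one_mul, ← ha, inv_mul_cancel₀ ha0])
    rwa [degree_X_pow] at this
  have h3 : (X ^ U : ℚ[X]) • v = (X ^ U - Q) • v + Q • v := by rw [← add_smul, sub_add_cancel]
  rw [h3]
  exact Submodule.add_mem _ (Submodule.mem_sup_left (smul_mem_boundedSpan (Set.mem_singleton v) h2))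
    (Submodule.mem_sup_right h1)

/-- An element of `boundedSpan {v} U` is `R • v` with `deg R < U`. So `X ^ U - R` is a nonzero
multiplier that brings `v` into the module; the leading power prevents the relation from being
trivial. -/
theorem mem_span_of_X_pow_smul_mem {S : Set (Fin n → ℚ[X])} {v : Fin n → ℚ[X]} {U k : ℕ}
    (h : (X ^ U : ℚ[X]) • v ∈ boundedSpan {v} U ⊔ boundedSpan S k) :
    toRatFunc v ∈ Submodule.span (RatFunc ℚ) (toRatFunc '' S) := by
  obtain ⟨y, hy, z, hz, hyz⟩ := Submodule.mem_sup.1 h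
  have h1 : ∃ R : ℚ[X], R.degree < (U : WithBot ℕ) ∧ y = R • v := by
    have : boundedSpan {v} U ≤ Submodule.map
        ((LinearMap.toSpanSingleton ℚ[X] (Fin n → ℚ[X]) v).restrictScalars ℚ) (degreeLT ℚ U) := by
      refine Submodule.span_le.2 ?_
      rintro w ⟨u, hu, j, hj, rfl⟩
      rw [Set.mem_singleton_iff] at hu
      subst hu
      refine ⟨X ^ j, mem_degreeLT.2 ?_, rfl⟩
      rw [degree_X_pow]; exact_mod_cast hj
    obtain ⟨R, hR, hRy⟩ := this hy
    exact ⟨R, mem_degreeLT.1 hR, hRy.symm⟩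
  obtain ⟨R, hR, rfl⟩ := h1
  have h2 : (X ^ U - R) • v ∈ Submodule.span ℚ[X] S := by
    rw [sub_smul, ← hyz, add_sub_cancel_left]
    exact boundedSpan_le S k hz
  have h3 : X ^ U - R ≠ 0 := fun h0 => by
    rw [← sub_eq_zero.1 h0, degree_X_pow] at hR
    exact lt_irrefl _ hR
  have h4 : toRatFunc ((X ^ U - R) • v) ∈ Submodule.span (RatFunc ℚ) (toRatFunc '' S) := by
    have : Submodule.span ℚ[X] S ≤ Submodule.comap ratFuncMap
        ((Submodule.span (RatFunc ℚ) (toRatFunc '' S)).restrictScalars ℚ[X]) :=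
      Submodule.span_le.2 fun w hw => Submodule.subset_span ⟨w, hw, rfl⟩
    exact this h2
  rw [toRatFunc_smul] at h4
  exact (Submodule.smul_mem_iff _ fun h0 => h3 (RatFunc.algebraMap_injective ℚ
    (h0.trans (map_zero _).symm))).1 h4

end Adapted

end

end PFinite

namespace PFinite

noncomputable section

variable {n s : ℕ}

/-! ### The backward function -/

theorem shift_zero (p : ℚ[X]) : shift 0 p = p := by simp [shift]

theorem shift_shift (k : ℕ) (p : ℚ[X]) : shift 1 (shift k p) = shift (k + 1) p := by
  simp only [shift, comp_assoc, add_comp, X_comp, C_comp]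
  congr 1
  push_cast
  rw [C_add]; ring

/-- The shift as a ring homomorphism. -/
def shiftHom : ℚ[X] →+* ℚ[X] := compRingHom (X + C ((1 : ℕ) : ℚ))

theorem shiftHom_apply (p : ℚ[X]) : shiftHom p = shift 1 p := rfl

theorem natDegree_shift (k : ℕ) (p : ℚ[X]) : (shift k p).natDegree = p.natDegree := by
  rw [shift, natDegree_comp, natDegree_X_add_C, mul_one]

theorem shift_ne_zero {p : ℚ[X]} (hp : p ≠ 0) : shift 1 p ≠ 0 := by
  intro h
  have h1 : shift 1 p = shift 1 0 := by rw [h]; simp [shift]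
  refine hp ?_
  have h2 : (p.comp (X + C ((1 : ℕ) : ℚ))).comp (X - C ((1 : ℕ) : ℚ)) = 0 := by
    rw [show p.comp (X + C ((1 : ℕ) : ℚ)) = 0 from h, zero_comp]
  rwa [comp_assoc, add_comp, X_comp, C_comp, sub_add_cancel, comp_X] at h2

/-- The effect of prepending a letter on the backward vector of a word. -/
def Automaton.push (A : Automaton n s) (σ : Fin s) (v : Fin n → ℚ[X]) : Fin n → ℚ[X] :=
  (A.trans σ).mulVec fun i => shift 1 (v i)

theorem Automaton.transFrom_succ (A : Automaton n s) (w : List (Fin s)) :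
    ∀ k, A.transFrom (k + 1) w = (A.transFrom k w).map (shift 1) := by
  induction w with
  | nil =>
    intro k
    change (1 : Matrix (Fin n) (Fin n) ℚ[X]) = (1 : Matrix (Fin n) (Fin n) ℚ[X]).map shiftHom
    rw [Matrix.map_one _ (map_zero _) (map_one _)]
  | cons σ w ih =>
    intro k
    rw [Automaton.transFrom, Automaton.transFrom, ih (k + 1)]
    change _ = ((A.trans σ).map (shift k) * A.transFrom (k + 1) w).map shiftHom
    rw [Matrix.map_mul]
    congr 1
    ext i j
    simp only [Matrix.map_apply, shiftHom_apply, shift_shift]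

theorem Automaton.backward_nil (A : Automaton n s) : A.backward [] = A.final := by
  funext i
  simp [Automaton.backward, Automaton.transWord_nil, shift_zero]

/-- The shift is a ring homomorphism, so a letter in front shifts the whole remaining product. The
vector of `σ :: w` thus depends on `w` only through the vector of `w`. -/
theorem Automaton.backward_cons (A : Automaton n s) (σ : Fin s) (w : List (Fin s)) :
    A.backward (σ :: w) = A.push σ (A.backward w) := by
  have h0 : (A.trans σ).map (shift 0) = A.trans σ := by
    ext i j; simp [shift_zero]
  rw [Automaton.backward, Automaton.transWord, Automaton.transFrom, h0, A.transFrom_succ,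
    ← Matrix.mulVec_mulVec, Automaton.push]
  congr 1
  funext i
  change _ = shiftHom _
  rw [Automaton.backward, Automaton.transWord]
  simp only [Matrix.mulVec, dotProduct, map_sum, map_mul, Matrix.map_apply, shiftHom_apply,
    shift_shift, List.length_cons]

theorem Automaton.push_add (A : Automaton n s) (σ : Fin s) (v w : Fin n → ℚ[X]) :
    A.push σ (v + w) = A.push σ v + A.push σ w := by
  rw [Automaton.push, Automaton.push, Automaton.push, ← Matrix.mulVec_add]
  congr 1
  funext i
  exact map_add shiftHom _ _

/-- Semilinearity, the source of all closure arguments: scalars are shifted, but remain polynomials,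
and nonzero ones remain nonzero. -/
theorem Automaton.push_smul (A : Automaton n s) (σ : Fin s) (p : ℚ[X]) (v : Fin n → ℚ[X]) :
    A.push σ (p • v) = shift 1 p • A.push σ v := by
  rw [Automaton.push, Automaton.push, ← Matrix.mulVec_smul]
  congr 1
  funext i
  exact map_mul shiftHom _ _

theorem Automaton.push_zero (A : Automaton n s) (σ : Fin s) : A.push σ 0 = 0 := by
  have := A.push_smul σ 0 0
  rw [zero_smul] at this
  rw [this]
  simp [shift]

theorem Automaton.natDegree_trans_le (A : Automaton n s) (σ : Fin s) (i j : Fin n) :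
    (A.trans σ i j).natDegree ≤ A.degree :=
  le_trans (le_trans (le_trans (Finset.le_sup (f := fun j => (A.trans σ i j).natDegree)
    (Finset.mem_univ j)) (Finset.le_sup (f := fun i => Finset.univ.sup fun j =>
      (A.trans σ i j).natDegree) (Finset.mem_univ i))) (Finset.le_sup (f := fun σ =>
      Finset.univ.sup fun i => Finset.univ.sup fun j => (A.trans σ i j).natDegree)
      (Finset.mem_univ σ))) (le_max_left _ _)

theorem Automaton.natDegree_final_le (A : Automaton n s) (i : Fin n) :
    (A.final i).natDegree ≤ A.degree :=
  le_trans (Finset.le_sup (f := fun i => (A.final i).natDegree) (Finset.mem_univ i))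
    (le_max_right _ _)

theorem Automaton.natDegree_backward_le (A : Automaton n s) (u : List (Fin s)) (i : Fin n) :
    (A.backward u i).natDegree ≤ A.degree * (u.length + 1) := by
  induction u generalizing i with
  | nil => rw [A.backward_nil]; simpa using A.natDegree_final_le i
  | cons σ u ih =>
    rw [A.backward_cons, Automaton.push, Matrix.mulVec, dotProduct]
    refine natDegree_sum_le_of_forall_le _ _ fun j _ => natDegree_mul_le.trans ?_
    rw [natDegree_shift, List.length_cons]
    have := A.natDegree_trans_le σ i j
    have := ih j
    linarith

/-! ### Rational spans -/

/-- The vectors in the span over the rational functions. -/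
def RatSpan (S : Set (Fin n → ℚ[X])) (v : Fin n → ℚ[X]) : Prop :=
  toRatFunc v ∈ Submodule.span (RatFunc ℚ) (toRatFunc '' S)

theorem ratSpan_of_smul {S : Set (Fin n → ℚ[X])} {v : Fin n → ℚ[X]} {q : ℚ[X]} (hq : q ≠ 0)
    (h : RatSpan S (q • v)) : RatSpan S v := by
  rw [RatSpan, toRatFunc_smul] at h
  exact (Submodule.smul_mem_iff _ fun h0 => hq (RatFunc.algebraMap_injective ℚ
    (h0.trans (map_zero _).symm))).1 h

theorem RatSpan.exists_smul {S : Set (Fin n → ℚ[X])} {v : Fin n → ℚ[X]} (h : RatSpan S v) :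
    ∃ q : ℚ[X], q ≠ 0 ∧ q • v ∈ Submodule.span ℚ[X] S := by
  obtain ⟨B, I, hB⟩ := exists_adapted S
  refine ⟨B.det, hB.det_ne, ?_⟩
  rw [det_smul_eq_sum]
  refine Submodule.sum_mem _ fun i _ => ?_
  by_cases hi : i ∈ I
  · exact Submodule.smul_mem _ _ (Submodule.subset_span (hB.mem i hi))
  · rw [hB.cramer_eq_zero v h i hi, zero_smul]; exact Submodule.zero_mem _

theorem Automaton.push_mem_of_mem_span (A : Automaton n s) (σ : Fin s)
    {S : Set (Fin n → ℚ[X])} {M : Submodule ℚ[X] (Fin n → ℚ[X])} (h : ∀ w ∈ S, A.push σ w ∈ M)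
    {v : Fin n → ℚ[X]} (hv : v ∈ Submodule.span ℚ[X] S) : A.push σ v ∈ M := by
  induction hv using Submodule.closure_induction with
  | zero => rw [A.push_zero]; exact M.zero_mem
  | add x y _ _ hx hy => rw [A.push_add]; exact M.add_mem hx hy
  | smul_mem p b hb => rw [A.push_smul]; exact M.smul_mem _ (h b hb)

/-- Clearing denominators avoids extending the shift to rational functions: if `q • v` is in the
polynomial span, then `shift 1 q • A.push σ v` is in the rational span, and the nonzero factor
cancels. -/
theorem RatSpan.push (A : Automaton n s) (σ : Fin s) {S : Set (Fin n → ℚ[X])}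
    (h : ∀ w ∈ S, RatSpan S (A.push σ w)) {v : Fin n → ℚ[X]} (hv : RatSpan S v) :
    RatSpan S (A.push σ v) := by
  obtain ⟨q, hq, hqv⟩ := hv.exists_smul
  have h1 : A.push σ (q • v) ∈ Submodule.comap ratFuncMap
      ((Submodule.span (RatFunc ℚ) (toRatFunc '' S)).restrictScalars ℚ[X]) :=
    A.push_mem_of_mem_span σ h hqv
  refine ratSpan_of_smul (shift_ne_zero hq) ?_
  rw [← A.push_smul]
  exact h1

/-! ### Executions -/

/-- The backward vectors of a list of words. -/
def Automaton.vecs (A : Automaton n s) (W : List (List (Fin s))) : Set (Fin n → ℚ[X]) :=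
  {y | ∃ w ∈ W, y = A.backward w}

theorem Automaton.raisesRank_iff (A : Automaton n s) (W : List (List (Fin s)))
    (u : List (Fin s)) : A.RaisesRank W u ↔ ¬ RatSpan (A.vecs W) (A.backward u) := by
  rw [Automaton.RaisesRank, RatSpan]
  have : {y | ∃ w ∈ W, y = toRatFunc (A.backward w)} = toRatFunc '' A.vecs W := by
    ext y
    constructor
    · rintro ⟨w, hw, rfl⟩; exact ⟨_, ⟨w, hw, rfl⟩, rfl⟩
    · rintro ⟨_, ⟨w, hw, rfl⟩, rfl⟩; exact ⟨w, hw, rfl⟩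
  rw [this]

theorem Automaton.enlargesModule_iff (A : Automaton n s) (W : List (List (Fin s)))
    (u : List (Fin s)) :
    A.EnlargesModule W u ↔ A.backward u ∉ Submodule.span ℚ[X] (A.vecs W) := Iff.rfl

/-- The sequences of words collected by the first loop. -/
inductive Automaton.First (A : Automaton n s) : List (List (Fin s)) → Prop
  | start : A.First [[]]
  | snoc {W : List (List (Fin s))} {w : List (Fin s)} {σ : Fin s} (h : A.First W) (hw : w ∈ W)
      (hg : A.RaisesRank W (σ :: w)) : A.First (W ++ [σ :: w])

/-- The sequences `V` of words collected by the second loop after the sequence `W`. -/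
inductive Automaton.Second (A : Automaton n s) (W : List (List (Fin s))) :
    List (List (Fin s)) → Prop
  | start (h : A.First W) (hg : ∀ w ∈ W, ∀ σ : Fin s, ¬ A.RaisesRank W (σ :: w)) : A.Second W []
  | snoc {V : List (List (Fin s))} {w : List (Fin s)} {σ : Fin s} (h : A.Second W V)
      (hw : w ∈ W ++ V) (hg : A.EnlargesModule (W ++ V) (σ :: w)) : A.Second W (V ++ [σ :: w])

theorem Automaton.First.reachable {A : Automaton n s} {W : List (List (Fin s))} (h : A.First W) :
    A.Reachable ⟨Phase.first, W⟩ := by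
  induction h with
  | start => exact Relation.ReflTransGen.refl
  | snoc _ hw hg ih => exact ih.tail (Automaton.Step.rank _ _ _ hw hg)

theorem Automaton.Second.reachable {A : Automaton n s} {W V : List (List (Fin s))}
    (h : A.Second W V) : A.Reachable ⟨Phase.second, W ++ V⟩ := by
  induction h with
  | start h hg => rw [List.append_nil]; exact h.reachable.tail (Automaton.Step.exit _ hg)
  | snoc _ hw hg ih =>
    rw [← List.append_assoc]; exact ih.tail (Automaton.Step.enlarge _ _ _ hw hg)

theorem Automaton.Second.first {A : Automaton n s} {W V : List (List (Fin s))}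
    (h : A.Second W V) : A.First W := by
  induction h with
  | start h _ => exact h
  | snoc _ _ _ ih => exact ih

theorem Automaton.Second.closed {A : Automaton n s} {W V : List (List (Fin s))}
    (h : A.Second W V) : ∀ w ∈ W, ∀ σ : Fin s, ¬ A.RaisesRank W (σ :: w) := by
  induction h with
  | start _ h => exact h
  | snoc _ _ _ ih => exact ih

theorem Automaton.Reachable.cases {A : Automaton n s} {q : State s} (h : A.Reachable q) :
    (q.phase = Phase.first ∧ A.First q.words) ∨
      (q.phase = Phase.second ∧ ∃ W V, q.words = W ++ V ∧ A.Second W V) := by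
  induction h with
  | refl => exact Or.inl ⟨rfl, Automaton.First.start⟩
  | tail _ hstep ih =>
    cases hstep with
    | rank W w σ hw hg =>
      rcases ih with ⟨-, h⟩ | ⟨h, -⟩
      · exact Or.inl ⟨rfl, h.snoc hw hg⟩
      · simp at h
    | exit W hg =>
      rcases ih with ⟨-, h⟩ | ⟨h, -⟩
      · exact Or.inr ⟨rfl, W, [], (List.append_nil W).symm, Automaton.Second.start h hg⟩
      · simp at h
    | enlarge W w σ hw hg =>
      rcases ih with ⟨h, -⟩ | ⟨-, W, V, e, h⟩
      · simp at h
      · simp only at e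
        subst e
        exact Or.inr ⟨rfl, W, V ++ [σ :: w], List.append_assoc _ _ _, h.snoc hw hg⟩

/-- A new word is one letter longer than an earlier one. Through this the number of words bounds the
degrees of their vectors. -/
theorem Automaton.First.length_lt {A : Automaton n s} {W : List (List (Fin s))} (h : A.First W) :
    ∀ u ∈ W, u.length < W.length := by
  induction h with
  | start => simp
  | snoc _ hw _ ih =>
    intro u hu
    rw [List.length_append, List.length_singleton]
    rcases List.mem_append.1 hu with hu | hu
    · have := ih u hu; omega
    · rw [List.mem_singleton] at hu
      subst hu
      have := ih _ hw
      rw [List.length_cons]; omega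

theorem Automaton.Second.length_lt {A : Automaton n s} {W V : List (List (Fin s))}
    (h : A.Second W V) : ∀ u ∈ W ++ V, u.length < (W ++ V).length := by
  induction h with
  | start h _ => simpa using h.length_lt
  | snoc _ hw _ ih =>
    intro u hu
    rw [← List.append_assoc] at hu ⊢
    rw [List.length_append, List.length_singleton]
    rcases List.mem_append.1 hu with hu | hu
    · have := ih u hu; omega
    · rw [List.mem_singleton] at hu
      subst hu
      have := ih _ hw
      rw [List.length_cons]; omega

theorem vecs_append (A : Automaton n s) (W V : List (List (Fin s))) :
    A.vecs (W ++ V) = A.vecs W ∪ A.vecs V := by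
  ext y
  simp only [Automaton.vecs, List.mem_append, Set.mem_ofPred_eq, Set.mem_union]
  constructor
  · rintro ⟨w, hw | hw, rfl⟩
    · exact Or.inl ⟨w, hw, rfl⟩
    · exact Or.inr ⟨w, hw, rfl⟩
  · rintro (⟨w, hw, rfl⟩ | ⟨w, hw, rfl⟩)
    · exact ⟨w, Or.inl hw, rfl⟩
    · exact ⟨w, Or.inr hw, rfl⟩

/-! ### Bounds for the number of collected words, and termination. -/

/-- Every added word raises the rank. The single word `ε` has to be excluded, since its vector `β`
may be zero. -/
theorem Automaton.First.length_le_finrank {A : Automaton n s} {W : List (List (Fin s))}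
    (h : A.First W) : 1 < W.length → W.length ≤
      Module.finrank (RatFunc ℚ) (Submodule.span (RatFunc ℚ) (toRatFunc '' A.vecs W)) := by
  induction h with
  | start => simp
  | @snoc W w σ h hw hg ih =>
    intro _
    rw [A.raisesRank_iff] at hg
    have h1 : Module.finrank (RatFunc ℚ) (Submodule.span (RatFunc ℚ) (toRatFunc '' A.vecs W)) <
        Module.finrank (RatFunc ℚ)
          (Submodule.span (RatFunc ℚ) (toRatFunc '' A.vecs (W ++ [σ :: w]))) := by
      refine Submodule.finrank_lt_finrank_of_lt (lt_of_le_of_ne (Submodule.span_mono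
        (Set.image_mono (by rw [vecs_append]; exact Set.subset_union_left))) fun e => hg ?_)
      rw [RatSpan, e]
      exact Submodule.subset_span ⟨_, ⟨σ :: w, by simp, rfl⟩, rfl⟩
    rw [List.length_append, List.length_singleton]
    by_cases h2 : 1 < W.length
    · have := ih h2; omega
    · have hpos : 0 < W.length := List.length_pos_of_mem hw
      -- The first addition requires `β ≠ 0`: the image of the zero vector under `push` is zero and
      -- cannot raise the rank.
      have h3 : 0 < Module.finrank (RatFunc ℚ)
          (Submodule.span (RatFunc ℚ) (toRatFunc '' A.vecs W)) := by
        rw [Nat.pos_iff_ne_zero]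
        intro h0
        rw [Submodule.finrank_eq_zero] at h0
        have h4 : toRatFunc (A.backward w) ∈
            Submodule.span (RatFunc ℚ) (toRatFunc '' A.vecs W) :=
          Submodule.subset_span ⟨_, ⟨w, hw, rfl⟩, rfl⟩
        rw [h0, Submodule.mem_bot, ← toRatFunc_zero] at h4
        refine hg ?_
        rw [A.backward_cons, toRatFunc_injective h4, A.push_zero, RatSpan, toRatFunc_zero]
        exact Submodule.zero_mem _
      omega

theorem Automaton.First.length_le {A : Automaton n s} {W : List (List (Fin s))}
    (h : A.First W) : W.length ≤ max 1 n := by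
  by_cases h1 : 1 < W.length
  · refine (h.length_le_finrank h1).trans ((Submodule.finrank_le _).trans ?_)
    rw [Module.finrank_pi, Fintype.card_fin]
    exact le_max_right _ _
  · exact (not_lt.1 h1).trans (le_max_left _ _)

/-- The exit condition of the first loop makes the rational span of `W` stable under `push`, so the
second loop can only enlarge the module inside this space. -/
theorem Automaton.Second.ratSpan {A : Automaton n s} {W V : List (List (Fin s))}
    (h : A.Second W V) : ∀ u ∈ W ++ V, RatSpan (A.vecs W) (A.backward u) := by
  have hcl : ∀ σ, ∀ v ∈ A.vecs W, RatSpan (A.vecs W) (A.push σ v) := by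
    rintro σ _ ⟨w, hw, rfl⟩
    have := h.closed w hw σ
    rwa [A.raisesRank_iff, not_not, A.backward_cons] at this
  induction h with
  | start h _ =>
    intro u hu
    rw [List.append_nil] at hu
    exact Submodule.subset_span ⟨_, ⟨u, hu, rfl⟩, rfl⟩
  | snoc _ hw _ ih =>
    intro u hu
    rw [← List.append_assoc, List.mem_append, List.mem_singleton] at hu
    rcases hu with hu | rfl
    · exact ih u hu
    · rw [A.backward_cons]
      exact RatSpan.push A _ (hcl _) (ih _ hw)

theorem Automaton.Second.not_mem {A : Automaton n s} {W V : List (List (Fin s))}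
    (h : A.Second W V) : ∀ vs₁ v vs₂, V.map A.backward = vs₁ ++ v :: vs₂ →
      v ∉ Submodule.span ℚ[X] (A.vecs W ∪ {w | w ∈ vs₁}) := by
  induction h with
  | start => intro vs₁ v vs₂ e; simp at e
  | @snoc V w σ h hw hg ih =>
    intro vs₁ v vs₂ e
    rw [List.map_append, List.map_singleton] at e
    rcases List.eq_nil_or_concat vs₂ with rfl | ⟨vs₃, z, rfl⟩
    · obtain ⟨e1, e2⟩ := List.append_inj' e rfl
      obtain rfl : A.backward (σ :: w) = v := by simpa using e2
      rw [A.enlargesModule_iff, vecs_append] at hg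
      have : A.vecs V = {y | y ∈ vs₁} := by
        rw [← e1]
        ext y
        simp [Automaton.vecs, eq_comm]
      rwa [this] at hg
    · rw [List.concat_eq_append, ← List.cons_append, ← List.append_assoc] at e
      obtain ⟨e1, -⟩ := List.append_inj' e rfl
      exact ih vs₁ v vs₃ e1

/-- The factor `A.degree * max 1 n` bounds the degrees of the vectors of the first loop, whose words
are shorter than `max 1 n`; the factor `n` comes from the expansion of an `n × n` determinant. -/
theorem Automaton.Second.length_le {A : Automaton n s} {W V : List (List (Fin s))}
    (h : A.Second W V) : V.length ≤ n * (A.degree * max 1 n) := by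
  obtain ⟨B, I, hB⟩ := exists_adapted (A.vecs W)
  have h1 := hB.chain_length_le (V.map A.backward) (by
    intro v hv
    obtain ⟨u, hu, rfl⟩ := List.mem_map.1 hv
    exact h.ratSpan u (List.mem_append_right _ hu)) h.not_mem
  rw [List.length_map] at h1
  refine h1.trans (natDegree_det_le B (hB.natDegree_le ?_))
  rintro _ ⟨w, hw, rfl⟩ j
  refine (A.natDegree_backward_le w j).trans (Nat.mul_le_mul_left _ ?_)
  have h2 := h.first.length_lt w hw
  have h3 := h.first.length_le
  omega

theorem Automaton.Reachable.length_le {A : Automaton n s} {q : State s} (h : A.Reachable q) :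
    q.words.length ≤ max 1 n + n * (A.degree * max 1 n) := by
  rcases h.cases with ⟨-, h⟩ | ⟨-, W, V, e, h⟩
  · exact h.length_le.trans (Nat.le_add_right _ _)
  · rw [e, List.length_append]
    exact Nat.add_le_add h.first.length_le h.length_le

theorem Automaton.Reachable.length_lt {A : Automaton n s} {q : State s} (h : A.Reachable q) :
    ∀ u ∈ q.words, u.length < q.words.length := by
  rcases h.cases with ⟨-, h⟩ | ⟨-, W, V, e, h⟩
  · exact h.length_lt
  · rw [e]; exact h.length_lt

theorem Automaton.Reachable.length_le_of_pos {A : Automaton n s} {q : State s}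
    (h : A.Reachable q) (hn : 0 < n) (hd : 0 < A.degree) :
    q.words.length ≤ n * (A.degree * (n + 1)) + n - 1 := by
  have h1 := h.length_le
  rw [max_eq_right (show 1 ≤ n from hn)] at h1
  have h2 : 0 < n * A.degree := Nat.mul_pos hn hd
  have h3 : n * (A.degree * (n + 1)) = n * (A.degree * n) + n * A.degree := by ring
  omega

theorem Automaton.Reachable.length_le_max {A : Automaton n s} {q : State s}
    (h : A.Reachable q) : q.words.length ≤ max 1 (n * (A.degree * (n + 1)) + n) := by
  have h1 := h.length_le
  rcases Nat.eq_zero_or_pos n with rfl | hn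
  · simpa using h1
  · rw [max_eq_right (show 1 ≤ n from hn)] at h1
    have h3 : n * (A.degree * (n + 1)) = n * (A.degree * n) + n * A.degree := by ring
    exact le_max_of_le_right (by omega)

theorem Automaton.not_exists_infinite_run (A : Automaton n s) :
    ¬ ∃ run : ℕ → State s, run 0 = State.start s ∧ ∀ i, A.Step (run i) (run (i + 1)) := by
  rintro ⟨run, h0, hs⟩
  have hr : ∀ i, A.Reachable (run i) := by
    intro i
    induction i with
    | zero => rw [h0]; exact Relation.ReflTransGen.refl
    | succ i ih => exact ih.tail (hs i)
  -- The number of words, plus one in the second loop, increases by exactly one in each step. The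
  -- summand accounts for the step that exits the first loop.
  have hl : ∀ i, i ≤ (run i).words.length + (match (run i).phase with
      | Phase.first => 0
      | Phase.second => 1) := by
    intro i
    induction i with
    | zero => exact Nat.zero_le _
    | succ i ih =>
      have h := hs i
      generalize run i = q at h ih
      generalize run (i + 1) = q' at h
      cases h with
      | rank W w σ hw hg => simp only [List.length_append, List.length_singleton] at ih ⊢; omega
      | exit W hg => simp only at ih ⊢; omega
      | enlarge W w σ hw hg =>
        simp only [List.length_append, List.length_singleton] at ih ⊢; omega
  set N := max 1 n + n * (A.degree * max 1 n)
  have h1 := hl (N + 2)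
  have h2 := (hr (N + 2)).length_le
  have h3 : (match (run (N + 2)).phase with
      | Phase.first => 0
      | Phase.second => 1) ≤ 1 := by split <;> omega
  omega

theorem Automaton.Reachable.returns_of_stuck {A : Automaton n s} {q : State s}
    (h : A.Reachable q) (hq : ∀ q', ¬ A.Step q q') : A.Returns q.words := by
  obtain ⟨ph, W⟩ := q
  cases ph with
  | first =>
    exfalso
    by_cases hg : ∀ w ∈ W, ∀ σ : Fin s, ¬ A.RaisesRank W (σ :: w)
    · exact hq _ (Automaton.Step.exit W hg)
    · push Not at hg
      obtain ⟨w, hw, σ, hg⟩ := hg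
      exact hq _ (Automaton.Step.rank W w σ hw hg)
  | second => exact ⟨h, fun w hw σ hg => hq _ (Automaton.Step.enlarge W w σ hw hg)⟩

theorem Automaton.Reachable.nil_mem {A : Automaton n s} {q : State s} (h : A.Reachable q) :
    [] ∈ q.words := by
  induction h with
  | refl => simp [State.start]
  | tail _ hstep ih =>
    cases hstep with
    | rank => exact List.mem_append_left _ ih
    | exit => exact ih
    | enlarge => exact List.mem_append_left _ ih

/-- The span contains `β`, the vector of the empty word, and the failed guards make it stable under
`push`; induction on words does the rest. -/
theorem Automaton.Returns.span_eq {A : Automaton n s} {W : List (List (Fin s))}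
    (h : A.Returns W) : Submodule.span ℚ[X] {v | v ∈ A.output W} = A.backwardModule := by
  have e : {v | v ∈ A.output W} = A.vecs W := by
    ext y; simp [Automaton.vecs, Automaton.output, eq_comm]
  rw [e]
  apply le_antisymm
  · refine Submodule.span_mono ?_
    rintro _ ⟨w, -, rfl⟩; exact ⟨w, rfl⟩
  · refine Submodule.span_le.2 ?_
    rintro _ ⟨u, rfl⟩
    induction u with
    | nil => exact Submodule.subset_span ⟨[], h.1.nil_mem, rfl⟩
    | cons σ u ih =>
      rw [A.backward_cons]
      refine A.push_mem_of_mem_span σ ?_ ih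
      rintro _ ⟨w, hw, rfl⟩
      have := h.2 w hw σ
      rwa [A.enlargesModule_iff, not_not, A.backward_cons] at this

end

end PFinite

namespace PFinite

noncomputable section

/-! ### Decision procedures for the guards -/

section Tests

variable {n s : ℕ} {α : Type} [Enc α]

/-- A list of polynomials as one polynomial, the `i`-th entry being multiplied by `x ^ (k i)`. -/
def packL (k : ℕ) (l : List ℚ[X]) : ℚ[X] :=
  ((List.range l.length).map fun i => X ^ (k * i) * l.getD i 0).sum

/-- The products of `p` with the first `k` powers of `x`. -/
def pows (k : ℕ) (p : ℚ[X]) : List ℚ[X] := (List.range k).map fun j => X ^ j * p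

/-- The test for membership in the rational span. -/
def ratTest (U : ℕ) (L : List (List ℚ[X])) (v : List ℚ[X]) : Bool :=
  inSpan (pows U (packL (3 * U) v) ++ L.flatMap fun b => pows (2 * U) (packL (3 * U) b))
    (X ^ U * packL (3 * U) v)

/-- The test for membership in the polynomial span. -/
def polyTest (U : ℕ) (L : List (List ℚ[X])) (v : List ℚ[X]) : Bool :=
  inSpan (L.flatMap fun b => pows U (packL (3 * U) b)) (packL (3 * U) v)

@[fun_prop]
theorem PD.packL {k : α → ℕ} {l : α → List ℚ[X]} (hk : PD k) (hl : PD l) :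
    PD fun a => packL (k a) (l a) :=
  PD.poly_sum (PD.map (f := fun s : α × ℕ => X ^ (k s.1 * s.2) * (l s.1).getD s.2 0)
    (by fun_prop) (by fun_prop))

@[fun_prop]
theorem PD.pows {k : α → ℕ} {p : α → ℚ[X]} (hk : PD k) (hp : PD p) :
    PD fun a => pows (k a) (p a) :=
  PD.map (f := fun s : α × ℕ => X ^ s.2 * p s.1) (by fun_prop) (by fun_prop)

@[fun_prop]
theorem PD.ratTest {U : α → ℕ} {L : α → List (List ℚ[X])} {v : α → List ℚ[X]} (hU : PD U)
    (hL : PD L) (hv : PD v) : PD fun a => ratTest (U a) (L a) (v a) := by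
  have : PD fun a => (L a).flatMap fun b => PFinite.pows (2 * U a) (PFinite.packL (3 * U a) b) :=
    PD.flatMap (f := fun s : α × List ℚ[X] =>
      PFinite.pows (2 * U s.1) (PFinite.packL (3 * U s.1) s.2)) hL (by fun_prop)
  unfold PFinite.ratTest
  fun_prop

@[fun_prop]
theorem PD.polyTest {U : α → ℕ} {L : α → List (List ℚ[X])} {v : α → List ℚ[X]} (hU : PD U)
    (hL : PD L) (hv : PD v) : PD fun a => polyTest (U a) (L a) (v a) := by
  have : PD fun a => (L a).flatMap fun b => PFinite.pows (U a) (PFinite.packL (3 * U a) b) :=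
    PD.flatMap (f := fun s : α × List ℚ[X] =>
      PFinite.pows (U s.1) (PFinite.packL (3 * U s.1) s.2)) hL (by fun_prop)
  unfold PFinite.polyTest
  fun_prop

/-- The packing of vectors into polynomials, as a linear map. -/
def pack (n k : ℕ) : (Fin n → ℚ[X]) →ₗ[ℚ[X]] ℚ[X] where
  toFun v := ∑ i : Fin n, X ^ (k * (i : ℕ)) * v i
  map_add' v w := by simp only [Pi.add_apply, mul_add, Finset.sum_add_distrib]
  map_smul' p v := by
    rw [RingHom.id_apply, smul_eq_mul, Finset.mul_sum]
    exact Finset.sum_congr rfl fun i _ => by rw [Pi.smul_apply, smul_eq_mul]; ring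

theorem packL_ofFn (k : ℕ) (v : Fin n → ℚ[X]) : packL k (List.ofFn v) = pack n k v := by
  change ∑ i ∈ Finset.range (List.ofFn v).length, X ^ (k * i) * (List.ofFn v).getD i 0 = _
  rw [List.length_ofFn, Finset.sum_range]
  refine Finset.sum_congr rfl fun i _ => ?_
  rw [List.getD_eq_getElem _ _ (by simp)]
  simp

/-- Kronecker substitution: entries of degree below `k` occupy disjoint blocks of `k` exponents. -/
theorem pack_injOn {k : ℕ} {v w : Fin n → ℚ[X]} (hv : v ∈ degVec n k) (hw : w ∈ degVec n k)
    (h : pack n k v = pack n k w) : v = w := by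
  have h0 : pack n k (v - w) = 0 := by rw [map_sub, h, sub_self]
  have hd := mem_degVec.1 (Submodule.sub_mem _ hv hw)
  rw [← sub_eq_zero]
  generalize v - w = z at h0 hd
  funext i
  ext j
  rw [Pi.zero_apply, coeff_zero]
  by_cases hj : j < k
  · have h1 := congrArg (fun p => coeff p (k * i + j)) h0
    simp only [coeff_zero] at h1
    rw [← h1]
    change _ = (∑ l : Fin n, X ^ (k * (l : ℕ)) * z l).coeff (k * i + j)
    rw [finsetSum_coeff, Finset.sum_eq_single i]
    · rw [coeff_X_pow_mul', if_pos (by omega), Nat.add_sub_cancel_left]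
    · intro l _ hl
      rw [coeff_X_pow_mul']
      split_ifs with hle
      · refine coeff_eq_zero_of_degree_lt ((hd l).trans_le ?_)
        have hlt : (l : ℕ) < i := by
          rcases lt_trichotomy (l : ℕ) i with h2 | h2 | h2
          · exact h2
          · exact absurd (Fin.ext h2) hl
          · have : k * ((i : ℕ) + 1) ≤ k * l := Nat.mul_le_mul_left _ h2
            rw [mul_add] at this
            omega
        have : k * ((l : ℕ) + 1) ≤ k * i := Nat.mul_le_mul_left _ hlt
        rw [mul_add] at this
        exact_mod_cast (show k ≤ k * i + j - k * l by omega)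
      · rfl
    · simp
  · exact coeff_eq_zero_of_degree_lt ((hd i).trans_le (by exact_mod_cast not_lt.1 hj))

theorem pack_mem_map_iff {k : ℕ} {M : Submodule ℚ (Fin n → ℚ[X])} (hM : M ≤ degVec n k)
    {v : Fin n → ℚ[X]} (hv : v ∈ degVec n k) :
    pack n k v ∈ M.map ((pack n k).restrictScalars ℚ) ↔ v ∈ M := by
  constructor
  · rintro ⟨w, hw, h⟩
    rw [← pack_injOn (hM hw) hv h]; exact hw
  · exact fun h => ⟨v, h, rfl⟩

theorem span_pows (k l : ℕ) (Ws : List (Fin n → ℚ[X])) :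
    Submodule.span ℚ {u | u ∈ (Ws.map List.ofFn).flatMap fun b => pows l (packL k b)} =
      (boundedSpan {w | w ∈ Ws} l).map ((pack n k).restrictScalars ℚ) := by
  rw [boundedSpan, Submodule.map_span]
  congr 1
  ext u
  simp only [Set.mem_ofPred_eq, List.mem_flatMap, List.mem_map, exists_exists_and_eq_and, pows,
    List.mem_range, Set.mem_image, packL_ofFn]
  constructor
  · rintro ⟨w, hw, j, hj, rfl⟩
    exact ⟨_, ⟨w, hw, j, hj, rfl⟩, map_smul (pack n k) _ _⟩
  · rintro ⟨_, ⟨w, hw, j, hj, rfl⟩, rfl⟩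
    exact ⟨w, hw, j, hj, (map_smul (pack n k) _ _).symm⟩

theorem mem_degVec_of_natDegree_le {v : Fin n → ℚ[X]} {D k : ℕ} (h : ∀ i, (v i).natDegree ≤ D)
    (hk : D < k) : v ∈ degVec n k :=
  mem_degVec.2 fun i => degree_le_natDegree.trans_lt (by exact_mod_cast (h i).trans_lt hk)

theorem degVec_mono {k l : ℕ} (h : k ≤ l) : degVec n k ≤ degVec n l := fun v hv =>
  mem_degVec.2 fun i => (mem_degVec.1 hv i).trans_le (by exact_mod_cast h)

theorem polyTest_iff {Ws : List (Fin n → ℚ[X])} {v : Fin n → ℚ[X]} {D U : ℕ}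
    (hS : ∀ w ∈ Ws, ∀ j, (w j).natDegree ≤ D) (hvD : ∀ j, (v j).natDegree ≤ D)
    (hD : D < U) (hU : n * D + 1 ≤ U) (hU' : n * (D + (n * D + 1)) + 1 ≤ U) :
    polyTest U (Ws.map List.ofFn) (List.ofFn v) = true ↔
      v ∈ Submodule.span ℚ[X] {w | w ∈ Ws} := by
  rw [polyTest, inSpan_iff, span_pows, packL_ofFn, pack_mem_map_iff
    ((boundedSpan_le_degVec (S := {w | w ∈ Ws}) hS).trans (degVec_mono (by omega)))
    (mem_degVec_of_natDegree_le hvD (by omega))]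
  exact ⟨fun h => boundedSpan_le _ _ h, mem_boundedSpan_of_mem_span (S := {w | w ∈ Ws}) hS hvD hU hU'⟩

/-- Blocks of width `3 U` suffice: since `D < U`, both `x ^ U v` and the products `x ^ j w` with `j
< 2 U` have degree below `3 U`. -/
theorem ratTest_iff {Ws : List (Fin n → ℚ[X])} {v : Fin n → ℚ[X]} {D U : ℕ}
    (hS : ∀ w ∈ Ws, ∀ j, (w j).natDegree ≤ D) (hvD : ∀ j, (v j).natDegree ≤ D)
    (hD : D < U) (hU : n * D + 1 ≤ U) :
    ratTest U (Ws.map List.ofFn) (List.ofFn v) = true ↔ RatSpan {w | w ∈ Ws} v := by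
  have e : {u | u ∈ pows U (packL (3 * U) (List.ofFn v)) ++
      (Ws.map List.ofFn).flatMap fun b => pows (2 * U) (packL (3 * U) b)} =
      {u | u ∈ ([v].map List.ofFn).flatMap fun b => pows U (packL (3 * U) b)} ∪
      {u | u ∈ (Ws.map List.ofFn).flatMap fun b => pows (2 * U) (packL (3 * U) b)} := by
    ext u; simp
  have e2 : X ^ U * packL (3 * U) (List.ofFn v) = pack n (3 * U) ((X ^ U : ℚ[X]) • v) := by
    rw [map_smul, packL_ofFn, smul_eq_mul]
  have e3 : {w | w ∈ [v]} = ({v} : Set (Fin n → ℚ[X])) := by ext; simp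
  have hX : (X ^ U : ℚ[X]) • v ∈ degVec n (3 * U) := by
    refine mem_degVec_of_natDegree_le (D := U + D) (fun i => ?_) (by omega)
    rw [Pi.smul_apply, smul_eq_mul]
    refine natDegree_mul_le.trans ?_
    rw [natDegree_X_pow]
    have := hvD i
    omega
  rw [ratTest, inSpan_iff, e, Submodule.span_union, span_pows, span_pows, ← Submodule.map_sup, e2,
    e3, pack_mem_map_iff (sup_le ?_ ?_) hX]
  · exact ⟨mem_span_of_X_pow_smul_mem, X_pow_smul_mem_of_mem_span (S := {w | w ∈ Ws}) hS hvD hU⟩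
  · refine (boundedSpan_le_degVec (D := D) ?_).trans (degVec_mono (by omega))
    rintro w hw
    rw [Set.mem_singleton_iff] at hw
    subst hw
    exact hvD
  · exact (boundedSpan_le_degVec (S := {w | w ∈ Ws}) hS).trans (degVec_mono (by omega))

end Tests

/-! ### The input of the program -/

/-- An automaton together with its dimension and the size of its alphabet. -/
def Input : Type := Σ n s : ℕ, Automaton n s

instance : Enc Input := ⟨fun a => a.2.2.encode⟩

/-- The entries of the final vector. -/
def finalL (a : Input) : List ℚ[X] := List.ofFn a.2.2.final

/-- The rows of the transition matrices. -/
def transL (a : Input) : List (List (List ℚ[X])) :=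
  List.ofFn fun σ => List.ofFn fun i => List.ofFn fun j => a.2.2.trans σ i j

theorem enc_ofFn {α : Type} [Enc α] {m : ℕ} (f : Fin m → α) :
    Enc.enc (List.ofFn f) = encList (List.ofFn fun i => Enc.enc (f i)) := by
  change encList ((List.ofFn f).map Enc.enc) = _
  rw [List.map_ofFn]; rfl

theorem PD.input : PD fun a : Input => (List.ofFn a.2.2.init, transL a, finalL a) :=
  PD.of_enc_eq fun a => by
    change Val.pair (Enc.enc (List.ofFn _)) (Val.pair (Enc.enc (List.ofFn _))
      (Enc.enc (List.ofFn _))) = _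
    simp only [enc_ofFn]
    rfl

@[fun_prop]
theorem PD.finalL {α : Type} [Enc α] {f : α → Input} (hf : PD f) : PD fun a => finalL (f a) :=
  (PD.input.comp hf).snd.snd

@[fun_prop]
theorem PD.transL {α : Type} [Enc α] {f : α → Input} (hf : PD f) : PD fun a => transL (f a) :=
  (PD.input.comp hf).snd.fst

/-- All coefficients of the final vector and of the transition matrices. -/
def allCoefs (a : Input) : List ℚ := (finalL a ++ (transL a).flatten.flatten).flatMap coefs

@[fun_prop]
theorem PD.allCoefs {α : Type} [Enc α] {f : α → Input} (hf : PD f) :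
    PD fun a => allCoefs (f a) :=
  PD.comp (g := fun a => PFinite.allCoefs a)
    (PD.flatMap (f := fun s : Input × ℚ[X] => PFinite.coefs s.2)
      (l := fun a : Input => PFinite.finalL a ++ (PFinite.transL a).flatten.flatten)
      (by fun_prop) (by fun_prop)) hf

/-- A bound for the dimension and the degree. -/
def param (a : Input) : ℕ := 1 + (allCoefs a).length

/-- The number of iterations of each loop, and the bound for the degrees in the tests. -/
def fuel (a : Input) : ℕ := 8 * (param a * param a * param a * (param a * param a * param a))

@[fun_prop]
theorem PD.param {α : Type} [Enc α] {f : α → Input} (hf : PD f) : PD fun a => param (f a) := by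
  unfold PFinite.param; fun_prop

@[fun_prop]
theorem PD.fuel {α : Type} [Enc α] {f : α → Input} (hf : PD f) : PD fun a => fuel (f a) := by
  unfold PFinite.fuel; fun_prop

theorem coefs_subset {a : Input} {p : ℚ[X]} (h : p ∈ finalL a ++ (transL a).flatten.flatten) :
    (∀ q ∈ coefs p, q ∈ allCoefs a) ∧ p.natDegree ≤ param a := by
  have h1 : ∀ l : List ℚ[X], p ∈ l → p.natDegree < (l.flatMap coefs).length := by
    intro l hl
    induction l with
    | nil => simp at hl
    | cons q l ih =>
      rw [List.flatMap_cons, List.length_append, length_coefs]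
      rcases List.mem_cons.1 hl with rfl | hl
      · omega
      · have := ih hl; omega
  refine ⟨fun q hq => List.mem_flatMap.2 ⟨p, h, hq⟩, ?_⟩
  have := h1 _ h
  rw [param, allCoefs]; omega

theorem final_mem (a : Input) (i : Fin a.1) :
    a.2.2.final i ∈ finalL a ++ (transL a).flatten.flatten :=
  List.mem_append_left _ (List.mem_ofFn.2 ⟨i, rfl⟩)

theorem trans_mem (a : Input) (σ : Fin a.2.1) (i j : Fin a.1) :
    a.2.2.trans σ i j ∈ finalL a ++ (transL a).flatten.flatten := by
  refine List.mem_append_right _ (List.mem_flatten.2 ⟨_, List.mem_flatten.2 ⟨_,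
    List.mem_ofFn.2 ⟨σ, rfl⟩, List.mem_ofFn.2 ⟨i, rfl⟩⟩, List.mem_ofFn.2 ⟨j, rfl⟩⟩)

theorem param_pos (a : Input) : 1 ≤ param a := by rw [param]; omega

/-- Every polynomial, also the zero polynomial, has at least one listed coefficient, so the entries
of the final vector alone account for `n` coefficients. -/
theorem dim_le_param (a : Input) : a.1 ≤ param a := by
  have h : ∀ l : List ℚ[X], l.length ≤ (l.flatMap coefs).length := by
    intro l
    induction l with
    | nil => simp
    | cons q l ih =>
      rw [List.flatMap_cons, List.length_append, length_coefs, List.length_cons]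
      omega
  have h1 := h (finalL a ++ (transL a).flatten.flatten)
  have h2 : (finalL a).length = a.1 := List.length_ofFn
  rw [List.length_append] at h1
  rw [param, allCoefs]; omega

theorem degree_le_param (a : Input) : a.2.2.degree ≤ param a := by
  refine max_le (Finset.sup_le fun σ _ => Finset.sup_le fun i _ => Finset.sup_le fun j _ => ?_)
    (Finset.sup_le fun i _ => ?_)
  · exact (coefs_subset (trans_mem a σ i j)).2
  · exact (coefs_subset (final_mem a i)).2

/-- A bound for the number of collected words, plus one. -/
def wordBound (a : Input) : ℕ := 2 * (param a * param a * param a) + 1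

theorem length_lt_wordBound {a : Input} {q : State a.2.1} (h : a.2.2.Reachable q) :
    q.words.length < wordBound a := by
  have h1 := h.length_le
  have h2 := dim_le_param a
  have h3 := degree_le_param a
  have h4 := param_pos a
  have h5 : max 1 a.1 ≤ param a := max_le h4 h2
  have h6 : a.1 * (a.2.2.degree * max 1 a.1) ≤ param a * (param a * param a) := by gcongr
  have h7 : param a ≤ param a * (param a * param a) := Nat.le_mul_of_pos_right _ (by positivity)
  have h8 : param a * (param a * param a) = param a * param a * param a := by ring
  rw [wordBound]
  omega

/-- A bound for the degrees of the backward vectors. -/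
def degBound (a : Input) : ℕ := param a * wordBound a

theorem natDegree_backward_le (a : Input) {u : List (Fin a.2.1)} (hu : u.length < wordBound a)
    (i : Fin a.1) : (a.2.2.backward u i).natDegree ≤ degBound a :=
  (a.2.2.natDegree_backward_le u i).trans (Nat.mul_le_mul (degree_le_param a) hu)

/-- With `T` for `param a`, the largest requirement is at most `2T^6 + 2T^5 + T^3 + T^2 + T + 1`.
Its coefficients sum to `8`, which explains the factor in `fuel`. -/
theorem fuel_bounds (a : Input) : wordBound a ≤ fuel a ∧ degBound a < fuel a ∧
    a.1 * degBound a + 1 ≤ fuel a ∧ a.1 * (degBound a + (a.1 * degBound a + 1)) + 1 ≤ fuel a := by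
  have h2 := dim_le_param a
  have h4 := param_pos a
  set T := param a with hT
  have hp : ∀ i j, i ≤ j → T ^ i ≤ T ^ j := fun i j h => Nat.pow_le_pow_right h4 h
  have f0 : fuel a = 8 * T ^ 6 := by rw [fuel]; ring
  have w0 : wordBound a = 2 * T ^ 3 + 1 := by rw [wordBound]; ring
  have d0 : degBound a = 2 * T ^ 4 + T ^ 1 := by rw [degBound, w0]; ring
  have e1 : a.1 * degBound a ≤ 2 * T ^ 5 + T ^ 2 := by
    rw [d0]
    calc a.1 * (2 * T ^ 4 + T ^ 1) ≤ T * (2 * T ^ 4 + T ^ 1) := by gcongr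
      _ = _ := by ring
  have e2 : a.1 * (degBound a + (a.1 * degBound a + 1)) ≤
      T * (2 * T ^ 4 + T ^ 1 + (2 * T ^ 5 + T ^ 2 + 1)) := by
    rw [← d0]; gcongr
  have e3 : T * (2 * T ^ 4 + T ^ 1 + (2 * T ^ 5 + T ^ 2 + 1)) =
      2 * T ^ 5 + T ^ 2 + 2 * T ^ 6 + T ^ 3 + T ^ 1 := by ring
  have p1 := hp 0 6 (by norm_num)
  have p2 := hp 1 6 (by norm_num)
  have p3 := hp 2 6 (by norm_num)
  have p4 := hp 3 6 (by norm_num)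
  have p5 := hp 4 6 (by norm_num)
  have p6 := hp 5 6 (by norm_num)
  rw [pow_zero] at p1
  rw [f0, w0, d0]
  rw [d0] at e1 e2
  refine ⟨?_, ?_, ?_, ?_⟩ <;> omega

/-! ### The size of backward vectors -/

/-- The increment of the height of a backward vector caused by one letter. -/
def heightStep (a : Input) : ℕ :=
  2 * sz (allCoefs a) + 2 * (degBound a + 1) + (param a + 1) + param a

/-- One letter multiplies the denominator by `c` and adds a fixed number of bits to the height. The
terms of `heightStep` come, in order, from the coefficients of the matrix, the shift, the product of
two polynomials and the sum over the `n` columns. -/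
theorem backward_height (a : Input) : ∃ c : ℕ, 0 < c ∧ c ≤ 2 ^ sz (allCoefs a) ∧
    ∀ u : List (Fin a.2.1), u.length < wordBound a → ∀ i,
      PHt (c ^ (u.length + 1)) ((u.length + 1) * heightStep a) (a.2.2.backward u i) := by
  obtain ⟨c, hc, hcl, hq⟩ := exists_common_den (allCoefs a)
  have key : ∀ p ∈ finalL a ++ (transL a).flatten.flatten, PHt c (2 * sz (allCoefs a)) p := by
    intro p hp k
    rw [coeff_eq_getD]
    by_cases hk : k < (coefs p).length
    · rw [List.getD_eq_getElem _ _ hk]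
      exact hq _ ((coefs_subset hp).1 _ (List.getElem_mem hk))
    · rw [List.getD_eq_default _ _ (by omega)]; exact Ht.zero hc
  refine ⟨c, hc, hcl, fun u => ?_⟩
  induction u with
  | nil =>
    intro _ i
    rw [Automaton.backward_nil]
    simp only [List.length_nil, zero_add, pow_one, one_mul]
    exact (key _ (final_mem a i)).mono (by rw [heightStep]; omega)
  | cons σ u ih =>
    intro hu i
    rw [List.length_cons] at hu
    have ih' := ih (by omega)
    rw [Automaton.backward_cons, Automaton.push, Matrix.mulVec, dotProduct, List.length_cons]
    have h1 : ∀ j, PHt (c ^ (u.length + 1 + 1)) (2 * sz (allCoefs a) +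
        ((u.length + 1) * heightStep a + 2 * (degBound a + 1)) + (param a + 1))
        (a.2.2.trans σ i j * shift 1 (a.2.2.backward u j)) := fun j => by
      have := (key _ (trans_mem a σ i j)).mul ((ih' j).shift (natDegree_backward_le a (by omega) j))
        (coefs_subset (trans_mem a σ i j)).2
      rwa [← pow_succ'] at this
    refine (PHt.sum (pow_pos hc _) Finset.univ _ fun j _ => h1 j).mono ?_
    rw [Finset.card_univ, Fintype.card_fin]
    have h2 := dim_le_param a
    have h3 : (u.length + 1 + 1) * heightStep a = (u.length + 1) * heightStep a + heightStep a := by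
      ring
    rw [h3]
    nth_rewrite 3 [heightStep]
    omega

/-- A bound for the size of the entries of backward vectors. -/
def entryBound (a : Input) : ℕ :=
  1 + (degBound a + 1) * (5 + wordBound a * heightStep a + (sz (allCoefs a) * wordBound a + 1))

theorem sz_backward_le (a : Input) {u : List (Fin a.2.1)} (hu : u.length < wordBound a) :
    sz (List.ofFn (a.2.2.backward u)) ≤ 1 + param a * (1 + entryBound a) := by
  obtain ⟨c, hc, hcl, h⟩ := backward_height a
  refine (sz_le_mul _ (entryBound a) fun p hp => ?_).trans ?_
  · obtain ⟨i, rfl⟩ := List.mem_ofFn.1 hp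
    refine ((h u hu i).sz_le (natDegree_backward_le a hu i)).trans ?_
    have h1 : Nat.size (c ^ (u.length + 1)) ≤ sz (allCoefs a) * wordBound a + 1 := by
      refine size_le_of_le_two_pow ?_
      calc c ^ (u.length + 1) ≤ (2 ^ sz (allCoefs a)) ^ (u.length + 1) :=
            Nat.pow_le_pow_left hcl _
        _ = 2 ^ (sz (allCoefs a) * (u.length + 1)) := (pow_mul _ _ _).symm
        _ ≤ _ := Nat.pow_le_pow_right (by norm_num) (Nat.mul_le_mul_left _ hu)
    have h2 : (u.length + 1) * heightStep a ≤ wordBound a * heightStep a :=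
      Nat.mul_le_mul_right _ hu
    rw [entryBound]
    gcongr
  · rw [List.length_ofFn]
    have := dim_le_param a
    gcongr

/-- A bound for the size of the lists of vectors that occur in executions. -/
def stateBound (a : Input) : ℕ :=
  1 + wordBound a * (1 + (1 + param a * (1 + entryBound a)))

theorem PB.stateBound : PB stateBound := by
  have hT : PB param := PB.nat (by fun_prop)
  have hC : PB fun a : Input => sz (allCoefs a) := PD.bound (by fun_prop)
  have hW : PB wordBound := ((PB.const 2).mul ((hT.mul hT).mul hT)).add (PB.const 1)
  have hD : PB degBound := hT.mul hW
  have hH : PB heightStep := ((((PB.const 2).mul hC).add ((PB.const 2).mul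
    (hD.add (PB.const 1)))).add (hT.add (PB.const 1))).add hT
  have hE : PB entryBound := (PB.const 1).add ((hD.add (PB.const 1)).mul
    (((PB.const 5).add (hW.mul hH)).add ((hC.mul hW).add (PB.const 1))))
  exact (PB.const 1).add (hW.mul ((PB.const 1).add ((PB.const 1).add
    (hT.mul ((PB.const 1).add hE)))))

/-- The backward vector of a word, as a list. -/
def Automaton.vecL {n s : ℕ} (A : Automaton n s) (u : List (Fin s)) : List ℚ[X] :=
  List.ofFn (A.backward u)

theorem sz_map_vecL_le {a : Input} {q : State a.2.1} (h : a.2.2.Reachable q) :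
    sz (q.words.map a.2.2.vecL) ≤ stateBound a := by
  have h1 := length_lt_wordBound h
  refine (sz_le_mul _ (1 + param a * (1 + entryBound a)) fun v hv => ?_).trans ?_
  · obtain ⟨u, hu, rfl⟩ := List.mem_map.1 hv
    exact sz_backward_le a ((h.length_lt u hu).trans h1)
  · rw [List.length_map, stateBound]
    gcongr

end

end PFinite

namespace PFinite

noncomputable section

/-! ### The program -/

section Program

variable {α : Type} [Enc α]

/-- The product of a matrix with a shifted vector. -/
def pushL (M : List (List ℚ[X])) (v : List ℚ[X]) : List ℚ[X] :=
  M.map fun r => ((List.range v.length).map fun k => r.getD k 0 * shift 1 (v.getD k 0)).sum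

@[fun_prop]
theorem PD.pushL {M : α → List (List ℚ[X])} {v : α → List ℚ[X]} (hM : PD M) (hv : PD v) :
    PD fun a => pushL (M a) (v a) :=
  PD.map (f := fun s : α × List ℚ[X] => ((List.range (v s.1).length).map fun k =>
    s.2.getD k 0 * PFinite.shift 1 ((v s.1).getD k 0)).sum) hM
    (PD.poly_sum (PD.map (f := fun s : (α × List ℚ[X]) × ℕ =>
      s.1.2.getD s.2 0 * PFinite.shift 1 ((v s.1.1).getD s.2 0)) (by fun_prop) (by fun_prop)))

/-- The vectors that the collected vectors `L` lead to. -/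
def candidates (a : Input) (L : List (List ℚ[X])) : List (List ℚ[X]) :=
  L.flatMap fun v => (transL a).map fun M => pushL M v

@[fun_prop]
theorem PD.candidates {f : α → Input} {L : α → List (List ℚ[X])} (hf : PD f) (hL : PD L) :
    PD fun a => candidates (f a) (L a) :=
  PD.flatMap (f := fun s : α × List ℚ[X] => (PFinite.transL (f s.1)).map fun M => PFinite.pushL M s.2) hL
    (PD.map (f := fun s : (α × List ℚ[X]) × List (List ℚ[X]) => PFinite.pushL s.2 s.1.2)
      (by fun_prop) (by fun_prop))

/-- Choice of one of the vectors `c` and `cs`. -/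
def chooseL (pick : Val → Bool) (L : List (List ℚ[X])) (c : List ℚ[X]) (cs : List (List ℚ[X])) :
    List ℚ[X] :=
  -- A choice depends only on the value presented to it. The collected vectors `L` therefore
  -- accompany both alternatives, so that different states of an execution can be resolved
  -- differently.
  cs.foldl (fun x c => (if pick (.pair (Enc.enc (L, x)) (Enc.enc (L, c))) = true then (L, x)
    else (L, c)).2) c

theorem chooseL_cons (pick : Val → Bool) (L : List (List ℚ[X])) (c d : List ℚ[X])
    (cs : List (List ℚ[X])) : chooseL pick L c (d :: cs) = chooseL pick L
      (if pick (.pair (Enc.enc (L, c)) (Enc.enc (L, d))) = true then (L, c) else (L, d)).2 cs :=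
  rfl

theorem chooseL_mem (pick : Val → Bool) (L : List (List ℚ[X])) (c : List ℚ[X])
    (cs : List (List ℚ[X])) : chooseL pick L c cs ∈ c :: cs := by
  induction cs generalizing c with
  | nil => simp [chooseL]
  | cons d cs ih =>
    have h := ih (if pick (.pair (Enc.enc (L, c)) (Enc.enc (L, d))) = true then (L, c)
      else (L, d)).2
    rw [chooseL_cons]
    split_ifs at h ⊢
    · exact List.mem_cons.2 ((List.mem_cons.1 h).imp id (List.mem_cons_of_mem _))
    · exact List.mem_cons_of_mem _ h

theorem PT.chooseL : PT fun pick (s : List (List ℚ[X]) × List ℚ[X] × List (List ℚ[X])) =>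
    chooseL pick s.1 s.2.1 s.2.2 := by
  refine PT.foldl (l := fun s : List (List ℚ[X]) × List ℚ[X] × List (List ℚ[X]) => s.2.2)
    (b := fun _ s => s.2.1) (f := fun pick t => (if pick (.pair (Enc.enc (t.1.1, t.2.1))
      (Enc.enc (t.1.1, t.2.2))) = true then (t.1.1, t.2.1) else (t.1.1, t.2.2)).2)
    (g := fun s => sz s) (by fun_prop)
    (show PD fun s : List (List ℚ[X]) × List ℚ[X] × List (List ℚ[X]) => s.2.1 by fun_prop) ?_
    PB.size ?_
  · have h : PT fun pick (t : (List (List ℚ[X]) × List ℚ[X] × List (List ℚ[X])) × List ℚ[X] ×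
        List ℚ[X]) => if pick (.pair (Enc.enc (t.1.1, t.2.1)) (Enc.enc (t.1.1, t.2.2))) = true
        then (t.1.1, t.2.1) else (t.1.1, t.2.2) :=
      PT.choose (show PD fun t : (List (List ℚ[X]) × List ℚ[X] × List (List ℚ[X])) × List ℚ[X] ×
        List ℚ[X] => (t.1.1, t.2.1) by fun_prop) (show PD fun t : (List (List ℚ[X]) × List ℚ[X] ×
          List (List ℚ[X])) × List ℚ[X] × List ℚ[X] => (t.1.1, t.2.2) by fun_prop)
    exact PT.comp (g := fun _ (p : List (List ℚ[X]) × List ℚ[X]) => p.2)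
      (show PD fun p : List (List ℚ[X]) × List ℚ[X] => p.2 by fun_prop) h
  · rintro pick ⟨L, c, cs⟩ l₁ l₂ h
    change sz (PFinite.chooseL pick L c l₁) ≤ sz (L, c, cs)
    have h1 : PFinite.chooseL pick L c l₁ ∈ c :: cs := by
      have h2 := chooseL_mem pick L c l₁
      simp only at h
      rw [h]
      exact List.mem_cons.2 ((List.mem_cons.1 h2).imp id (List.mem_append_left _))
    have h2 := sz_mem h1
    rw [sz_cons] at h2
    rw [sz_pair, sz_pair]
    omega

/-- One iteration of a loop with guard `¬ test`. -/
def iteration (test : ℕ → List (List ℚ[X]) → List ℚ[X] → Bool) (pick : Val → Bool) (a : Input)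
    (L : List (List ℚ[X])) : List (List ℚ[X]) :=
  match (candidates a L).filter fun c => !test (fuel a) L c with
  -- Without a candidate the round is idle, so a fixed number of rounds can replace the `while`
  -- loop.
  | [] => L
  | c :: cs => L ++ [chooseL pick L c cs]

theorem PT.iteration {test : ℕ → List (List ℚ[X]) → List ℚ[X] → Bool}
    (ht : PD fun s : ℕ × List (List ℚ[X]) × List ℚ[X] => test s.1 s.2.1 s.2.2) :
    PT fun pick (s : Input × List (List ℚ[X])) => iteration test pick s.1 s.2 := by
  have h := PT.listCases (l := fun s : Input × List (List ℚ[X]) =>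
    (candidates s.1 s.2).filter fun c => !test (fuel s.1) s.2 c) (f := fun _ s => s.2)
    (g := fun pick t => t.1.2 ++ [PFinite.chooseL pick t.1.2 t.2.1 t.2.2]) ?_ ?_ ?_
  · convert h using 3 with pick s
    unfold PFinite.iteration
    split <;> simp only [*]
  · refine PD.filter (c := fun t : (Input × List (List ℚ[X])) × List ℚ[X] =>
      !test (fuel t.1.1) t.1.2 t.2) (by fun_prop) (PD.not ?_)
    exact ht.comp (f := fun t : (Input × List (List ℚ[X])) × List ℚ[X] =>
      (fuel t.1.1, t.1.2, t.2)) (by fun_prop)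
  · exact show PD fun s : Input × List (List ℚ[X]) => s.2 by fun_prop
  · have h := PT.chooseL.comp (f := fun _ (t : (Input × List (List ℚ[X])) × List ℚ[X] ×
      List (List ℚ[X])) => (t.1.2, t.2.1, t.2.2)) (show PD fun t : (Input × List (List ℚ[X])) ×
      List ℚ[X] × List (List ℚ[X]) => (t.1.2, t.2.1, t.2.2) by fun_prop)
    exact PT.comp (g := fun _ (p : List (List ℚ[X]) × List ℚ[X]) => p.1 ++ [p.2])
      (show PD fun p : List (List ℚ[X]) × List ℚ[X] => p.1 ++ [p.2] by fun_prop)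
      (PT.pair (show PD fun t : (Input × List (List ℚ[X])) × List ℚ[X] × List (List ℚ[X]) => t.1.2
        by fun_prop) h)

/-- The first loop. -/
def firstLoop (pick : Val → Bool) (a : Input) : List (List ℚ[X]) :=
  (List.range (fuel a)).foldl (fun L _ => iteration ratTest pick a L) [finalL a]

/-- The procedure. -/
def procedure (pick : Val → Bool) (a : Input) : List (List ℚ[X]) :=
  (List.range (fuel a)).foldl (fun L _ => iteration polyTest pick a L) (firstLoop pick a)

end Program

/-! ### Correctness of the program -/

theorem pushL_ofFn (a : Input) (σ : Fin a.2.1) (v : Fin a.1 → ℚ[X]) :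
    pushL (List.ofFn fun i => List.ofFn fun j => a.2.2.trans σ i j) (List.ofFn v) =
      List.ofFn (a.2.2.push σ v) := by
  rw [pushL, List.map_ofFn]
  congr 1
  funext i
  simp only [Function.comp_apply, List.length_ofFn]
  change ∑ k ∈ Finset.range a.1, (List.ofFn fun j => a.2.2.trans σ i j).getD k 0 *
    shift 1 ((List.ofFn v).getD k 0) = _
  rw [Finset.sum_range]
  refine Finset.sum_congr rfl fun j _ => ?_
  rw [List.getD_eq_getElem _ _ (by simp), List.getD_eq_getElem _ _ (by simp)]
  simp

theorem mem_candidates {a : Input} {W : List (List (Fin a.2.1))} {c : List ℚ[X]} :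
    c ∈ candidates a (W.map a.2.2.vecL) ↔ ∃ w ∈ W, ∃ σ, c = a.2.2.vecL (σ :: w) := by
  have h : ∀ w σ, pushL (List.ofFn fun i => List.ofFn fun j => a.2.2.trans σ i j)
      (a.2.2.vecL w) = a.2.2.vecL (σ :: w) := fun w σ => by
    rw [Automaton.vecL, Automaton.vecL, pushL_ofFn, Automaton.backward_cons]
  rw [candidates, List.mem_flatMap]
  constructor
  · rintro ⟨_, hv, hc⟩
    obtain ⟨w, hw, rfl⟩ := List.mem_map.1 hv
    obtain ⟨M, hM, rfl⟩ := List.mem_map.1 hc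
    obtain ⟨σ, rfl⟩ := List.mem_ofFn.1 hM
    exact ⟨w, hw, σ, h w σ⟩
  · rintro ⟨w, hw, σ, rfl⟩
    exact ⟨_, List.mem_map.2 ⟨w, hw, rfl⟩, List.mem_map.2 ⟨_, List.mem_ofFn.2 ⟨σ, rfl⟩, h w σ⟩⟩

/-- `test` decides the negation of the guard `G` for the words `W`. -/
def Decides (a : Input) (test : ℕ → List (List ℚ[X]) → List ℚ[X] → Bool)
    (W : List (List (Fin a.2.1))) (G : List (Fin a.2.1) → Prop) : Prop :=
  ∀ w ∈ W, ∀ σ, test (fuel a) (W.map a.2.2.vecL) (a.2.2.vecL (σ :: w)) = true ↔ ¬ G (σ :: w)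

theorem mem_filter_candidates {a : Input} {test : ℕ → List (List ℚ[X]) → List ℚ[X] → Bool}
    {W : List (List (Fin a.2.1))} {G : List (Fin a.2.1) → Prop} (hd : Decides a test W G)
    {c : List ℚ[X]} : c ∈ (candidates a (W.map a.2.2.vecL)).filter
      (fun c => !test (fuel a) (W.map a.2.2.vecL) c) ↔
      ∃ w ∈ W, ∃ σ, G (σ :: w) ∧ c = a.2.2.vecL (σ :: w) := by
  rw [List.mem_filter, mem_candidates]
  constructor
  · rintro ⟨⟨w, hw, σ, rfl⟩, ht⟩
    refine ⟨w, hw, σ, ?_, rfl⟩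
    by_contra hg
    rw [(hd w hw σ).2 hg] at ht
    simp at ht
  · rintro ⟨w, hw, σ, hg, rfl⟩
    refine ⟨⟨w, hw, σ, rfl⟩, ?_⟩
    have := mt (hd w hw σ).1 (not_not.2 hg)
    simpa using this

theorem iteration_of_closed {a : Input} {test : ℕ → List (List ℚ[X]) → List ℚ[X] → Bool}
    {W : List (List (Fin a.2.1))} {G : List (Fin a.2.1) → Prop} (hd : Decides a test W G)
    (pick : Val → Bool) (h : ∀ w ∈ W, ∀ σ, ¬ G (σ :: w)) :
    iteration test pick a (W.map a.2.2.vecL) = W.map a.2.2.vecL := by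
  have h1 : (candidates a (W.map a.2.2.vecL)).filter
      (fun c => !test (fuel a) (W.map a.2.2.vecL) c) = [] := by
    rw [List.eq_nil_iff_forall_not_mem]
    intro c hc
    obtain ⟨w, hw, σ, hg, -⟩ := (mem_filter_candidates hd).1 hc
    exact h w hw σ hg
  rw [iteration, h1]

/-- The program handles vectors only. Several words may have the chosen vector, and any of them that
satisfies the guard continues the execution. -/
theorem iteration_of_not_closed {a : Input} {test : ℕ → List (List ℚ[X]) → List ℚ[X] → Bool}
    {W : List (List (Fin a.2.1))} {G : List (Fin a.2.1) → Prop} (hd : Decides a test W G)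
    (pick : Val → Bool) (h : ¬ ∀ w ∈ W, ∀ σ, ¬ G (σ :: w)) :
    ∃ w ∈ W, ∃ σ, G (σ :: w) ∧
      iteration test pick a (W.map a.2.2.vecL) = (W ++ [σ :: w]).map a.2.2.vecL := by
  push Not at h
  obtain ⟨w, hw, σ, hg⟩ := h
  have h1 := (mem_filter_candidates hd).2 ⟨w, hw, σ, hg, rfl⟩
  cases hF : (candidates a (W.map a.2.2.vecL)).filter
      (fun c => !test (fuel a) (W.map a.2.2.vecL) c) with
  | nil => rw [hF] at h1; simp at h1
  | cons c cs =>
    have h2 := chooseL_mem pick (W.map a.2.2.vecL) c cs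
    rw [← hF, mem_filter_candidates hd] at h2
    obtain ⟨w', hw', σ', hg', e⟩ := h2
    refine ⟨w', hw', σ', hg', ?_⟩
    rw [iteration, hF]
    simp only [e, List.map_append, List.map_singleton]

/-! ### Faithfulness of the encoding, and choices that reproduce a given output. -/

theorem encList_injective : Function.Injective encList := by
  intro l
  induction l with
  | nil => intro m h; cases m with
    | nil => rfl
    | cons b m => simp [encList] at h
  | cons a l ih => intro m h; cases m with
    | nil => simp [encList] at h
    | cons b m =>
      simp only [encList, Val.pair.injEq] at h
      rw [h.1, ih h.2]

theorem enc_list_injective {α : Type} [Enc α] (h : Function.Injective (Enc.enc : α → Val)) :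
    Function.Injective (Enc.enc : List α → Val) :=
  encList_injective.comp (List.map_injective_iff.2 h)

theorem enc_rat_injective : Function.Injective (Enc.enc : ℚ → Val) := by
  intro p q h
  change encRat p = encRat q at h
  simp only [encRat, Val.pair.injEq, Val.int.injEq, Nat.cast_inj] at h
  exact Rat.ext h.1 h.2

theorem enc_poly_injective : Function.Injective (Enc.enc : ℚ[X] → Val) := by
  intro p q h
  rw [← enc_coefs, ← enc_coefs] at h
  have := enc_list_injective enc_rat_injective h
  rw [← ofCoefs_coefs p, this, ofCoefs_coefs]

/-- The choices that lead to the output `T`. -/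
def follow (T : List (List ℚ[X])) (x : Val) : Bool :=
  open Classical in
  decide (∃ (L : List (List ℚ[X])) (v : List ℚ[X]) (y : Val), (L ++ [v]) <+: T ∧
    x = .pair (Enc.enc (L, v)) y)

theorem follow_iff {T L : List (List ℚ[X])} {v : List ℚ[X]} {y : Val} :
    follow T (.pair (Enc.enc (L, v)) y) = true ↔ (L ++ [v]) <+: T := by
  simp only [follow, decide_eq_true_eq]
  constructor
  · rintro ⟨L', v', y', h, e⟩
    simp only [Val.pair.injEq] at e
    have e1 : Val.pair (Enc.enc L) (Enc.enc v) = Val.pair (Enc.enc L') (Enc.enc v') := e.1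
    simp only [Val.pair.injEq] at e1
    rw [enc_list_injective (enc_list_injective enc_poly_injective) e1.1,
      enc_list_injective enc_poly_injective e1.2]
    exact h
  · exact fun h => ⟨L, v, y, h, rfl⟩

/-- The wanted vector `v` survives the successive comparisons. Once it is the current winner it is
kept, and any other winner is dropped because `T` has only one prefix of length `L.length + 1`. -/
theorem chooseL_follow {T L : List (List ℚ[X])} {v : List ℚ[X]} (hT : (L ++ [v]) <+: T) :
    ∀ (cs : List (List ℚ[X])) (c : List ℚ[X]), v ∈ c :: cs → chooseL (follow T) L c cs = v := by
  intro cs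
  induction cs with
  | nil => intro c hc; exact (List.mem_singleton.1 hc).symm
  | cons d cs ih =>
    intro c hc
    rw [chooseL_cons]
    refine ih _ ?_
    by_cases hcv : c = v
    · rw [if_pos (by rw [hcv]; exact follow_iff.2 hT)]
      simp [hcv]
    · rw [if_neg]
      · exact (List.mem_cons.1 hc).resolve_left (Ne.symm hcv)
      · rw [follow_iff]
        intro h
        refine hcv ?_
        have h1 := List.prefix_of_prefix_length_le h hT (by simp)
        have h2 := h1.eq_of_length (by simp)
        simpa using h2

theorem iteration_follow {a : Input} {test : ℕ → List (List ℚ[X]) → List ℚ[X] → Bool}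
    {W : List (List (Fin a.2.1))} {G : List (Fin a.2.1) → Prop} (hd : Decides a test W G)
    {T : List (List ℚ[X])} {w : List (Fin a.2.1)} (hw : w ∈ W) {σ : Fin a.2.1} (hg : G (σ :: w))
    (hT : ((W ++ [σ :: w]).map a.2.2.vecL) <+: T) :
    iteration test (follow T) a (W.map a.2.2.vecL) = (W ++ [σ :: w]).map a.2.2.vecL := by
  have h1 := (mem_filter_candidates hd).2 ⟨w, hw, σ, hg, rfl⟩
  rw [List.map_append, List.map_singleton] at hT ⊢
  rw [iteration]
  cases hF : (candidates a (W.map a.2.2.vecL)).filter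
      (fun c => !test (fuel a) (W.map a.2.2.vecL) c) with
  | nil => rw [hF] at h1; simp at h1
  | cons c cs =>
    rw [hF] at h1
    simp only [chooseL_follow hT cs c h1]

/-! ### The tests decide the guards in reachable states. -/

section Decide

variable {a : Input} {q : State a.2.1}

theorem words_bounds (h : a.2.2.Reachable q) :
    (∀ v ∈ q.words.map a.2.2.backward, ∀ j, (v j).natDegree ≤ degBound a) ∧
    (∀ w ∈ q.words, ∀ σ j, (a.2.2.backward (σ :: w) j).natDegree ≤ degBound a) := by
  have h1 := length_lt_wordBound h
  constructor
  · intro v hv j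
    obtain ⟨u, hu, rfl⟩ := List.mem_map.1 hv
    exact natDegree_backward_le a ((h.length_lt u hu).trans h1) j
  · intro w hw σ j
    refine natDegree_backward_le a ?_ j
    have := h.length_lt w hw
    rw [List.length_cons]
    omega

theorem vecs_eq {n s : ℕ} (A : Automaton n s) (W : List (List (Fin s))) :
    {v | v ∈ W.map A.backward} = A.vecs W := by
  ext y; simp [Automaton.vecs, eq_comm]

theorem map_vecL {n s : ℕ} (A : Automaton n s) (W : List (List (Fin s))) :
    W.map A.vecL = (W.map A.backward).map List.ofFn := by
  rw [List.map_map]; rfl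

theorem decides_ratTest (h : a.2.2.Reachable q) :
    Decides a ratTest q.words (a.2.2.RaisesRank q.words) := by
  obtain ⟨-, hD, hU, -⟩ := fuel_bounds a
  obtain ⟨h1, h2⟩ := words_bounds h
  intro w hw σ
  rw [map_vecL, Automaton.vecL, ratTest_iff h1 (h2 w hw σ) hD hU, vecs_eq,
    Automaton.raisesRank_iff, not_not]

theorem decides_polyTest (h : a.2.2.Reachable q) :
    Decides a polyTest q.words (a.2.2.EnlargesModule q.words) := by
  obtain ⟨-, hD, hU, hU'⟩ := fuel_bounds a
  obtain ⟨h1, h2⟩ := words_bounds h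
  intro w hw σ
  rw [map_vecL, Automaton.vecL, polyTest_iff h1 (h2 w hw σ) hD hU hU', vecs_eq,
    Automaton.enlargesModule_iff, not_not]

end Decide

theorem foldl_eq_iterate {β γ : Type} (f : β → β) (l : List γ) (b : β) :
    l.foldl (fun x _ => f x) b = f^[l.length] b := by
  induction l generalizing b with
  | nil => rfl
  | cons c l ih => rw [List.foldl_cons, ih, List.length_cons, Function.iterate_succ_apply]

/-! ### The simulated loops: soundness, and reproduction of every complete execution. -/

section Loops

variable {a : Input}

theorem finalL_eq : [finalL a] = ([[]] : List (List (Fin a.2.1))).map a.2.2.vecL := by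
  simp [finalL, Automaton.vecL, Automaton.backward_nil]

/-- As long as the loop is not finished, each round adds a word. More words than `wordBound a ≤ fuel
a` are impossible, so after `fuel a` rounds only the second alternative is left. -/
theorem firstLoop_iterate (pick : Val → Bool) (i : ℕ) :
    ∃ W, a.2.2.First W ∧ (iteration ratTest pick a)^[i] [finalL a] = W.map a.2.2.vecL ∧
      (i < W.length ∨ ∀ w ∈ W, ∀ σ, ¬ a.2.2.RaisesRank W (σ :: w)) := by
  induction i with
  | zero => exact ⟨[[]], .start, finalL_eq, Or.inl (by simp)⟩
  | succ i ih =>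
    obtain ⟨W, hW, e, h⟩ := ih
    have hd := decides_ratTest hW.reachable
    rw [Function.iterate_succ_apply', e]
    by_cases hc : ∀ w ∈ W, ∀ σ, ¬ a.2.2.RaisesRank W (σ :: w)
    · exact ⟨W, hW, iteration_of_closed hd pick hc, Or.inr hc⟩
    · obtain ⟨w, hw, σ, hg, e'⟩ := iteration_of_not_closed hd pick hc
      refine ⟨_, hW.snoc hw hg, e', Or.inl ?_⟩
      have := h.resolve_right hc
      rw [List.length_append, List.length_singleton]
      omega

theorem firstLoop_spec (pick : Val → Bool) :
    ∃ W, a.2.2.Second W [] ∧ firstLoop pick a = W.map a.2.2.vecL := by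
  obtain ⟨W, hW, e, h⟩ := firstLoop_iterate (a := a) pick (fuel a)
  have h1 := length_lt_wordBound hW.reachable
  have h2 := (fuel_bounds a).1
  refine ⟨W, .start hW (h.resolve_left ?_), ?_⟩
  · simp only at h1; omega
  · rw [firstLoop, foldl_eq_iterate (iteration ratTest pick a), List.length_range, e]

theorem procedure_iterate (pick : Val → Bool) (i : ℕ) :
    ∃ W V, a.2.2.Second W V ∧
      (iteration polyTest pick a)^[i] (firstLoop pick a) = (W ++ V).map a.2.2.vecL ∧
      (i ≤ V.length ∨ ∀ w ∈ W ++ V, ∀ σ, ¬ a.2.2.EnlargesModule (W ++ V) (σ :: w)) := by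
  induction i with
  | zero =>
    obtain ⟨W, hW, e⟩ := firstLoop_spec (a := a) pick
    exact ⟨W, [], hW, by rw [List.append_nil]; exact e, Or.inl (Nat.zero_le _)⟩
  | succ i ih =>
    obtain ⟨W, V, hV, e, h⟩ := ih
    have hd := decides_polyTest hV.reachable
    rw [Function.iterate_succ_apply', e]
    by_cases hc : ∀ w ∈ W ++ V, ∀ σ, ¬ a.2.2.EnlargesModule (W ++ V) (σ :: w)
    · exact ⟨W, V, hV, iteration_of_closed hd pick hc, Or.inr hc⟩
    · obtain ⟨w, hw, σ, hg, e'⟩ := iteration_of_not_closed hd pick hc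
      refine ⟨W, _, hV.snoc hw hg, by rw [← List.append_assoc]; exact e', Or.inl ?_⟩
      have := h.resolve_right hc
      rw [List.length_append, List.length_singleton]
      omega

theorem procedure_spec (pick : Val → Bool) :
    ∃ W, a.2.2.Returns W ∧ procedure pick a = W.map a.2.2.vecL := by
  obtain ⟨W, V, hV, e, h⟩ := procedure_iterate (a := a) pick (fuel a)
  have h1 := length_lt_wordBound hV.reachable
  have h2 := (fuel_bounds a).1
  refine ⟨W ++ V, ⟨hV.reachable, h.resolve_left ?_⟩, ?_⟩
  · simp only [List.length_append] at h1; omega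
  · rw [procedure, foldl_eq_iterate (iteration polyTest pick a), List.length_range, e]

theorem iterate_eq_of_fixed {β : Type} {f : β → β} {x y : β} {i k : ℕ} (h : f^[i] x = y)
    (hy : f y = y) (hik : i ≤ k) : f^[k] x = y := by
  obtain ⟨j, rfl⟩ := Nat.exists_eq_add_of_le' hik
  rw [Function.iterate_add_apply, h, Function.iterate_fixed hy]

/-- The list starts with one word, hence one round fewer than words; the remaining rounds up to
`fuel a` are idle. -/
theorem firstLoop_iterate_follow {T : List (List ℚ[X])} {W : List (List (Fin a.2.1))}
    (hW : a.2.2.First W) (hT : W.map a.2.2.vecL <+: T) :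
    (iteration ratTest (follow T) a)^[W.length - 1] [finalL a] = W.map a.2.2.vecL := by
  induction hW with
  | start => exact finalL_eq
  | @snoc W w σ h hw hg ih =>
    have hpos : 0 < W.length := List.length_pos_of_mem hw
    have hl : (W ++ [σ :: w]).length - 1 = (W.length - 1) + 1 := by
      rw [List.length_append, List.length_singleton]; omega
    rw [hl, Function.iterate_succ_apply', ih ?_]
    · exact iteration_follow (decides_ratTest h.reachable) hw hg hT
    · rw [List.map_append] at hT
      exact (List.prefix_append _ _).trans hT

theorem firstLoop_follow {T : List (List ℚ[X])} {W V : List (List (Fin a.2.1))}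
    (hV : a.2.2.Second W V) (hT : W.map a.2.2.vecL <+: T) :
    firstLoop (follow T) a = W.map a.2.2.vecL := by
  rw [firstLoop, foldl_eq_iterate (iteration ratTest (follow T) a), List.length_range]
  refine iterate_eq_of_fixed (firstLoop_iterate_follow hV.first hT) ?_ ?_
  · exact iteration_of_closed (decides_ratTest hV.first.reachable) _ hV.closed
  · have h1 := length_lt_wordBound hV.first.reachable
    have h2 := (fuel_bounds a).1
    simp only at h1
    omega

theorem procedure_iterate_follow {T : List (List ℚ[X])} {W V : List (List (Fin a.2.1))}
    (hV : a.2.2.Second W V) (hT : (W ++ V).map a.2.2.vecL <+: T) :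
    (iteration polyTest (follow T) a)^[V.length] (firstLoop (follow T) a) =
      (W ++ V).map a.2.2.vecL := by
  induction hV with
  | start h hg =>
    rw [List.append_nil] at hT ⊢
    exact firstLoop_follow (.start h hg) hT
  | @snoc V w σ h hw hg ih =>
    rw [← List.append_assoc] at hT ⊢
    rw [List.length_append, List.length_singleton, Function.iterate_succ_apply', ih ?_]
    · exact iteration_follow (decides_polyTest h.reachable) hw hg hT
    · rw [List.map_append] at hT
      exact (List.prefix_append _ _).trans hT

theorem procedure_follow {W : List (List (Fin a.2.1))} (h : a.2.2.Returns W) :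
    procedure (follow (W.map a.2.2.vecL)) a = W.map a.2.2.vecL := by
  obtain ⟨h1, h2⟩ := h
  rcases h1.cases with ⟨h3, -⟩ | ⟨-, W, V, e, hV⟩
  · simp at h3
  · simp only at e
    subst e
    rw [procedure, foldl_eq_iterate (iteration polyTest (follow _) a), List.length_range]
    refine iterate_eq_of_fixed (procedure_iterate_follow hV (List.prefix_refl _)) ?_ ?_
    · exact iteration_of_closed (decides_polyTest h1) _ h2
    · have h1 := length_lt_wordBound hV.reachable
      have h2 := (fuel_bounds a).1
      simp only [List.length_append] at h1
      omega

end Loops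

/-! ### Polynomial running time of the whole procedure. -/

/-- For every choice function the accumulator lists the vectors of a reachable state, so
`stateBound` bounds it uniformly, as `PT.foldl` requires. -/
theorem PT.firstLoop : PT firstLoop := by
  refine PT.foldl (l := fun a : Input => List.range (fuel a)) (b := fun _ a => [finalL a])
    (f := fun pick t => PFinite.iteration ratTest pick t.1 t.2.1) (g := stateBound) (by fun_prop)
    (show PD fun a : Input => [finalL a] by fun_prop) ?_ PB.stateBound ?_
  · exact (PT.iteration (show PD fun s : ℕ × List (List ℚ[X]) × List ℚ[X] =>
      ratTest s.1 s.2.1 s.2.2 by fun_prop)).comp (f := fun _ (t : Input × List (List ℚ[X]) × ℕ) =>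
        (t.1, t.2.1)) (show PD fun t : Input × List (List ℚ[X]) × ℕ => (t.1, t.2.1) by fun_prop)
  · intro pick a l₁ l₂ _
    rw [foldl_eq_iterate (PFinite.iteration ratTest pick a)]
    obtain ⟨W, hW, e, -⟩ := firstLoop_iterate (a := a) pick l₁.length
    rw [e]
    exact sz_map_vecL_le hW.reachable

theorem PT.procedure : PT procedure := by
  refine PT.foldl (l := fun a : Input => List.range (fuel a)) (b := PFinite.firstLoop)
    (f := fun pick t => PFinite.iteration polyTest pick t.1 t.2.1) (g := stateBound) (by fun_prop)
    PT.firstLoop ?_ PB.stateBound ?_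
  · exact (PT.iteration (show PD fun s : ℕ × List (List ℚ[X]) × List ℚ[X] =>
      polyTest s.1 s.2.1 s.2.2 by fun_prop)).comp (f := fun _ (t : Input × List (List ℚ[X]) × ℕ) =>
        (t.1, t.2.1)) (show PD fun t : Input × List (List ℚ[X]) × ℕ => (t.1, t.2.1) by fun_prop)
  · intro pick a l₁ l₂ _
    rw [foldl_eq_iterate (PFinite.iteration polyTest pick a)]
    obtain ⟨W, V, hV, e, -⟩ := procedure_iterate (a := a) pick l₁.length
    rw [e]
    exact sz_map_vecL_le hV.reachable

theorem enc_map_vecL {n s : ℕ} (A : Automaton n s) (W : List (List (Fin s))) :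
    Enc.enc (W.map A.vecL) = encVecs (A.output W) := by
  change encList ((W.map A.vecL).map Enc.enc) = encList ((W.map A.backward).map encVec)
  rw [List.map_map, List.map_map]
  congr 1
  refine List.map_congr_left fun u _ => ?_
  exact enc_ofFn _

end

end PFinite

/-- The procedure terminates on every P-finite automaton, whatever choices it makes; what it
returns generates the backward module; it collects at most `n d (n + 1) + n` words (and one less if
`d > 0`) when `n > 0`; and it can be executed, for all resolutions of its choices, in time
polynomial in the length of the encoding of the automaton. -/
theorem mainTheorem8 :
    (∀ (n s : ℕ) (A : Automaton n s),
      (¬ ∃ run : ℕ → State s, run 0 = State.start s ∧ ∀ i, A.Step (run i) (run (i + 1))) ∧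
      (∀ q : State s, A.Reachable q → (∀ q' : State s, ¬ A.Step q q') → A.Returns q.words) ∧
      (∀ W : List (List (Fin s)), A.Returns W →
        Submodule.span ℚ[X] {v | v ∈ A.output W} = A.backwardModule) ∧
      (∀ q : State s, A.Reachable q →
        q.words.length ≤ max 1 (n * (A.degree * (n + 1)) + n) ∧
        (0 < n → 0 < A.degree → q.words.length ≤ n * (A.degree * (n + 1)) + n - 1))) ∧
    ∃ (P : Prog) (p : Polynomial ℕ), ∀ (n s : ℕ) (A : Automaton n s),
      (∀ pick : Val → Bool, ∃ (W : List (List (Fin s))) (t : ℕ), A.Returns W ∧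
        Runs pick P A.encode (encVecs (A.output W)) t ∧ t ≤ p.eval A.encode.size) ∧
      (∀ W : List (List (Fin s)), A.Returns W → ∃ (pick : Val → Bool) (t : ℕ),
        Runs pick P A.encode (encVecs (A.output W)) t ∧ t ≤ p.eval A.encode.size) := by
  refine ⟨fun n s A => ⟨A.not_exists_infinite_run, fun q h hq => h.returns_of_stuck hq,
    fun W h => h.span_eq, fun q h => ⟨h.length_le_max, h.length_le_of_pos⟩⟩, ?_⟩
  obtain ⟨P, p, hP⟩ := PT.procedure
  refine ⟨P, p, fun n s A => ⟨fun pick => ?_, fun W hW => ?_⟩⟩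
  · obtain ⟨W, hW, e⟩ := procedure_spec (a := ⟨n, s, A⟩) pick
    obtain ⟨t, h1, h2⟩ := hP pick ⟨n, s, A⟩
    rw [e, enc_map_vecL] at h1
    exact ⟨W, t, hW, h1, h2⟩
  -- The program and its time bound do not depend on the choice function, so `follow` may be built
  -- from the prescribed output.
  · obtain ⟨t, h1, h2⟩ := hP (follow (W.map A.vecL)) ⟨n, s, A⟩
    rw [procedure_follow (a := ⟨n, s, A⟩) hW, enc_map_vecL] at h1
    exact ⟨_, t, h1, h2⟩
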